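/- **Setting.** Values are rationals (including integers) and lists of values; $\mathrm{Mem}[S]=S\to\mathrm{Val}$ for a finite set $S$ of variables, and $\pi_S$ denotes restriction of memories to $S$. Commands are $C::=\mathsf{skip}\mid C;C\mid C\parallel C\mid \mathsf{if}\ b\ \mathsf{then}\ C\ \mathsf{else}\ C\mid\mathsf{while}\ b\ C\mid x:=e\mid x:\approx d(e)$, with $d$ a Bernoulli, geometric or uniform distribution; reading or writing a variable that is absent from the memory, or sampling with an illegal parameter, is a fault. *Outcomes.* Sets of outcomes are sets of discrete distributions on $\mathrm{Mem}[V]\cup\{\bot\}$, where $\bot$ stands for divergence and faults; $\bot_{\mathcal C}$ is the set of all of them and suprema are intersections. For $f:\mathrm{Mem}[V]\to\mathcal C(\mathrm{Mem}[V])$ put $f^\dagger(S)=\{\sum_x\mu(x)\nu_x\mid \mu\in S,\ \nu_x\in f(x)\text{ for } x\in\mathrm{supp}\,\mu,\ x\ne\bot,\ \nu_\bot\in\bot_{\mathcal C}\}$ and $f^\dagger(\mu)=f^\dagger(\{\mu\})$. For an event $A\subseteq\mathrm{Mem}[V]$ let $\mathrm{minProb}(S,A)=\inf_{\mu\in S}\mu(A)$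 and $\mathrm{minterm}(S)=\mathrm{minProb}(S,\mathrm{Mem}[V])$. *Programs.* For a finite $\mathcal I\subseteq\mathrm{Mem}[T]$, $\mathcal L^{\mathcal I}(C):\mathrm{Mem}[V]\to\mathcal C(\mathrm{Mem}[V])$ is the invariant sensitive semantics of $C$: the linearization of the pomset with formulae denoted by $C$, i.e. the supremum, over all finite approximations of that pomset, of the outcomes of all (randomized) schedules that respect causality and the results of tests. Each atomic action faults unless $\pi_T(\sigma)\in\mathcal I$, then replaces the $T$-part of the memory by an arbitrary (possibly random) element of $\mathcal I$, acts, and faults unless the $T$-part is again in $\mathcal I$. *Assertions.* A pure assertion $P$ is satisfied by a context $\Gamma:\mathrm{LVar}\to\mathrm{Val}$ and a memory; $[\![P]\!]_\Gamma^S\subseteq\mathrm{Mem}[S]$ is its set of satisfying memories, and $[\![P]\!]_\Gamma=[\![P]\!]_\Gamma^{\mathrm{fv}(P)}$. A probabilistic assertion is built from $\top,\bot,\wedge,\vee,\exists X$, the outcome conjunctions $\bigoplus_{X\sim d(E)}$ and $\&_{X\in E}$ (with binary form $\varphi\mathbin\&\psi$), strong and weak separating conjunctions, and $\lceil P\rceil$.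 It is interpreted in $\Gamma$ and a complete probability space $\mathcal P=\langle\mathrm{Mem}[S],\mathcal F,\mu\rangle$. A distribution $\mu$ on $\mathrm{Mem}[S]$ counts as the space in which all subsets are events. $\mathcal P\preceq\mathcal Q$ means that $\mathcal Q$ refines $\mathcal P$ (more variables, more events, the same probabilities for the events of $\mathcal P$). $\lceil P\rceil$ says that $[\![P]\!]^S_\Gamma$ is an event of probability 1. $\varphi*\psi$ holds in $\mathcal P$ iff $\mathcal P_1\otimes\mathcal P_2\preceq\mathcal P$ for an independent product of spaces $\mathcal P_1\vDash\varphi$, $\mathcal P_2\vDash\psi$ over disjoint sets of variables. $\varphi\mathbin\&\psi$ holds in $\mathcal P$ iff $\mathcal P$ refines a direct sum, with some weights $q,1-q$, of complete spaces with disjoint sample spaces whose extensions by null sets to all memories satisfy $\varphi$ and $\psi$ respectively (a summand of weight $0$ being omitted). $\psi$ is *precise* if for every $\Gamma$ under which it is satisfiable there is a $\preceq$-smallest space satisfying it. *Triples.* $I\vDash_{\mathsf w}\langle\varphi\rangle C\langle\psi\rangle$ means: for all $\Gamma$, all distributions $\mu$ on memories, all spaces $\mathcal P,\mathcal P_F$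 over disjoint sets of variables and every space $\mathcal P'\preceq\mu$ over the union of these sets with projections $\mathcal P$ and $\mathcal P_F$, if $\Gamma,\mathcal P\vDash\varphi*\lceil I\rceil$, then for every $\nu\in\mathcal L^{[\![I]\!]_\Gamma}(C)^\dagger(\mu)$ we have $\nu(\bot)=0$, and there are $\mathcal Q$ and $\mathcal Q'\preceq\nu$, where $\mathcal Q'$ has projections $\mathcal Q$ and $\mathcal P_F$ (over disjoint sets of variables), with $\Gamma,\mathcal Q\vDash\psi*\lceil I\rceil$. **Statement.** Let $I$ be a pure assertion such that $[\![I]\!]_{\Gamma'}$ is finite for every context $\Gamma'$. Let $\langle\varphi,\psi\rangle$ be a loop invariant pair for $\mathsf{while}\ b\ C$ under $I$, that is: (1) $\varphi\Rightarrow\lceil b\mapsto\mathsf{true}\rceil$; (2) $\psi\Rightarrow\lceil b\mapsto\mathsf{false}\rceil$; (3) $I\vDash_{\mathsf w}\langle\varphi\rangle C\langle\varphi\mathbin\&\psi\rangle$; (4) $\psi$ is precise. Fix a context $\Gamma$ and a finite set $V$ of variables, and put $\mathcal I=[\![I]\!]_\Gamma$ and $L=\mathcal L^{\mathcal I}(\mathsf{while}\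 b\ C)$ on $\mathrm{Mem}[V]$. (a) Let $\mathcal Q$ be the smallest space satisfying $\psi$ under $\Gamma$. For every distribution $\mu$ on $\mathrm{Mem}[V]$ with $\Gamma,\mu\vDash\varphi*\lceil I\rceil$ and every event $A\in\mathcal F_{\mathcal Q}$, $$\mathrm{minProb}\bigl(L^\dagger(\mu),\,A*\mathcal I\bigr)=\mathrm{minterm}\bigl(L^\dagger(\mu)\bigr)\cdot\mu_{\mathcal Q}(A),$$ where $A*\mathcal I$ is the set of memories in $\mathrm{Mem}[V]$ that extend a disjoint union of a memory in $A$ and a memory in $\mathcal I$. (b) (Almost sure termination.) Let $0<p\le1$. If $\mathrm{minterm}(L^\dagger(\mu))\ge p$ for all distributions $\mu$ on $\mathrm{Mem}[V]$ with $\Gamma,\mu\vDash\varphi*\lceil I\rceil$, then $\mathrm{minterm}(L^\dagger(\mu))=1$ for all such $\mu$. -/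

import Mathlib

open scoped ENNReal
open MeasureTheory

namespace PCOL

noncomputable section

/-! ## Values, memories, expressions -/

/-- Program variables. -/
abbrev Var := ℕ

/-- Logical variables. -/
abbrev LVar := ℕ

/-- Values: rational numbers (the integers among them) and lists of values. -/
inductive Val : Type
  | num (q : ℚ)
  | list (l : List Val)

/-- The truth values `0` and `1` as values. -/
def Val.ofBool (r : Bool) : Val := Val.num (if r then 1 else 0)

/-- Memories over a finite set of variables. -/
abbrev Mem (S : Finset Var) : Type := {x // x ∈ S} → Val

/-- The projection of a memory to a smaller set of variables. -/
def proj {S T : Finset Var} (h : S ⊆ T) (σ : Mem T) : Mem S := fun x => σ ⟨x.1, h x.2⟩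

/-- The assignment `σ[x := v]`. -/
def Mem.set {S : Finset Var} (σ : Mem S) (x : Var) (v : Val) : Mem S :=
  fun y => if y.1 = x then v else σ y

/-- A total store that agrees with `σ` on `S`. Only its values on `S` are ever used. -/
def Mem.toStore {S : Finset Var} (σ : Mem S) : Var → Val :=
  fun x => if h : x ∈ S then σ ⟨x, h⟩ else Val.num 0

mutual
/-- Program expressions. The constructor `op` covers list literals, list accesses, arithmetic and
every other total operation on values. -/
inductive Exp : Type
  | var (x : Var)
  | val (v : Val)
  | test (b : Test)
  | op (n : ℕ) (f : (Fin n → Val) → Val) (args : Fin n → Exp)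
/-- Tests. The constructor `cmp` covers all comparisons of values. -/
inductive Test : Type
  | tru
  | fls
  | and (b₁ b₂ : Test)
  | or (b₁ b₂ : Test)
  | not (b : Test)
  | cmp (r : Val → Val → Bool) (e₁ e₂ : Exp)
end

mutual
/-- Free variables of an expression. -/
def Exp.fv : Exp → Finset Var
  | .var x => {x}
  | .val _ => ∅
  | .test b => b.fv
  | .op _ _ args => Finset.univ.biUnion (fun i => (args i).fv)
/-- Free variables of a test. -/
def Test.fv : Test → Finset Var
  | .tru => ∅
  | .fls => ∅
  | .and b₁ b₂ => b₁.fv ∪ b₂.fv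
  | .or b₁ b₂ => b₁.fv ∪ b₂.fv
  | .not b => b.fv
  | .cmp _ e₁ e₂ => e₁.fv ∪ e₂.fv
end

mutual
/-- Value of an expression in a total store. -/
def Exp.evalStore : Exp → (Var → Val) → Val
  | .var x, s => s x
  | .val v, _ => v
  | .test b, s => Val.ofBool (b.evalStore s)
  | .op _ f args, s => f (fun i => (args i).evalStore s)
/-- Value of a test in a total store. -/
def Test.evalStore : Test → (Var → Val) → Bool
  | .tru, _ => true
  | .fls, _ => false
  | .and b₁ b₂, s => b₁.evalStore s && b₂.evalStore s
  | .or b₁ b₂, s => b₁.evalStore s || b₂.evalStore s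
  | .not b, s => !(b.evalStore s)
  | .cmp r e₁ e₂, s => r (e₁.evalStore s) (e₂.evalStore s)
end

/-- Value of an expression in a memory, undefined unless all free variables are present. -/
def Exp.eval (e : Exp) {S : Finset Var} (σ : Mem S) : Option Val :=
  if e.fv ⊆ S then some (e.evalStore σ.toStore) else none

/-- Value of a test in a memory, undefined unless all free variables are present. -/
def Test.eval (b : Test) {S : Finset Var} (σ : Mem S) : Option Bool :=
  if b.fv ⊆ S then some (b.evalStore σ.toStore) else none

/-- The Bernoulli distribution on the values `1` (probability `p`) and `0`. -/
def bernPMF (p : ℝ) (h₀ : 0 ≤ p) (h₁ : p ≤ 1) : PMF Val :=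
  (PMF.ofFintype (fun r : Bool => if r then ENNReal.ofReal p else ENNReal.ofReal (1 - p)) (by
    simp only [Fintype.sum_bool, if_true, Bool.false_eq_true, if_false]
    rw [← ENNReal.ofReal_add h₀ (by linarith)]
    simp)).map Val.ofBool

/-- The geometric distribution on natural numbers, `n` having probability `(1 - p) ^ n * p`. -/
def geoPMF (p : ℝ) (h₀ : 0 < p) (h₁ : p ≤ 1) : PMF Val :=
  PMF.map (fun n : ℕ => Val.num n)
    (⟨fun n => ENNReal.ofReal ((1 - p) ^ n * p), by
      have hs : HasSum (fun n : ℕ => (1 - p) ^ n * p) 1 := by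
        have := (hasSum_geometric_of_lt_one (r := 1 - p) (by linarith) (by linarith)).mul_right p
        simpa [h₀.ne'] using this
      have hn : ∀ n : ℕ, 0 ≤ (1 - p) ^ n * p := fun n =>
        mul_nonneg (pow_nonneg (by linarith) n) h₀.le
      have := ENNReal.ofReal_tsum_of_nonneg hn hs.summable
      rw [hs.tsum_eq, ENNReal.ofReal_one] at this
      rw [this]
      exact ENNReal.summable.hasSum⟩ : PMF ℕ)

/-- Names of the discrete distributions. -/
inductive Dist : Type
  | bern
  | geo
  | unif

open Classical in
/-- The distribution `d(v)`, undefined if `v` is not a legal parameter. -/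
def Dist.eval : Dist → Val → Option (PMF Val)
  | .bern, .num q => if h : (0 : ℝ) ≤ q ∧ (q : ℝ) ≤ 1 then some (bernPMF q h.1 h.2) else none
  | .geo, .num q => if h : (0 : ℝ) < q ∧ (q : ℝ) ≤ 1 then some (geoPMF q h.1 h.2) else none
  | .unif, .list l => if h : (l : Multiset Val) ≠ 0 then some (PMF.ofMultiset l h) else none
  | _, _ => none

/-! ## Commands -/

/-- Atomic actions. -/
inductive Action : Type
  | assign (x : Var) (e : Exp)
  | sample (x : Var) (d : Dist) (e : Exp)

/-- Commands. -/
inductive Cmd : Type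
  | skip
  | seq (C₁ C₂ : Cmd)
  | par (C₁ C₂ : Cmd)
  | ite (b : Test) (C₁ C₂ : Cmd)
  | while (b : Test) (C : Cmd)
  | act (a : Action)

/-! ## The convex powerset -/

/-- Sets of distributions on `X` with an added bottom element (`none`), which stands for divergence
and faults. All sets formed below are nonempty, convex, up-closed and Cauchy closed, so that the
order of the convex powerset is reverse inclusion and directed suprema are intersections. -/
abbrev CSet (X : Type) : Type := Set (PMF (Option X))

/-- The least element: all distributions. -/
def CSet.bot {X : Type} : CSet X := Set.univ

/-- The unit. -/
def CSet.eta {X : Type} (x : X) : CSet X := {PMF.pure (some x)}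

/-- The extension of `f` to the bottom element. -/
def CSet.strict {X Y : Type} (f : X → CSet Y) : Option X → CSet Y
  | none => CSet.bot
  | some x => f x

/-- The Kleisli extension. -/
def CSet.bind {X Y : Type} (f : X → CSet Y) (S : CSet X) : CSet Y :=
  {ρ | ∃ μ ∈ S, ∃ ν : Option X → PMF (Option Y),
    (∀ x ∈ μ.support, ν x ∈ CSet.strict f x) ∧ ρ = μ.bind ν}

/-- The Kleisli extension applied to a single proper distribution. -/
def CSet.bindPMF {X Y : Type} (f : X → CSet Y) (μ : PMF X) : CSet Y :=
  CSet.bind f {μ.map some}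

/-- The convex union of a finite nonempty family. -/
def CSet.nd {X ι : Type} (S : ι → CSet X) : CSet X :=
  {ρ | ∃ (w : PMF ι) (ν : ι → PMF (Option X)), (∀ i, ν i ∈ S i) ∧ ρ = w.bind ν}

/-- The minimum probability of the event `A`. -/
def minProb {X : Type} (S : CSet X) (A : Set X) : ℝ≥0∞ :=
  ⨅ μ ∈ S, PMF.toOuterMeasure μ (some '' A)

/-- The minimum probability of termination. -/
def minTerm {X : Type} (S : CSet X) : ℝ≥0∞ := minProb S Set.univ

/-! ## Actions and invariants -/

/-- The plain semantics of actions. -/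
def Action.sem (a : Action) {S : Finset Var} (σ : Mem S) : CSet (Mem S) :=
  match a with
  | .assign x e =>
    match e.eval σ with
    | some v => if x ∈ S then CSet.eta (σ.set x v) else CSet.bot
    | none => CSet.bot
  | .sample x d e =>
    match (e.eval σ).bind d.eval with
    | some μ => if x ∈ S then {μ.map (fun v => some (σ.set x v))} else CSet.bot
    | none => CSet.bot

section invariant

variable {S T : Finset Var} (J : Set (Mem T))

open Classical in
/-- Faults unless the shared part of the memory satisfies the invariant. -/
def check (σ : Mem S) : CSet (Mem S) :=
  if ∃ h : T ⊆ S, proj h σ ∈ J then CSet.eta σ else CSet.bot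

/-- Replaces the shared part of the memory. -/
def overwrite (σ : Mem S) (τ : Mem T) : Mem S :=
  fun x => if h : x.1 ∈ T then τ ⟨x.1, h⟩ else σ x

/-- Replaces the shared part of the memory by an arbitrary legal one. -/
def replace (σ : Mem S) : CSet (Mem S) :=
  CSet.nd (fun τ : J => CSet.eta (overwrite σ τ.1))

/-- The invariant sensitive semantics of actions. -/
def Action.semInv (a : Action) (σ : Mem S) : CSet (Mem S) :=
  CSet.bind (check J) (CSet.bind a.sem (CSet.bind (replace J) (check J σ)))

end invariant

/-! ## Pomsets with formulae

A pomset is an isomorphism class of labelled partial orders with formulae (LPOFs). Linearization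
is computed on a representative, so the operations below are given on representatives, whose nodes
are taken from one fixed countable universe. -/

/-- Labels: actions, tests, no-ops and the undetermined label. -/
inductive Label : Type
  | act (a : Action)
  | test (b : Test)
  | fork
  | bot

/-- The universe of nodes. `copy l x` is the node `x` in the copy, indexed by the
list `l` of test outcomes, of the second operand of a sequential composition. -/
inductive Node : Type
  | root
  | left (x : Node)
  | right (x : Node)
  | copy (l : List (Node × Bool)) (x : Node)

/-- Boolean formulae over nodes up to equivalence: sets of valuations. -/
abbrev Form : Type := (Node → Bool) → Prop

/-- The data of an LPOF. -/
structure LPOF : Type where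
  /-- The nodes. -/
  N : Set Node
  /-- The causal order. -/
  lt : Node → Node → Prop
  /-- The labels. -/
  lab : Node → Label
  /-- The formula of a node: which tests must have passed or failed to reach it. -/
  form : Node → Form

namespace LPOF

/-- One node. -/
def single (ℓ : Label) : LPOF where
  N := {Node.root}
  lt _ _ := False
  lab _ := ℓ
  form _ _ := True

/-- Guarded choice: a new root labelled by the test. -/
def guard (b : Test) (α β : LPOF) : LPOF where
  N := {z | z = .root ∨ (∃ x ∈ α.N, z = .left x) ∨ ∃ x ∈ β.N, z = .right x}
  lt
    | .root, .left _ => True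
    | .root, .right _ => True
    | .left x, .left y => α.lt x y
    | .right x, .right y => β.lt x y
    | _, _ => False
  lab
    | .left x => α.lab x
    | .right x => β.lab x
    | _ => .test b
  form
    | .left x, v => v .root = true ∧ α.form x (fun z => v (.left z))
    | .right x, v => v .root = false ∧ β.form x (fun z => v (.right z))
    | _, _ => True

/-- Parallel composition: a new no-op root. -/
def par (α β : LPOF) : LPOF where
  N := {z | z = .root ∨ (∃ x ∈ α.N, z = .left x) ∨ ∃ x ∈ β.N, z = .right x}
  lt
    | .root, .left _ => True
    | .root, .right _ => True
    | .left x, .left y => α.lt x y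
    | .right x, .right y => β.lt x y
    | _, _ => False
  lab
    | .left x => α.lab x
    | .right x => β.lab x
    | _ => .fork
  form
    | .left x, v => α.form x (fun z => v (.left z))
    | .right x, v => β.form x (fun z => v (.right z))
    | _, _ => True

/-- The formula stating the listed test outcomes. -/
def outcomes (l : List (Node × Bool)) : Form := fun v => ∀ p ∈ l, v p.1 = p.2

/-- The nodes that are executed when the tests have the listed outcomes. -/
def reached (α : LPOF) (l : List (Node × Bool)) : Set Node :=
  {x ∈ α.N | ∀ v, outcomes l v → α.form x v}

/-- The listed test outcomes describe a complete finite execution of `α`: they decide exactly the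
tests that are executed, they contradict the formulae of all nodes that are not executed, and no
undetermined node is executed. The first clause makes the listing of each finite set of outcomes
canonical. -/
def Terminal (α : LPOF) (l : List (Node × Bool)) : Prop :=
  (∃ t : Finset (Node × Bool), l = t.toList) ∧
  (∃ v, outcomes l v) ∧
  (α.reached l).Finite ∧
  (∀ x, (∃ r, (x, r) ∈ l) ↔ x ∈ α.reached l ∧ ∃ b, α.lab x = .test b) ∧
  (∀ x ∈ α.N, x ∉ α.reached l → ∀ v, outcomes l v → ¬ α.form x v) ∧
  (∀ x ∈ α.reached l, α.lab x ≠ .bot)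

/-- Sequential composition: each complete finite execution of `α` is followed by its own copy
of `β`. -/
def seq (α β : LPOF) : LPOF where
  N := {z | (∃ x ∈ α.N, z = .left x) ∨ ∃ l, α.Terminal l ∧ ∃ y ∈ β.N, z = .copy l y}
  lt
    | .left x, .left y => α.lt x y
    | .left x, .copy l _ => x ∈ α.reached l
    | .copy l x, .copy l' y => l = l' ∧ β.lt x y
    | _, _ => False
  lab
    | .left x => α.lab x
    | .copy _ y => β.lab y
    | _ => .bot
  form
    | .left x, v => α.form x (fun z => v (.left z))
    | .copy l y, v =>
      outcomes l (fun z => v (.left z)) ∧ β.form y (fun z => v (.copy l z))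
    | _, _ => True

open Classical in
/-- The supremum of an increasing sequence, where each member arises from the previous one by
replacing nodes labelled `bot` by larger structures. -/
def sup (α : ℕ → LPOF) : LPOF where
  N := {x | ∃ n, x ∈ (α n).N}
  lt x y := ∃ n, x ∈ (α n).N ∧ y ∈ (α n).N ∧ (α n).lt x y
  lab x :=
    if h : ∃ n, x ∈ (α n).N ∧ (α n).lab x ≠ .bot then (α h.choose).lab x else .bot
  form x v := ∃ n, x ∈ (α n).N ∧ (α n).form x v

/-- The least fixed point, as the supremum of the finite unrollings, of
`γ ↦ guard b (α ; γ) •`. -/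
def loop (b : Test) (α : LPOF) : LPOF :=
  sup (fun n => (fun γ => guard b (α.seq γ) (single .fork))^[n] (single .bot))

open Classical in
/-- The approximation of `α` that is obtained by cutting off everything above the nodes in `K`
and labelling the nodes in `K` by `bot`. Up to isomorphism, all approximations of `α` in the
order of pomsets have this form. -/
def cut (α : LPOF) (K : Set Node) : LPOF where
  N := {x ∈ α.N | ¬ ∃ k ∈ K, α.lt k x}
  lt := α.lt
  lab x := if x ∈ K then .bot else α.lab x
  form := α.form

/-- The nodes that are ready to be scheduled, given the path condition `ψ` and the set `S` of nodes
that have already been processed. -/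
def next (α : LPOF) (ψ : Form) (S : Set Node) : Set Node :=
  {x ∈ α.N | x ∉ S ∧ (∀ y ∈ α.N, α.lt y x → y ∈ S) ∧ ∀ v, ψ v → α.form x v}

end LPOF

/-- The trace semantics of commands. -/
def Cmd.den : Cmd → LPOF
  | .skip => LPOF.single .fork
  | .seq C₁ C₂ => LPOF.seq C₁.den C₂.den
  | .par C₁ C₂ => LPOF.par C₁.den C₂.den
  | .ite b C₁ C₂ => LPOF.guard b C₁.den C₂.den
  | .while b C => LPOF.loop b C.den
  | .act a => LPOF.single (.act a)

section linearization

variable {T : Finset Var} (J : Set (Mem T)) {V : Finset Var}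

open Classical in
/-- Linearization of a finite LPOF from the path condition `ψ` and the processed nodes `S`. A test
that reads a missing variable is a fault. -/
def linLPOF (α : LPOF) (hα : α.N.Finite) (ψ : Form) (S : Set Node) (σ : Mem V) : CSet (Mem V) :=
  if α.next ψ S = ∅ then CSet.eta σ
  else CSet.nd (fun x : α.next ψ S =>
    match α.lab x.1 with
    | .act a => CSet.bind (fun τ => linLPOF α hα ψ (insert x.1 S) τ) (a.semInv J σ)
    | .test b =>
      match b.eval σ with
      | some r => linLPOF α hα (fun v => ψ v ∧ v x.1 = r) (insert x.1 S) σ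
      | none => CSet.bot
    | .bot => CSet.bot
    | .fork => linLPOF α hα ψ (insert x.1 S) σ)
termination_by (α.N \ S).ncard
decreasing_by
  all_goals
    apply Set.ncard_lt_ncard _ (hα.subset Set.sdiff_subset)
    refine ⟨fun y hy => ⟨hy.1, fun h => hy.2 (Set.mem_insert_of_mem _ h)⟩, fun h => ?_⟩
    exact (h ⟨x.2.1, x.2.2.1⟩).2 (Set.mem_insert _ _)

/-- Linearization: the supremum of the linearizations of all finite approximations. -/
def linPom (α : LPOF) (σ : Mem V) : CSet (Mem V) :=
  {ρ | ∀ (K : Set Node) (_ : K ⊆ α.N) (h : (α.cut K).N.Finite),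
    ρ ∈ linLPOF J (α.cut K) h (fun _ => True) ∅ σ}

/-- The invariant sensitive state transformer of a command. -/
def lin (C : Cmd) (σ : Mem V) : CSet (Mem V) := linPom J C.den σ

end linearization

/-! ## Pure assertions -/

/-- Logical contexts. -/
abbrev Ctx : Type := LVar → Val

/-- Logical expressions. -/
inductive LExp : Type
  | lvar (X : LVar)
  | val (v : Val)
  | op (n : ℕ) (f : (Fin n → Val) → Val) (args : Fin n → LExp)

/-- Value of a logical expression. -/
def LExp.eval : LExp → Ctx → Val
  | .lvar X, Γ => Γ X
  | .val v, _ => v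
  | .op _ f args, Γ => f (fun i => (args i).eval Γ)

/-- Pure assertions. The constructor `cmp` covers all comparisons of values. -/
inductive Pure : Type
  | tru
  | fls
  | and (P Q : Pure)
  | or (P Q : Pure)
  | sep (P Q : Pure)
  | ex (X : LVar) (P : Pure)
  | pointsTo (e : Exp) (E : LExp)
  | cmp (r : Val → Val → Prop) (E₁ E₂ : LExp)

/-- Free program variables. -/
def Pure.fv : Pure → Finset Var
  | .tru => ∅
  | .fls => ∅
  | .and P Q => P.fv ∪ Q.fv
  | .or P Q => P.fv ∪ Q.fv
  | .sep P Q => P.fv ∪ Q.fv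
  | .ex _ P => P.fv
  | .pointsTo e _ => e.fv
  | .cmp _ _ _ => ∅

/-- Satisfaction of pure assertions. -/
def Pure.Sat : Pure → Ctx → {S : Finset Var} → Mem S → Prop
  | .tru, _, _, _ => True
  | .fls, _, _, _ => False
  | .and P Q, Γ, _, σ => P.Sat Γ σ ∧ Q.Sat Γ σ
  | .or P Q, Γ, _, σ => P.Sat Γ σ ∨ Q.Sat Γ σ
  | .sep P Q, Γ, S, σ => ∃ (S₁ S₂ : Finset Var) (h₁ : S₁ ⊆ S) (h₂ : S₂ ⊆ S),
      Disjoint S₁ S₂ ∧ P.Sat Γ (proj h₁ σ) ∧ Q.Sat Γ (proj h₂ σ)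
  | .ex X P, Γ, _, σ => ∃ v : Val, P.Sat (Function.update Γ X v) σ
  | .pointsTo e E, Γ, _, σ => e.eval σ = some (E.eval Γ)
  | .cmp r E₁ E₂, Γ, _, _ => r (E₁.eval Γ) (E₂.eval Γ)

/-- The memories over `S` that satisfy `P`. -/
def Pure.sem (P : Pure) (Γ : Ctx) (S : Finset Var) : Set (Mem S) := {σ | P.Sat Γ σ}

/-- The memories over the free variables of `P` that satisfy `P`. -/
def Pure.semFv (P : Pure) (Γ : Ctx) : Set (Mem P.fv) := P.sem Γ P.fv

/-- Finitary assertions, which may serve as resource invariants. -/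
def Pure.Finitary (P : Pure) : Prop := ∀ Γ : Ctx, (P.semFv Γ).Finite

/-- The pure assertion that a test has a given truth value. -/
def Pure.testIs (b : Test) (r : Bool) : Pure := .pointsTo (.test b) (.val (Val.ofBool r))

/-! ## Probability spaces -/

/-- Probability spaces whose sample space consists of memories over `S`. -/
structure PSpace (S : Finset Var) : Type where
  /-- The sample space. -/
  Ω : Set (Mem S)
  /-- The event space. -/
  F : MeasurableSpace Ω
  /-- The measure. -/
  μ : @Measure Ω F
  /-- The total mass is one. -/
  isProb : @IsProbabilityMeasure Ω F μ

namespace PSpace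

variable {S T W : Finset Var}

/-- `A` is a measurable event. -/
def Event (P : PSpace S) (A : Set (Mem S)) : Prop :=
  A ⊆ P.Ω ∧ MeasurableSet[P.F] (Subtype.val ⁻¹' A : Set P.Ω)

/-- The probability of an event. -/
def prob (P : PSpace S) (A : Set (Mem S)) : ℝ≥0∞ := P.μ (Subtype.val ⁻¹' A : Set P.Ω)

/-- Completeness: all subsets of null events are events. -/
def Complete (P : PSpace S) : Prop := @Measure.IsComplete P.Ω P.F P.μ

/-- The spaces in which assertions are interpreted: complete, with all memories as samples. -/
def Model (P : PSpace S) : Prop := P.Ω = Set.univ ∧ P.Complete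

/-- A discrete distribution as a probability space in which every set is an event. -/
def ofPMF (μ : PMF (Mem S)) : PSpace S where
  Ω := Set.univ
  F := ⊤
  μ := @PMF.toMeasure _ ⊤ (μ.map (fun σ => (⟨σ, trivial⟩ : (Set.univ : Set (Mem S)))))
  isProb := @PMF.toMeasure.isProbabilityMeasure _ ⊤ _

/-- `Q` contains at least the information of `P`. -/
def Le (P : PSpace S) (Q : PSpace T) : Prop :=
  ∃ h : S ⊆ T,
    P.Ω ⊆ proj h '' Q.Ω ∧
    (∀ A, P.Event A → ∃ B, Q.Event B ∧ proj h '' B = A) ∧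
    ∀ A, P.Event A → P.prob A = Q.prob (⋃₀ {B | Q.Event B ∧ proj h '' B = A})

/-- `R` is the extension of `P` to all memories. -/
def IsComp (P R : PSpace S) : Prop :=
  R.Ω = Set.univ ∧ (∀ A, R.Event A ↔ P.Event (A ∩ P.Ω)) ∧
    ∀ A, R.Event A → R.prob A = P.prob (A ∩ P.Ω)

/-- The set `A ∗ B` of joined memories, inside the memories over `W ⊇ S ∪ T`: all memories
that extend a disjoint union of a member of `A` and a member of `B`. -/
def star (W : Finset Var) (A : Set (Mem S)) (B : Set (Mem T)) : Set (Mem W) :=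
  {ρ | Disjoint S T ∧ ∃ (hS : S ⊆ W) (hT : T ⊆ W), proj hS ρ ∈ A ∧ proj hT ρ ∈ B}

/-- `R` is the independent product of `P` and `Q`. -/
def IsProd (P : PSpace S) (Q : PSpace T) (R : PSpace W) : Prop :=
  Disjoint S T ∧ W = S ∪ T ∧ R.Ω = star W P.Ω Q.Ω ∧
  R.F = MeasurableSpace.generateFrom
    {D | ∃ A B, P.Event A ∧ Q.Event B ∧ D = Subtype.val ⁻¹' star W A B} ∧
  ∀ A B, P.Event A → Q.Event B → R.prob (star W A B) = P.prob A * Q.prob B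

/-- `P` is the projection of `R` to the variables `S`. -/
def IsProj (R : PSpace W) (P : PSpace S) : Prop :=
  ∃ h : S ⊆ W,
    P.Ω = proj h '' R.Ω ∧
    (∀ A, P.Event A ↔ ∃ B, R.Event B ∧ proj h '' B = A) ∧
    ∀ A, P.Event A →
      R.Event (star W A (proj (Finset.sdiff_subset (s := W) (t := S)) '' R.Ω)) ∧
      P.prob A = R.prob (star W A (proj (Finset.sdiff_subset (s := W) (t := S)) '' R.Ω))

/-- `R` is the direct sum of the spaces `P i` with weights `ν`; only the indices in the support of
`ν` matter. -/
def IsDirectSum {ι : Type} (ν : PMF ι) (P : ι → PSpace S) (R : PSpace S) : Prop :=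
  (∀ i ∈ ν.support, ∀ j ∈ ν.support, i ≠ j → Disjoint (P i).Ω (P j).Ω) ∧
  R.Ω = {σ | ∃ i ∈ ν.support, σ ∈ (P i).Ω} ∧
  (∀ A, R.Event A ↔ A ⊆ R.Ω ∧ ∀ i ∈ ν.support, (P i).Event (A ∩ (P i).Ω)) ∧
  ∀ A, R.Event A → R.prob A = ∑' i, ν i * (P i).prob (A ∩ (P i).Ω)

end PSpace

/-- Modes of separation. -/
inductive Mode : Type
  | strong
  | weak

/-- `R` combines `P` and `Q`: as their independent product (strong) or as any space over the
disjoint union of the variables that has `P` and `Q` as its projections (weak). -/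
def Combine {S T W : Finset Var} (m : Mode) (P : PSpace S) (Q : PSpace T) (R : PSpace W) : Prop :=
  match m with
  | .strong => PSpace.IsProd P Q R
  | .weak => Disjoint S T ∧ W = S ∪ T ∧ PSpace.IsProj R P ∧ PSpace.IsProj R Q

/-! ## Probabilistic assertions -/

/-- Probabilistic assertions. `oplus X d E φ` and `bigNd X E φ` are the outcome conjunctions
over `X ∼ d(E)` and over `X ∈ E`, and `nd φ ψ` is the binary form of the latter. -/
inductive Assertion : Type
  | top
  | bot
  | and (φ ψ : Assertion)
  | or (φ ψ : Assertion)
  | ex (X : LVar) (φ : Assertion)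
  | oplus (X : LVar) (d : Dist) (E : LExp) (φ : Assertion)
  | bigNd (X : LVar) (E : LExp) (φ : Assertion)
  | nd (φ ψ : Assertion)
  | sep (m : Mode) (φ ψ : Assertion)
  | sure (P : Pure)

/-- `P` refines a direct sum, with weights `ν`, of complete spaces whose extensions satisfy the
respective `K i`. -/
def OutcomeSat {ι : Type} (ν : PMF ι) (K : ι → (S : Finset Var) → PSpace S → Prop)
    {S : Finset Var} (P : PSpace S) : Prop :=
  ∃ (T : Finset Var) (Q : ι → PSpace T) (R : PSpace T),
    (∀ i ∈ ν.support, (Q i).Complete ∧ ∃ Q', PSpace.IsComp (Q i) Q' ∧ K i T Q') ∧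
    PSpace.IsDirectSum ν Q R ∧ PSpace.Le R P

/-- Satisfaction of probabilistic assertions in a context and a space `P` with `P.Model`. -/
def Assertion.Sat : Assertion → Ctx → {S : Finset Var} → PSpace S → Prop
  | .top, _, _, _ => True
  | .bot, _, _, _ => False
  | .and φ ψ, Γ, _, P => φ.Sat Γ P ∧ ψ.Sat Γ P
  | .or φ ψ, Γ, _, P => φ.Sat Γ P ∨ ψ.Sat Γ P
  | .ex X φ, Γ, _, P => ∃ v : Val, φ.Sat (Function.update Γ X v) P
  | .oplus X d E φ, Γ, _, P => ∃ ν : PMF Val, d.eval (E.eval Γ) = some ν ∧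
      OutcomeSat ν (fun v _ Q => φ.Sat (Function.update Γ X v) Q) P
  | .bigNd X E φ, Γ, _, P => ∃ ν : PMF Val,
      (∃ l : List Val, E.eval Γ = .list l ∧ ∀ v ∈ ν.support, v ∈ l) ∧
      OutcomeSat ν (fun v _ Q => φ.Sat (Function.update Γ X v) Q) P
  | .nd φ ψ, Γ, _, P => ∃ ν : PMF Bool,
      OutcomeSat ν (fun r _ Q => (r = true ∧ φ.Sat Γ Q) ∨ (r = false ∧ ψ.Sat Γ Q)) P
  | .sep m φ ψ, Γ, _, P => ∃ (U V W : Finset Var) (P₁ : PSpace U) (P₂ : PSpace V) (P' : PSpace W),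
      P₁.Model ∧ P₂.Model ∧ Combine m P₁ P₂ P' ∧ PSpace.Le P' P ∧ φ.Sat Γ P₁ ∧ ψ.Sat Γ P₂
  | .sure P', Γ, S, P => P.Event (P'.sem Γ S) ∧ P.prob (P'.sem Γ S) = 1

/-- Semantic implication. -/
def Assertion.Implies (φ ψ : Assertion) : Prop :=
  ∀ (Γ : Ctx) (S : Finset Var) (P : PSpace S), P.Model → φ.Sat Γ P → ψ.Sat Γ P

/-- `Q` is the smallest space that satisfies `φ`. (There is at most one, because `PSpace.Le` is
antisymmetric on the spaces with `PSpace.Model`.) -/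
def Assertion.IsSmallest (φ : Assertion) (Γ : Ctx) {U : Finset Var} (Q : PSpace U) : Prop :=
  Q.Model ∧ φ.Sat Γ Q ∧
    ∀ (S : Finset Var) (P : PSpace S), P.Model → φ.Sat Γ P → PSpace.Le Q P

/-- Precise assertions. -/
def Assertion.Precise (φ : Assertion) : Prop :=
  ∀ Γ : Ctx, (∃ (S : Finset Var) (P : PSpace S), P.Model ∧ φ.Sat Γ P) →
    ∃ (U : Finset Var) (Q : PSpace U), φ.IsSmallest Γ Q

/-- `φ ∗ ⌈I⌉`. -/
def Assertion.withInv (φ : Assertion) (I : Pure) : Assertion := .sep .strong φ (.sure I)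

/-- Validity of the triple `{φ} C {ψ}` under the resource invariant `I`. -/
def Triple (m : Mode) (I : Pure) (φ : Assertion) (C : Cmd) (ψ : Assertion) : Prop :=
  ∀ (Γ : Ctx) (V : Finset Var) (μ : PMF (Mem V)) (U UF W : Finset Var)
    (P : PSpace U) (PF : PSpace UF) (P' : PSpace W),
    P.Model → PF.Model → Combine m P PF P' → PSpace.Le P' (PSpace.ofPMF μ) →
    (φ.withInv I).Sat Γ P →
    ∀ ν ∈ CSet.bindPMF (lin (I.semFv Γ) C) μ,
      ∃ (U' W' : Finset Var) (Q : PSpace U') (Q' : PSpace W') (ν' : PMF (Mem V)),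
        Q.Model ∧ Combine m Q PF Q' ∧ ν = ν'.map some ∧ PSpace.Le Q' (PSpace.ofPMF ν') ∧
        (ψ.withInv I).Sat Γ Q

/-- `⟨φ, ψ⟩` is a loop invariant pair for `while b C` under the resource invariant `I`. -/
structure InvariantPair (φ ψ : Assertion) (b : Test) (C : Cmd) (I : Pure) : Prop where
  enter : φ.Implies (.sure (.testIs b true))
  exit : ψ.Implies (.sure (.testIs b false))
  body : Triple .weak I φ C (.nd φ ψ)
  precise : ψ.Precise

end

end PCOL

namespace PCOL

open Filter Topology

/-! ## Mixtures and convexity -/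

-- Start the loop in a distribution that satisfies φ ∗ ⌈I⌉. The test holds almost surely, so the
-- body runs, and its outcome is a mixture of a part that again satisfies φ ∗ ⌈I⌉ and loops on, and
-- a part that satisfies ψ ∗ ⌈I⌉ and leaves the loop (`exists_mixture_of_mem_bindPMF`). Every space
-- satisfying ψ refines the smallest one, so each part that leaves the loop gives an event `A` of
-- that space the same probability. The probability of ending in `A` would thus be that of
-- termination times a constant, were it not that divergence admits arbitrary distributions, so an
-- outcome may put additional mass anywhere.
--
-- Truncation removes this excess: follow an outcome `ρ` for `n` iterations, declare whatever still
-- loops divergent, and let `n` tend to infinity. By compactness a limit `ρ'` exists and is again an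
-- outcome of the loop (`exists_truncation`). It lies below `ρ` on proper memories and satisfies the
-- product formula exactly. Comparing `ρ'` with `ρ` gives both inequalities of (a) in
-- `minProb_while`.
--
-- For (b), let `c` be the infimum of the termination probabilities over all admissible initial
-- distributions and all outcomes. At each finite stage the mass cut off sits in a distribution
-- satisfying φ ∗ ⌈I⌉, from which `ρ` still terminates with probability at least `c`. In the limit,
-- if `ρ'` terminates with probability `t`, then `ρ` does so with probability at least `t + (1 - t)
-- c`. As `ρ'` is itself an outcome, `t ≥ c`; hence `c ≥ 2c - c²`, and `c > 0` forces `c = 1`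
-- (`minTerm_while_eq_one`).
--
-- All this rests on the unfolding of the loop (`lin_while_subset_bind`,
-- `bind_approx_subset_approx_while`). Linearization by finite cuts is replaced by executions with
-- bounded fuel, `LPOF.run`; the pomset of the loop solves its recursive equation
-- (`LPOF.loop_agree`); and executions of a sequential composition are Kleisli compositions up to
-- fuel. Finite branching and finiteness of the invariant make the sets of outcomes closed under
-- limits, which lets the Kleisli extension commute with the intersection over all amounts of fuel.

/-- Bayes' rule: the joint law of index and value is disintegrated along the value. Where the
marginal vanishes, any posterior will do. -/
theorem exists_posterior {ι X : Type} (w : PMF ι) (μ : ι → PMF X) :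
    ∃ post : X → PMF ι, ∀ x i, (w.bind μ) x * post x i = w i * μ i x := by
  have key : ∀ x, ∃ p : PMF ι, ∀ i, (w.bind μ) x * p i = w i * μ i x := by
    intro x
    by_cases h : (w.bind μ) x = 0
    · refine ⟨w, fun i => ?_⟩
      rw [PMF.bind_apply, ENNReal.tsum_eq_zero] at h
      rw [PMF.bind_apply, h i, ENNReal.tsum_eq_zero.2 h, zero_mul]
    · have ht : (w.bind μ) x ≠ ∞ := PMF.apply_ne_top _ _
      have hs : ∑' i, w i * μ i x = (w.bind μ) x := (PMF.bind_apply _ _ _).symm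
      refine ⟨PMF.normalize (fun i => w i * μ i x) (by rwa [hs]) (by rwa [hs]), fun i => ?_⟩
      rw [PMF.normalize_apply, hs, mul_comm, mul_assoc, ENNReal.inv_mul_cancel h ht, mul_one]
  choose p hp using key
  exact ⟨p, hp⟩

theorem bind_congr_support {X Y : Type} {p : PMF X} {f g : X → PMF Y}
    (h : ∀ x ∈ p.support, f x = g x) : p.bind f = p.bind g := by
  ext y
  rw [PMF.bind_apply, PMF.bind_apply]
  refine tsum_congr fun x => ?_
  by_cases hx : x ∈ p.support
  · rw [h x hx]
  · rw [(PMF.apply_eq_zero_iff _ _).2 hx, zero_mul, zero_mul]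

/-- Sets of distributions that are closed under countable convex combinations. -/
def SigmaConvex {X : Type} (S : Set (PMF X)) : Prop :=
  ∀ (ι : Type) (w : PMF ι) (ν : ι → PMF X), (∀ i ∈ w.support, ν i ∈ S) → w.bind ν ∈ S

namespace CSet

variable {X Y Z : Type}

/-- Different branches `i` may reach the same state and continue differently. Averaging the
continuations over the posterior of `i` given the state merges them into one kernel, and countable
convexity keeps the average admissible. -/
theorem exists_mixture_kernel {ι : Type} (w : PMF ι) (μ : ι → PMF (Option X))
    (κ : ι → Option X → PMF (Option Y)) {g : X → CSet Y} (hg : ∀ x, SigmaConvex (g x))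
    (h : ∀ i ∈ w.support, ∀ x ∈ (μ i).support, κ i x ∈ strict g x) :
    ∃ κ' : Option X → PMF (Option Y), (∀ x ∈ (w.bind μ).support, κ' x ∈ strict g x) ∧
      w.bind (fun i => (μ i).bind (κ i)) = (w.bind μ).bind κ' := by
  obtain ⟨post, hpost⟩ := exists_posterior w μ
  refine ⟨fun x => (post x).bind (fun i => κ i x), ?_, ?_⟩
  · rintro (_ | x) hx
    · trivial
    · refine hg x ι _ _ fun i hi => ?_
      have hne : w i * μ i (some x) ≠ 0 := by
        rw [← hpost]
        exact mul_ne_zero ((PMF.mem_support_iff _ _).1 hx) ((PMF.mem_support_iff _ _).1 hi)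
      exact h i ((PMF.mem_support_iff _ _).2 (left_ne_zero_of_mul hne)) (some x)
        ((PMF.mem_support_iff _ _).2 (right_ne_zero_of_mul hne))
  · ext y
    simp only [PMF.bind_apply (p := w.bind μ)]
    simp only [PMF.bind_apply (p := post _), ← ENNReal.tsum_mul_left]
    simp only [← mul_assoc, hpost]
    rw [ENNReal.tsum_comm]
    simp only [PMF.bind_apply, ← ENNReal.tsum_mul_left, mul_assoc]

theorem bind_bind_subset {f : X → CSet Y} {g : Y → CSet Z} (S : CSet X) :
    bind g (bind f S) ⊆ bind (fun x => bind g (f x)) S := by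
  rintro ρ ⟨_, ⟨μ, hμ, ν, hν, rfl⟩, κ, hκ, rfl⟩
  refine ⟨μ, hμ, fun x => (ν x).bind κ, ?_, PMF.bind_bind _ _ _⟩
  rintro (_ | x) hx
  · trivial
  · exact ⟨ν (some x), hν _ hx, κ,
      fun y hy => hκ y ((PMF.mem_support_bind_iff _ _ _).2 ⟨_, hx, hy⟩), rfl⟩

/-- This half of associativity needs convexity: on the left the second step may depend on the state
before the first one, on the right only on the state after it. -/
theorem subset_bind_bind {f : X → CSet Y} {g : Y → CSet Z} (hg : ∀ y, SigmaConvex (g y))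
    (S : CSet X) : bind (fun x => bind g (f x)) S ⊆ bind g (bind f S) := by
  rintro ρ ⟨μ, hμ, ν, hν, rfl⟩
  have key : ∀ x, ∃ (m : PMF (Option Y)) (k : Option Y → PMF (Option Z)), x ∈ μ.support →
      m ∈ strict f x ∧ (∀ y ∈ m.support, k y ∈ strict g y) ∧ ν x = m.bind k := by
    rintro (_ | x)
    · refine ⟨PMF.pure none, fun _ => ν none, fun _ => ⟨trivial, ?_, by simp⟩⟩
      intro y hy
      obtain rfl : y = none := by simpa using hy
      trivial
    · by_cases hx : some x ∈ μ.support
      · obtain ⟨m, hm, k, hk, he⟩ := hν _ hx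
        exact ⟨m, k, fun _ => ⟨hm, hk, he⟩⟩
      · exact ⟨PMF.pure none, fun _ => PMF.pure none, fun h => (hx h).elim⟩
  choose m k hmk using key
  obtain ⟨κ, hκ, he⟩ := exists_mixture_kernel μ m k hg (fun x hx => (hmk x hx).2.1)
  refine ⟨μ.bind m, ⟨μ, hμ, m, fun x hx => (hmk x hx).1, rfl⟩, κ, hκ, ?_⟩
  rw [← he]
  exact bind_congr_support fun x hx => (hmk x hx).2.2

theorem bind_mono {f g : X → CSet Y} {S S' : CSet X} (hf : ∀ x, f x ⊆ g x) (hS : S ⊆ S') :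
    bind f S ⊆ bind g S' := by
  rintro ρ ⟨μ, hμ, ν, hν, rfl⟩
  refine ⟨μ, hS hμ, ν, ?_, rfl⟩
  rintro (_ | x) hx
  · trivial
  · exact hf x (hν _ hx)

theorem bind_eta (f : X → CSet Y) (x : X) : bind f (eta x) = f x := by
  ext ρ
  constructor
  · rintro ⟨μ, rfl, ν, hν, rfl⟩
    rw [PMF.pure_bind]
    exact hν (some x) (by simp)
  · intro h
    refine ⟨_, rfl, fun _ => ρ, ?_, by simp⟩
    intro y hy
    obtain rfl : y = some x := by simpa using hy
    exact h

theorem bind_bot (f : X → CSet Y) : bind f bot = bot := by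
  refine Set.eq_univ_of_forall fun ρ => ⟨PMF.pure none, trivial, fun _ => ρ, ?_, by simp⟩
  intro y hy
  obtain rfl : y = none := by simpa using hy
  trivial

theorem bind_nonempty {f : X → CSet Y} {S : CSet X} (hS : S.Nonempty) (hf : ∀ x, (f x).Nonempty) :
    (bind f S).Nonempty := by
  obtain ⟨μ, hμ⟩ := hS
  choose k hk using hf
  refine ⟨_, μ, hμ, fun x => x.elim (PMF.pure none) k, ?_, rfl⟩
  rintro (_ | x) _
  · trivial
  · exact hk x

theorem sigmaConvex_bot : SigmaConvex (bot : CSet X) := fun _ _ _ _ => trivial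

theorem sigmaConvex_singleton (ρ : PMF X) : SigmaConvex {ρ} := by
  intro ι w ν h
  rw [Set.mem_singleton_iff]
  ext x
  rw [PMF.bind_apply]
  have : ∀ i, w i * ν i x = w i * ρ x := by
    intro i
    by_cases hi : i ∈ w.support
    · rw [Set.mem_singleton_iff.1 (h i hi)]
    · rw [(PMF.apply_eq_zero_iff _ _).2 hi, zero_mul, zero_mul]
  simp only [this, ENNReal.tsum_mul_right, PMF.tsum_coe, one_mul]

theorem sigmaConvex_eta (x : X) : SigmaConvex (eta x) := sigmaConvex_singleton _

theorem sigmaConvex_bind {f : X → CSet Y} {S : CSet X} (hf : ∀ x, SigmaConvex (f x))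
    (hS : SigmaConvex S) : SigmaConvex (bind f S) := by
  intro ι w ρ h
  have key : ∀ i, ∃ (m : PMF (Option X)) (k : Option X → PMF (Option Y)), i ∈ w.support →
      m ∈ S ∧ (∀ y ∈ m.support, k y ∈ strict f y) ∧ ρ i = m.bind k := by
    intro i
    by_cases hi : i ∈ w.support
    · obtain ⟨m, hm, k, hk, he⟩ := h i hi
      exact ⟨m, k, fun _ => ⟨hm, hk, he⟩⟩
    · exact ⟨PMF.pure none, fun _ => PMF.pure none, fun h => (hi h).elim⟩
  choose m k hmk using key
  obtain ⟨κ, hκ, he⟩ := exists_mixture_kernel w m k hf (fun x hx => (hmk x hx).2.1)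
  refine ⟨w.bind m, hS _ _ _ fun i hi => (hmk i hi).1, κ, hκ, ?_⟩
  rw [← he]
  exact bind_congr_support fun x hx => (hmk x hx).2.2

/-! ### Convex unions -/

theorem nd_mono {ι : Type} {S S' : ι → CSet X} (h : ∀ i, S i ⊆ S' i) : nd S ⊆ nd S' := by
  rintro ρ ⟨w, ν, hν, rfl⟩
  exact ⟨w, ν, fun i => h i (hν i), rfl⟩

theorem nd_equiv {ι ι' : Type} (e : ι ≃ ι') {S : ι → CSet X} {S' : ι' → CSet X}
    (h : ∀ i, S' (e i) = S i) : nd S = nd S' := by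
  have aux : ∀ {κ κ' : Type} (e : κ ≃ κ') {S : κ → CSet X} {S' : κ' → CSet X}
      (_ : ∀ i, S' (e i) = S i), nd S ⊆ nd S' := by
    rintro κ κ' e S S' h ρ ⟨w, ν, hν, rfl⟩
    refine ⟨w.map e, fun i => ν (e.symm i), fun i => ?_, ?_⟩
    · have := hν (e.symm i)
      rwa [← h, e.apply_symm_apply] at this
    · rw [PMF.bind_map]
      congr 1
      funext i
      simp
  exact (aux e h).antisymm (aux e.symm (fun i => by rw [← h, e.apply_symm_apply]))

theorem nd_unique {ι : Type} [Unique ι] (S : ι → CSet X) : nd S = S default := by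
  ext ρ
  constructor
  · rintro ⟨w, ν, hν, rfl⟩
    have : w = PMF.pure default := by
      ext i
      rw [Subsingleton.elim i default]
      have := w.tsum_coe
      rw [tsum_eq_single default (fun i hi => (hi (Subsingleton.elim _ _)).elim)] at this
      simpa using this
    rw [this, PMF.pure_bind]
    exact hν _
  · intro h
    refine ⟨PMF.pure default, fun _ => ρ, fun i => ?_, by simp⟩
    rwa [Subsingleton.elim i default]

theorem nd_nonempty {ι : Type} [Nonempty ι] {S : ι → CSet X} (h : ∀ i, (S i).Nonempty) :
    (nd S).Nonempty := by
  choose ν hν using h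
  exact ⟨_, PMF.pure (Classical.arbitrary ι), ν, hν, rfl⟩

theorem bind_nd_subset {ι : Type} (g : X → CSet Y) (S : ι → CSet X) (hg : ∀ x, (g x).Nonempty) :
    bind g (nd S) ⊆ nd (fun i => bind g (S i)) := by
  rintro ρ ⟨_, ⟨w, ν, hν, rfl⟩, κ, hκ, rfl⟩
  choose d hd using hg
  classical
  -- A convex union demands a member of every set, also for indices of weight zero, on which `κ`
  -- need not be admissible. There a default kernel is used, whence the nonemptiness hypothesis.
  refine ⟨w, fun i => if i ∈ w.support then (ν i).bind κ else
    (ν i).bind (fun x => x.elim (PMF.pure none) d), fun i => ?_, ?_⟩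
  · by_cases hi : i ∈ w.support
    · simp only [hi, if_true]
      exact ⟨ν i, hν i, κ, fun y hy => hκ y ((PMF.mem_support_bind_iff _ _ _).2 ⟨_, hi, hy⟩), rfl⟩
    · simp only [hi, if_false]
      refine ⟨ν i, hν i, _, ?_, rfl⟩
      rintro (_ | x) _
      · trivial
      · exact hd x
  · rw [PMF.bind_bind]
    exact bind_congr_support fun i hi => by simp only [hi, if_true]

theorem nd_bind_subset {ι : Type} {g : X → CSet Y} (hg : ∀ x, SigmaConvex (g x))
    (S : ι → CSet X) : nd (fun i => bind g (S i)) ⊆ bind g (nd S) := by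
  rintro ρ ⟨w, ν, hν, rfl⟩
  choose m hm k hk he using hν
  obtain ⟨κ, hκ, h⟩ := exists_mixture_kernel w m k hg (fun i _ => hk i)
  refine ⟨w.bind m, ⟨w, m, hm, rfl⟩, κ, hκ, ?_⟩
  rw [← h]
  congr 1
  funext i
  exact he i

theorem sigmaConvex_nd {ι : Type} {S : ι → CSet X} (hS : ∀ i, SigmaConvex (S i)) :
    SigmaConvex (nd S) := by
  intro τ w ρ h
  have hne : ∃ d : ι → PMF (Option X), ∀ i, d i ∈ S i := by
    obtain ⟨j, hj⟩ := w.support_nonempty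
    obtain ⟨_, ν, hν, _⟩ := h j hj
    exact ⟨ν, hν⟩
  obtain ⟨d, hd⟩ := hne
  have key : ∀ j, ∃ (m : PMF ι) (k : ι → PMF (Option X)),
      (∀ i, k i ∈ S i) ∧ (j ∈ w.support → ρ j = m.bind k) := by
    intro j
    by_cases hj : j ∈ w.support
    · obtain ⟨m, k, hk, he⟩ := h j hj
      exact ⟨m, k, hk, fun _ => he⟩
    · obtain ⟨j', hj'⟩ := w.support_nonempty
      obtain ⟨m, -⟩ := h j' hj'
      exact ⟨m, d, hd, fun h => (hj h).elim⟩
  choose m k hk he using key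
  obtain ⟨post, hpost⟩ := exists_posterior w m
  refine ⟨w.bind m, fun i => (post i).bind (fun j => k j i),
    fun i => hS i _ _ _ fun j _ => hk j i, ?_⟩
  ext z
  simp only [PMF.bind_apply (p := w.bind m)]
  simp only [PMF.bind_apply (p := post _), ← ENNReal.tsum_mul_left]
  simp only [← mul_assoc, hpost]
  rw [ENNReal.tsum_comm]
  simp only [PMF.bind_apply (p := w)]
  refine tsum_congr fun j => ?_
  by_cases hj : j ∈ w.support
  · rw [he j hj, PMF.bind_apply, ← ENNReal.tsum_mul_left]
    simp only [mul_assoc]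
  · simp [(PMF.apply_eq_zero_iff _ _).2 hj]

end CSet

/-! ## Limits of distributions -/

theorem tsum_option_eq {X : Type} (f : Option X → ℝ≥0∞) :
    ∑' o, f o = f none + ∑' x, f (some x) := by
  rw [← (Equiv.optionEquivSumPUnit.{0} X).symm.tsum_eq f,
    Summable.tsum_sum ENNReal.summable ENNReal.summable]
  simp [add_comm]

theorem none_add_tsum_some {X : Type} (ρ : PMF (Option X)) : ρ none + ∑' x, ρ (some x) = 1 := by
  rw [← tsum_option_eq, ρ.tsum_coe]

/-- Convergence along the hyperfilter at all proper outcomes; mass that escapes counts as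
divergence. -/
def LimTo {X : Type} (ρ : ℕ → PMF (Option X)) (ρ' : PMF (Option X)) : Prop :=
  ∀ x, Tendsto (fun n => ρ n (some x)) (hyperfilter ℕ : Filter ℕ) (𝓝 (ρ' (some x)))

/-- Pointwise limits along an ultrafilter exist by compactness of `[0, ∞]`. Finite partial sums show
that their total is at most one, and the deficit goes to `none`. -/
theorem exists_limTo {X : Type} (ρ : ℕ → PMF (Option X)) : ∃ ρ', LimTo ρ ρ' := by
  have h1 : ∀ x, ∃ a : ℝ≥0∞,
      Tendsto (fun n => ρ n (some x)) (hyperfilter ℕ : Filter ℕ) (𝓝 a) := by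
    intro x
    obtain ⟨a, -, ha⟩ := isCompact_univ.ultrafilter_le_nhds
      ((hyperfilter ℕ).map (fun n => ρ n (some x))) (by simp)
    exact ⟨a, ha⟩
  choose g hg using h1
  have hle : ∑' x, g x ≤ 1 := by
    rw [ENNReal.tsum_eq_iSup_sum]
    refine iSup_le fun s => le_of_tendsto' (tendsto_finsetSum s fun i _ => hg i) fun n => ?_
    calc ∑ x ∈ s, ρ n (some x) ≤ ∑' x, ρ n (some x) := ENNReal.sum_le_tsum s
      _ ≤ 1 := by rw [← none_add_tsum_some (ρ n)]; exact le_add_self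
  refine ⟨⟨fun o => o.elim (1 - ∑' x, g x) g, ?_⟩, fun x => hg x⟩
  have : ∑' o : Option X, (o.elim (1 - ∑' x, g x) g : ℝ≥0∞) = 1 := by
    rw [tsum_option_eq]
    exact tsub_add_cancel_of_le hle
  exact (Summable.hasSum_iff ENNReal.summable).2 this

theorem LimTo.unique {X : Type} {ρ : ℕ → PMF (Option X)} {ρ₁ ρ₂ : PMF (Option X)}
    (h₁ : LimTo ρ ρ₁) (h₂ : LimTo ρ ρ₂) : ρ₁ = ρ₂ := by
  have h : ∀ x, ρ₁ (some x) = ρ₂ (some x) := fun x => tendsto_nhds_unique (h₁ x) (h₂ x)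
  ext o
  cases o with
  | some x => exact h x
  | none =>
    have e₁ := none_add_tsum_some ρ₁
    rw [← none_add_tsum_some ρ₂] at e₁
    simp only [h] at e₁
    refine (ENNReal.add_left_inj ?_).1 e₁
    refine ne_top_of_le_ne_top ENNReal.one_ne_top ?_
    rw [← none_add_tsum_some ρ₂]
    exact le_add_self

theorem LimTo.const {X : Type} (ρ : PMF (Option X)) : LimTo (fun _ => ρ) ρ :=
  fun _ => tendsto_const_nhds

theorem LimTo.congr' {X : Type} {ρ ρ₁ : ℕ → PMF (Option X)} {ρ' : PMF (Option X)}
    (h : LimTo ρ ρ') (he : ∀ᶠ n in (hyperfilter ℕ : Filter ℕ), ρ n = ρ₁ n) : LimTo ρ₁ ρ' :=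
  fun x => (h x).congr' (he.mono fun n hn => by rw [hn])

/-- The mass arriving in `Z` is what flows there from `F` plus at most the mass outside `F`. Written
without subtraction and with finite sums only, this passes to limits. -/
theorem sum_bind_add_le {X Y : Type} (μ : PMF (Option X)) (κ : Option X → PMF (Option Y))
    (Z : Finset Y) (F : Finset X) :
    ∑ z ∈ Z, (μ.bind κ) (some z) + ∑ y ∈ F, μ (some y) ≤
      1 + ∑ z ∈ Z, ∑ y ∈ F, μ (some y) * κ (some y) (some z) := by
  classical
  set K : Option X → ℝ≥0∞ := fun o => ∑ z ∈ Z, κ o (some z) with hK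
  have hK1 : ∀ o, K o ≤ 1 := by
    intro o
    calc K o ≤ ∑' z, κ o (some z) := ENNReal.sum_le_tsum Z
      _ ≤ 1 := by rw [← none_add_tsum_some (κ o)]; exact le_add_self
  have hL : ∑ z ∈ Z, (μ.bind κ) (some z) = ∑' o, μ o * K o := by
    simp only [PMF.bind_apply, hK, Finset.mul_sum]
    exact (Summable.tsum_finsetSum (fun _ _ => ENNReal.summable)).symm
  have hind : ∀ f : Option X → ℝ≥0∞, ∑ y ∈ F, f (some y) =
      ∑' o, if o ∈ F.map Function.Embedding.some then f o else 0 := by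
    intro f
    rw [tsum_eq_sum (s := F.map Function.Embedding.some) (fun o ho => by simp only [if_neg ho])]
    rw [Finset.sum_map]
    refine Finset.sum_congr rfl fun y hy => ?_
    rw [if_pos (Finset.mem_map_of_mem _ hy)]
    rfl
  have hR : ∑ z ∈ Z, ∑ y ∈ F, μ (some y) * κ (some y) (some z) =
      ∑ y ∈ F, (fun o => μ o * K o) (some y) := by
    rw [Finset.sum_comm]
    simp only [hK, Finset.mul_sum]
  rw [hL, hR, hind (fun o => μ o), hind (fun o => μ o * K o), ← μ.tsum_coe,
    ← ENNReal.tsum_add, ← ENNReal.tsum_add]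
  refine ENNReal.tsum_le_tsum fun o => ?_
  by_cases ho : o ∈ F.map Function.Embedding.some
  · rw [if_pos ho, if_pos ho, add_comm]
  · rw [if_neg ho, if_neg ho, add_zero, add_zero]
    exact mul_le_of_le_one_right' (hK1 o)

/-- Mass may escape to infinity in `X` and yet return in `Y`. With `g` the flow through the limits
at proper points, the balance `hbal` gives `g ≤ ρ'`, and the remainder `ρ' - g` has total mass `μ'
none`. Normalized, it becomes the kernel at `none`, where Kleisli extension imposes no condition. -/
theorem LimTo.bind {X Y : Type} {μ : ℕ → PMF (Option X)} {κ : ℕ → Option X → PMF (Option Y)}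
    {ρ' : PMF (Option Y)} (h : LimTo (fun n => (μ n).bind (κ n)) ρ') :
    ∃ (μ' : PMF (Option X)) (κ' : Option X → PMF (Option Y)), LimTo μ μ' ∧
      (∀ x, LimTo (fun n => κ n (some x)) (κ' (some x))) ∧ ρ' = μ'.bind κ' := by
  obtain ⟨μ', hμ'⟩ := exists_limTo μ
  choose k hk using fun x => exists_limTo (fun n => κ n (some x))
  set g : Option Y → ℝ≥0∞ := fun z => ∑' x, μ' (some x) * k x z with hg
  have htend : ∀ x z, Tendsto (fun n => μ n (some x) * κ n (some x) (some z))
      (hyperfilter ℕ : Filter ℕ) (𝓝 (μ' (some x) * k x (some z))) := fun x z =>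
    ENNReal.Tendsto.mul (hμ' x) (Or.inr (PMF.apply_ne_top _ _)) (hk x z)
      (Or.inr (PMF.apply_ne_top _ _))
  have hgsome : ∀ z, g (some z) ≤ ρ' (some z) := by
    intro z
    rw [hg]
    simp only
    rw [ENNReal.tsum_eq_iSup_sum]
    refine iSup_le fun F => le_of_tendsto_of_tendsto'
      (tendsto_finsetSum F fun x _ => htend x z) (h z) fun n => ?_
    rw [PMF.bind_apply, tsum_option_eq]
    exact (ENNReal.sum_le_tsum F).trans le_add_self
  have hgsum : ∑' z, g z = ∑' x, μ' (some x) := by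
    rw [hg, ENNReal.tsum_comm]
    simp only [ENNReal.tsum_mul_left, PMF.tsum_coe, mul_one]
  have hbal : ∑' z, ρ' (some z) + ∑' x, μ' (some x) ≤ 1 + ∑' z, g (some z) := by
    rw [ENNReal.tsum_eq_iSup_sum (f := fun z => ρ' (some z)),
      ENNReal.tsum_eq_iSup_sum (f := fun x => μ' (some x))]
    refine ENNReal.iSup_add_iSup_le fun Z F => ?_
    have : ∑ z ∈ Z, ρ' (some z) + ∑ y ∈ F, μ' (some y) ≤
        1 + ∑ z ∈ Z, ∑ y ∈ F, μ' (some y) * k y (some z) :=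
      le_of_tendsto_of_tendsto'
        ((tendsto_finsetSum Z fun z _ => h z).add (tendsto_finsetSum F fun y _ => hμ' y))
        (tendsto_const_nhds.add (tendsto_finsetSum Z fun z _ => tendsto_finsetSum F fun y _ =>
          htend y z)) (fun n => sum_bind_add_le (μ n) (κ n) Z F)
    refine this.trans ?_
    gcongr
    refine le_trans ?_ (ENNReal.sum_le_tsum Z)
    exact Finset.sum_le_sum fun z _ => ENNReal.sum_le_tsum F
  have hgtop : ∑' z, g z ≠ ∞ := by
    rw [hgsum]
    refine ne_top_of_le_ne_top ENNReal.one_ne_top ?_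
    rw [← none_add_tsum_some μ']
    exact le_add_self
  have hgnone : g none ≤ ρ' none := by
    rw [← hgsum, tsum_option_eq g, ← add_assoc, ← none_add_tsum_some ρ'] at hbal
    have ht : ∑' z, g (some z) ≠ ∞ := by
      refine ne_top_of_le_ne_top hgtop ?_
      rw [tsum_option_eq g]
      exact le_add_self
    have hr : ∑' z, ρ' (some z) ≠ ∞ := by
      refine ne_top_of_le_ne_top ENNReal.one_ne_top ?_
      rw [← none_add_tsum_some ρ']
      exact le_add_self
    have := (ENNReal.add_le_add_iff_right ht).1 hbal
    rw [add_comm (ρ' none)] at this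
    exact (ENNReal.add_le_add_iff_left hr).1 this
  have hgle : ∀ z, g z ≤ ρ' z := by
    rintro (_ | z)
    · exact hgnone
    · exact hgsome z
  have hd : ∑' z, (ρ' z - g z) = μ' none := by
    refine (ENNReal.add_left_inj hgtop).1 ?_
    rw [← ENNReal.tsum_add]
    simp only [fun z => tsub_add_cancel_of_le (hgle z)]
    rw [ρ'.tsum_coe, hgsum, none_add_tsum_some]
  have hk0 : ∃ k0 : PMF (Option Y), ∀ z, μ' none * k0 z = ρ' z - g z := by
    by_cases h0 : μ' none = 0
    · refine ⟨PMF.pure none, fun z => ?_⟩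
      rw [h0, ENNReal.tsum_eq_zero] at hd
      rw [hd z, h0, zero_mul]
    · refine ⟨PMF.normalize (fun z => ρ' z - g z) (by rwa [hd])
        (by rw [hd]; exact PMF.apply_ne_top _ _), fun z => ?_⟩
      rw [PMF.normalize_apply, hd, mul_comm, mul_assoc,
        ENNReal.inv_mul_cancel h0 (PMF.apply_ne_top _ _), mul_one]
  obtain ⟨k0, hk0⟩ := hk0
  refine ⟨μ', fun o => o.elim k0 k, hμ', hk, ?_⟩
  ext z
  rw [PMF.bind_apply, tsum_option_eq]
  simp only [Option.elim_none, Option.elim_some]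
  rw [hk0]
  exact (tsub_add_cancel_of_le (hgle z)).symm

/-- Sets of distributions that are closed under limits. -/
def LimClosed {X : Type} (S : CSet X) : Prop :=
  ∀ (ρ : ℕ → PMF (Option X)) (ρ' : PMF (Option X)),
    (∀ᶠ n in (hyperfilter ℕ : Filter ℕ), ρ n ∈ S) → LimTo ρ ρ' → ρ' ∈ S

theorem LimTo.eventually_mem_support {X : Type} {μ : ℕ → PMF (Option X)} {μ' : PMF (Option X)}
    (h : LimTo μ μ') {x : X} (hx : some x ∈ μ'.support) :
    ∀ᶠ n in (hyperfilter ℕ : Filter ℕ), some x ∈ (μ n).support :=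
  ((h x).eventually_ne ((PMF.mem_support_iff _ _).1 hx)).mono
    fun _ hn => (PMF.mem_support_iff _ _).2 hn

-- Closure of the Kleisli extension and of convex unions under limits.

namespace CSet

variable {X Y : Type}

/-- Limits of elements of the Kleisli extensions of decreasing families of closed sets. -/
theorem mem_bind_iInter {f : ℕ → X → CSet Y} {S : ℕ → CSet X} (hf : ∀ n x, LimClosed (f n x))
    (hS : ∀ n, LimClosed (S n)) (hfa : ∀ x, Antitone (fun n => f n x)) (hSa : Antitone S)
    {ρ : ℕ → PMF (Option Y)} {ρ' : PMF (Option Y)}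
    (h : ∀ᶠ n in (hyperfilter ℕ : Filter ℕ), ρ n ∈ bind (f n) (S n)) (hl : LimTo ρ ρ') :
    ρ' ∈ bind (fun x => ⋂ n, f n x) (⋂ n, S n) := by
  have key : ∀ n, ∃ (m : PMF (Option X)) (k : Option X → PMF (Option Y)),
      ρ n ∈ bind (f n) (S n) →
      m ∈ S n ∧ (∀ y ∈ m.support, k y ∈ strict (f n) y) ∧ ρ n = m.bind k := by
    intro n
    by_cases hn : ρ n ∈ bind (f n) (S n)
    · obtain ⟨m, hm, k, hk, he⟩ := hn
      exact ⟨m, k, fun _ => ⟨hm, hk, he⟩⟩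
    · exact ⟨PMF.pure none, fun _ => PMF.pure none, fun h => (hn h).elim⟩
  choose m k hmk using key
  obtain ⟨μ', κ', hμ', hκ', he⟩ := LimTo.bind (hl.congr' (h.mono fun n hn => (hmk n hn).2.2))
  have hge : ∀ j, ∀ᶠ n in (hyperfilter ℕ : Filter ℕ), j ≤ n := fun j =>
    Nat.hyperfilter_le_atTop (eventually_ge_atTop j)
  refine ⟨μ', Set.mem_iInter.2 fun j => hS j m _ ?_ hμ', κ', ?_, he⟩
  · filter_upwards [h, hge j] with n hn hjn
    exact hSa hjn (hmk n hn).1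
  · rintro (_ | x) hx
    · trivial
    · refine Set.mem_iInter.2 fun j => hf j x _ _ ?_ (hκ' x)
      filter_upwards [h, hge j, hμ'.eventually_mem_support hx] with n hn hjn hxn
      exact hfa x hjn ((hmk n hn).2.1 _ hxn)

theorem limClosed_bind {f : X → CSet Y} {S : CSet X} (hf : ∀ x, LimClosed (f x))
    (hS : LimClosed S) : LimClosed (bind f S) := by
  intro ρ ρ' h hl
  have := mem_bind_iInter (f := fun _ => f) (S := fun _ => S) (fun _ => hf) (fun _ => hS)
    (fun _ => antitone_const) antitone_const h hl
  simpa only [Set.iInter_const] using this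

theorem limClosed_bot : LimClosed (bot : CSet X) := fun _ _ _ _ => trivial

theorem limClosed_singleton (ρ : PMF (Option X)) : LimClosed {ρ} := fun _ _ h hl =>
  hl.unique ((LimTo.const ρ).congr' (h.mono fun _ hn => (Set.mem_singleton_iff.1 hn).symm))

theorem limClosed_eta (x : X) : LimClosed (eta x) := limClosed_singleton _

/-- A finite index set prevents the weights from losing mass in the limit, so they converge to a
distribution again. Viewing the weights as a distribution on `Option ι` reduces the claim to
`LimTo.bind`. -/
theorem limClosed_nd {ι : Type} [Finite ι] {S : ι → CSet X} (hS : ∀ i, LimClosed (S i)) :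
    LimClosed (nd S) := by
  intro ρ ρ' h hl
  obtain ⟨w₀, hw₀⟩ : Nonempty (PMF ι) := by
    obtain ⟨n, w, -⟩ := h.exists
    exact ⟨w⟩
  have key : ∀ n, ∃ (w : PMF ι) (ν : ι → PMF (Option X)),
      ρ n ∈ nd S → (∀ i, ν i ∈ S i) ∧ ρ n = w.bind ν := by
    intro n
    by_cases hn : ρ n ∈ nd S
    · obtain ⟨w, ν, hν, he⟩ := hn
      exact ⟨w, ν, fun _ => ⟨hν, he⟩⟩
    · exact ⟨⟨w₀, hw₀⟩, fun _ => PMF.pure none, fun h => (hn h).elim⟩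
  choose w ν hwν using key
  have hbind : ∀ n, (w n).bind (ν n) =
      ((w n).map some).bind (fun o => o.elim (PMF.pure none) (ν n)) := by
    intro n
    rw [PMF.bind_map]
    rfl
  obtain ⟨μ', κ', hμ', hκ', he⟩ := LimTo.bind
    (hl.congr' (h.mono fun n hn => (hwν n hn).2.trans (hbind n)))
  have : Fintype ι := Fintype.ofFinite ι
  have hmap : ∀ n i, ((w n).map some) (some i) = w n i := by
    intro n i
    rw [PMF.map_apply, tsum_eq_single i (fun j hj => by simp [Ne.symm hj])]
    simp
  have hsum : ∑ i, μ' (some i) = 1 := by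
    refine tendsto_nhds_unique (tendsto_finsetSum _ fun i _ => hμ' i) ?_
    have : ∀ n, ∑ i, ((w n).map some) (some i) = 1 := by
      intro n
      simp only [hmap]
      rw [← (w n).tsum_coe, tsum_fintype]
    simp only [this]
    exact tendsto_const_nhds
  have hnone : μ' none = 0 := by
    have := none_add_tsum_some μ'
    rw [tsum_fintype, hsum] at this
    exact (ENNReal.add_left_inj ENNReal.one_ne_top).1 (this.trans (zero_add 1).symm)
  refine ⟨PMF.ofFintype (fun i => μ' (some i)) hsum, fun i => κ' (some i), fun i => ?_, ?_⟩
  · exact hS i _ _ (h.mono fun n hn => (hwν n hn).1 i) (hκ' i)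
  · rw [he]
    ext z
    rw [PMF.bind_apply, PMF.bind_apply, tsum_option_eq, hnone, zero_mul, zero_add]
    rfl

end CSet


/-! ## Invariant sensitive actions -/

section actions

variable {S T : Finset Var} {J : Set (Mem T)}

theorem Action.sem_cases (a : Action) (σ : Mem S) : a.sem σ = CSet.bot ∨ ∃ ρ, a.sem σ = {ρ} := by
  cases a with
  | assign x e =>
    simp only [Action.sem]
    split
    · split_ifs
      · exact Or.inr ⟨_, rfl⟩
      · exact Or.inl rfl
    · exact Or.inl rfl
  | sample x d e =>
    simp only [Action.sem]
    split
    · split_ifs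
      · exact Or.inr ⟨_, rfl⟩
      · exact Or.inl rfl
    · exact Or.inl rfl

theorem check_cases (J : Set (Mem T)) (σ : Mem S) :
    check J σ = CSet.bot ∨ (check J σ = CSet.eta σ ∧ J.Nonempty) := by
  unfold check
  split_ifs with h
  · exact Or.inr ⟨rfl, _, h.2⟩
  · exact Or.inl rfl

theorem Action.sigmaConvex_semInv (a : Action) (σ : Mem S) : SigmaConvex (a.semInv J σ) := by
  have hc : ∀ τ : Mem S, SigmaConvex (check J τ) := fun τ => by
    rcases check_cases J τ with h | ⟨h, -⟩ <;> rw [h]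
    exacts [CSet.sigmaConvex_bot, CSet.sigmaConvex_eta _]
  refine CSet.sigmaConvex_bind hc (CSet.sigmaConvex_bind (fun τ => ?_)
    (CSet.sigmaConvex_bind (fun τ => CSet.sigmaConvex_nd fun _ => CSet.sigmaConvex_eta _) (hc σ)))
  rcases a.sem_cases τ with h | ⟨ρ, h⟩ <;> rw [h]
  exacts [CSet.sigmaConvex_bot, CSet.sigmaConvex_singleton _]

/-- Finiteness of `J` makes the choice of a new shared memory a finite convex union. -/
theorem Action.limClosed_semInv (hJ : J.Finite) (a : Action) (σ : Mem S) :
    LimClosed (a.semInv J σ) := by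
  have : Finite J := hJ
  have hc : ∀ τ : Mem S, LimClosed (check J τ) := fun τ => by
    rcases check_cases J τ with h | ⟨h, -⟩ <;> rw [h]
    exacts [CSet.limClosed_bot, CSet.limClosed_eta _]
  refine CSet.limClosed_bind hc (CSet.limClosed_bind (fun τ => ?_)
    (CSet.limClosed_bind (fun τ => CSet.limClosed_nd fun _ => CSet.limClosed_eta _) (hc σ)))
  rcases a.sem_cases τ with h | ⟨ρ, h⟩ <;> rw [h]
  exacts [CSet.limClosed_bot, CSet.limClosed_singleton _]

theorem Action.semInv_nonempty (a : Action) (σ : Mem S) : (a.semInv J σ).Nonempty := by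
  have hc : ∀ τ : Mem S, (check J τ).Nonempty := fun τ => by
    rcases check_cases J τ with h | ⟨h, -⟩ <;> rw [h]
    exacts [⟨PMF.pure none, trivial⟩, Set.singleton_nonempty _]
  refine CSet.bind_nonempty (CSet.bind_nonempty ?_ fun τ => ?_) hc
  · rcases check_cases J σ with h | ⟨h, hJ⟩ <;> rw [h]
    · rw [CSet.bind_bot]
      exact ⟨PMF.pure none, trivial⟩
    · rw [CSet.bind_eta]
      have : Nonempty J := hJ.to_subtype
      exact CSet.nd_nonempty fun _ => Set.singleton_nonempty _
  · rcases a.sem_cases τ with h | ⟨ρ, h⟩ <;> rw [h]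
    · exact ⟨PMF.pure none, trivial⟩
    · exact Set.singleton_nonempty _

end actions

/-! ## Linearization with a bound on the number of steps -/

section run

variable {T : Finset Var} (J : Set (Mem T)) {V : Finset Var}

/-- Processing of the node `x` with label `ℓ`, continued by `k`. -/
def branch (ℓ : Label) (x : Node) (ψ : Form) (k : Form → Mem V → CSet (Mem V)) (σ : Mem V) :
    CSet (Mem V) :=
  match ℓ with
  | .act a => CSet.bind (k ψ) (a.semInv J σ)
  | .test b =>
    match b.eval σ with
    | some r => k (fun v => ψ v ∧ v x = r) σ
    | none => CSet.bot
  | .bot => CSet.bot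
  | .fork => k ψ σ

open Classical in
/-- The outcomes of the first `n` steps of all schedules of `α`; nothing is known about longer
executions. -/
noncomputable def LPOF.run (α : LPOF) : ℕ → Form → Set Node → Mem V → CSet (Mem V)
  | 0, _, _, _ => CSet.bot
  | n + 1, ψ, S, σ =>
    if α.next ψ S = ∅ then CSet.eta σ
    else CSet.nd (fun x : α.next ψ S =>
      branch J (α.lab x.1) x.1 ψ (fun ψ' => α.run n ψ' (insert x.1 S)) σ)

variable {J}

-- Comparison and composition of single scheduling steps.

theorem branch_subset {ℓ : Label} {x y : Node} {ψ ψ' : Form}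
    {k k' : Form → Mem V → CSet (Mem V)}
    (h : (∀ b, ℓ ≠ .test b) → ∀ τ, k ψ τ ⊆ k' ψ' τ)
    (ht : ∀ b, ℓ = .test b → ∀ r τ, k (fun v => ψ v ∧ v x = r) τ ⊆ k' (fun v => ψ' v ∧ v y = r) τ)
    (σ : Mem V) : branch J ℓ x ψ k σ ⊆ branch J ℓ y ψ' k' σ := by
  cases ℓ with
  | act a => exact CSet.bind_mono (h (by simp)) subset_rfl
  | test b =>
    simp only [branch]
    split
    · exact ht b rfl _ _
    · exact subset_rfl
  | fork => exact h (by simp) σ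
  | bot => exact subset_rfl

theorem bind_branch_subset {ℓ : Label} {x y : Node} {ψ ψ' : Form} {g : Mem V → CSet (Mem V)}
    {k k' : Form → Mem V → CSet (Mem V)}
    (h : (∀ b, ℓ ≠ .test b) → ∀ τ, CSet.bind g (k ψ τ) ⊆ k' ψ' τ)
    (ht : ∀ b, ℓ = .test b → ∀ r τ,
      CSet.bind g (k (fun v => ψ v ∧ v x = r) τ) ⊆ k' (fun v => ψ' v ∧ v y = r) τ)
    (σ : Mem V) : CSet.bind g (branch J ℓ x ψ k σ) ⊆ branch J ℓ y ψ' k' σ := by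
  cases ℓ with
  | act a => exact (CSet.bind_bind_subset _).trans (CSet.bind_mono (h (by simp)) subset_rfl)
  | test b =>
    simp only [branch]
    split
    · exact ht b rfl _ _
    · exact fun _ _ => trivial
  | fork => exact h (by simp) σ
  | bot => exact fun _ _ => trivial

theorem branch_subset_bind {ℓ : Label} {x y : Node} {ψ ψ' : Form} {g : Mem V → CSet (Mem V)}
    {k k' : Form → Mem V → CSet (Mem V)} (hg : ∀ τ, SigmaConvex (g τ))
    (h : (∀ b, ℓ ≠ .test b) → ∀ τ, k' ψ' τ ⊆ CSet.bind g (k ψ τ))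
    (ht : ∀ b, ℓ = .test b → ∀ r τ,
      k' (fun v => ψ' v ∧ v y = r) τ ⊆ CSet.bind g (k (fun v => ψ v ∧ v x = r) τ))
    (σ : Mem V) : branch J ℓ y ψ' k' σ ⊆ CSet.bind g (branch J ℓ x ψ k σ) := by
  cases ℓ with
  | act a =>
    exact (CSet.bind_mono (h (by simp)) subset_rfl).trans (CSet.subset_bind_bind hg _)
  | test b =>
    simp only [branch]
    split
    · exact ht b rfl _ _
    · rw [CSet.bind_bot]
  | fork => exact h (by simp) σ
  | bot =>
    simp only [branch]
    rw [CSet.bind_bot]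

namespace LPOF

theorem run_succ_of_eq_empty {α : LPOF} {n : ℕ} {ψ : Form} {S : Set Node} {σ : Mem V}
    (h : α.next ψ S = ∅) : α.run J (n + 1) ψ S σ = CSet.eta σ := by
  rw [run, if_pos h]

theorem run_succ_of_ne_empty {α : LPOF} {n : ℕ} {ψ : Form} {S : Set Node} {σ : Mem V}
    (h : α.next ψ S ≠ ∅) : α.run J (n + 1) ψ S σ = CSet.nd (fun x : α.next ψ S =>
      branch J (α.lab x.1) x.1 ψ (fun ψ' => α.run J n ψ' (insert x.1 S)) σ) := by
  rw [run, if_neg h]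

theorem run_succ_subset (α : LPOF) (n : ℕ) (ψ : Form) (S : Set Node) (σ : Mem V) :
    α.run J (n + 1) ψ S σ ⊆ α.run J n ψ S σ := by
  induction n generalizing ψ S σ with
  | zero => exact fun _ _ => trivial
  | succ n ih =>
    by_cases h : α.next ψ S = ∅
    · rw [run_succ_of_eq_empty h, run_succ_of_eq_empty h]
    · rw [run_succ_of_ne_empty h, run_succ_of_ne_empty h]
      exact CSet.nd_mono fun x => branch_subset (fun _ τ => ih _ _ _) (fun _ _ _ τ => ih _ _ _) _

theorem run_antitone (α : LPOF) (ψ : Form) (S : Set Node) (σ : Mem V) :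
    Antitone (fun n => α.run J n ψ S σ) :=
  antitone_nat_of_succ_le fun n => α.run_succ_subset n ψ S σ

theorem sigmaConvex_run (α : LPOF) (n : ℕ) (ψ : Form) (S : Set Node) (σ : Mem V) :
    SigmaConvex (α.run J n ψ S σ) := by
  induction n generalizing ψ S σ with
  | zero => exact CSet.sigmaConvex_bot
  | succ n ih =>
    by_cases h : α.next ψ S = ∅
    · rw [run_succ_of_eq_empty h]
      exact CSet.sigmaConvex_eta _
    · rw [run_succ_of_ne_empty h]
      refine CSet.sigmaConvex_nd fun x => ?_
      unfold branch
      split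
      · exact CSet.sigmaConvex_bind (fun _ => ih _ _ _) (Action.sigmaConvex_semInv _ _)
      · split
        · exact ih _ _ _
        · exact CSet.sigmaConvex_bot
      · exact CSet.sigmaConvex_bot
      · exact ih _ _ _

theorem run_nonempty (α : LPOF) (n : ℕ) (ψ : Form) (S : Set Node) (σ : Mem V) :
    (α.run J n ψ S σ).Nonempty := by
  induction n generalizing ψ S σ with
  | zero => exact ⟨PMF.pure none, trivial⟩
  | succ n ih =>
    by_cases h : α.next ψ S = ∅
    · rw [run_succ_of_eq_empty h]
      exact Set.singleton_nonempty _
    · rw [run_succ_of_ne_empty h]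
      have : Nonempty (α.next ψ S) := (Set.nonempty_iff_ne_empty.2 h).to_subtype
      refine CSet.nd_nonempty fun x => ?_
      unfold branch
      split
      · exact CSet.bind_nonempty (Action.semInv_nonempty _ _) (fun _ => ih _ _ _)
      · split
        · exact ih _ _ _
        · exact ⟨PMF.pure none, trivial⟩
      · exact ⟨PMF.pure none, trivial⟩
      · exact ih _ _ _

/-- The nodes all of whose predecessors are in `D`. -/
def frontier (α : LPOF) (D : Set Node) : Set Node := {x ∈ α.N | ∀ y ∈ α.N, α.lt y x → y ∈ D}

theorem frontier_mono (α : LPOF) {D D' : Set Node} (h : D ⊆ D') :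
    α.frontier D ⊆ α.frontier D' := fun _ hx => ⟨hx.1, fun y hy hyx => h (hx.2 y hy hyx)⟩

theorem next_subset_frontier (α : LPOF) (ψ : Form) (S : Set Node) :
    α.next ψ S ⊆ α.frontier S := fun _ hx => ⟨hx.1, hx.2.2.1⟩

/-- From finitely many processed nodes only finitely many are ready, so each scheduling choice is a
finite convex union. -/
theorem limClosed_run {α : LPOF} (hα : ∀ D : Set Node, D.Finite → (α.frontier D).Finite)
    (hJ : J.Finite) (n : ℕ) (ψ : Form) {S : Set Node} (hS : S.Finite) (σ : Mem V) :
    LimClosed (α.run J n ψ S σ) := by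
  induction n generalizing ψ S σ with
  | zero => exact CSet.limClosed_bot
  | succ n ih =>
    by_cases h : α.next ψ S = ∅
    · rw [run_succ_of_eq_empty h]
      exact CSet.limClosed_eta _
    · rw [run_succ_of_ne_empty h]
      have : Finite (α.next ψ S) := (hα S hS).subset (α.next_subset_frontier ψ S)
      refine CSet.limClosed_nd fun x => ?_
      have ih' := fun ψ σ => ih ψ (hS.insert x.1) σ
      unfold branch
      split
      · exact CSet.limClosed_bind (fun _ => ih' _ _) (Action.limClosed_semInv hJ _ _)
      · split
        · exact ih' _ _
        · exact CSet.limClosed_bot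
      · exact CSet.limClosed_bot
      · exact ih' _ _

end LPOF

/-! ### Comparison with the linearization of finite approximations -/

theorem linLPOF_of_eq_empty {α : LPOF} {hα : α.N.Finite} {ψ : Form} {S : Set Node} {σ : Mem V}
    (h : α.next ψ S = ∅) : linLPOF J α hα ψ S σ = CSet.eta σ := by
  rw [linLPOF, if_pos h]

theorem linLPOF_of_ne_empty {α : LPOF} {hα : α.N.Finite} {ψ : Form} {S : Set Node} {σ : Mem V}
    (h : α.next ψ S ≠ ∅) : linLPOF J α hα ψ S σ = CSet.nd (fun x : α.next ψ S =>
      branch J (α.lab x.1) x.1 ψ (fun ψ' => linLPOF J α hα ψ' (insert x.1 S)) σ) := by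
  rw [linLPOF, if_neg h]
  rfl

namespace LPOF

/-- Transitivity of the causal order on the nodes. -/
def IsTransOn (α : LPOF) : Prop :=
  ∀ x ∈ α.N, ∀ y ∈ α.N, ∀ z ∈ α.N, α.lt z y → α.lt y x → α.lt z x

/-- A node above an unprocessed node of `K` is ready in neither structure. Transitivity shows that a
node kept by the cut has all its predecessors kept. -/
theorem next_cut {α : LPOF} (hα : α.IsTransOn) {K : Set Node} (hK : K ⊆ α.N) (ψ : Form)
    {S : Set Node} (hS : ∀ x ∈ S, x ∉ K) : (α.cut K).next ψ S = α.next ψ S := by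
  ext x
  constructor
  · rintro ⟨⟨hxN, hxK⟩, hxS, hp, hf⟩
    refine ⟨hxN, hxS, fun y hy hyx => hp y ⟨hy, ?_⟩ hyx, hf⟩
    rintro ⟨k, hk, hky⟩
    exact hxK ⟨k, hk, hα x hxN y hy k (hK hk) hky hyx⟩
  · rintro ⟨hxN, hxS, hp, hf⟩
    refine ⟨⟨hxN, ?_⟩, hxS, fun y hy hyx => hp y hy.1 hyx, hf⟩
    rintro ⟨k, hk, hkx⟩
    exact hS k (hp k (hK hk) hkx) hk

/-- Fuel exceeding the number of remaining nodes suffices to exhaust the cut; a schedule that meets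
`K` earlier yields the least element there. -/
theorem run_subset_linLPOF_cut {α : LPOF} (hα : α.IsTransOn) {K : Set Node} (hK : K ⊆ α.N)
    (hfin : (α.cut K).N.Finite) (n : ℕ) (ψ : Form) (S : Set Node) (σ : Mem V)
    (hS : ∀ x ∈ S, x ∉ K) (hn : ((α.cut K).N \ S).ncard < n) :
    α.run J n ψ S σ ⊆ linLPOF J (α.cut K) hfin ψ S σ := by
  induction n generalizing ψ S σ with
  | zero => omega
  | succ n ih =>
    have hnext := next_cut hα hK ψ hS
    by_cases h : α.next ψ S = ∅
    · rw [run_succ_of_eq_empty h, linLPOF_of_eq_empty (hnext.trans h)]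
    · rw [run_succ_of_ne_empty h, linLPOF_of_ne_empty (by rwa [hnext])]
      rw [← CSet.nd_equiv (Equiv.setCongr hnext.symm) (fun _ => rfl)]
      refine CSet.nd_mono fun x => ?_
      by_cases hxK : x.1 ∈ K
      · have : (α.cut K).lab x.1 = .bot := if_pos hxK
        simp only [Equiv.setCongr_apply, this]
        exact fun _ _ => trivial
      · have hlab : (α.cut K).lab x.1 = α.lab x.1 := if_neg hxK
        have hxc : x.1 ∈ (α.cut K).next ψ S := by rw [hnext]; exact x.2
        have hS' : ∀ y ∈ insert x.1 S, y ∉ K := by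
          rintro y (rfl | hy)
          exacts [hxK, hS y hy]
        have hlt : ((α.cut K).N \ insert x.1 S).ncard < n := by
          refine lt_of_lt_of_le (Set.ncard_lt_ncard ?_ (hfin.subset Set.sdiff_subset))
            (Nat.lt_succ_iff.1 hn)
          refine ⟨fun y hy => ⟨hy.1, fun h => hy.2 (Set.mem_insert_of_mem _ h)⟩, fun h => ?_⟩
          exact (h ⟨hxc.1, hxc.2.1⟩).2 (Set.mem_insert _ _)
        simp only [Equiv.setCongr_apply, hlab]
        exact branch_subset (fun _ τ => ih _ _ _ hS' hlt) (fun _ _ _ τ => ih _ _ _ hS' hlt) _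

/-- The nodes of height less than `n`. -/
def layer (α : LPOF) : ℕ → Set Node
  | 0 => ∅
  | n + 1 => α.frontier (α.layer n)

theorem layer_mono (α : LPOF) : Monotone α.layer := by
  refine monotone_nat_of_le_succ fun n => ?_
  induction n with
  | zero => exact Set.empty_subset _
  | succ n ih => exact α.frontier_mono ih

/-- After `i` steps only nodes of height less than `i` have been processed, so a cut at height `n`
stays invisible during the first `n` steps. -/
theorem linLPOF_cut_subset_run {α : LPOF} (hα : α.IsTransOn) {n : ℕ}
    (hfin : (α.cut (α.N \ α.layer n)).N.Finite) (j i : ℕ) (hij : i + j ≤ n) (ψ : Form)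
    (S : Set Node) (σ : Mem V) (hS : S ⊆ α.layer i) :
    linLPOF J (α.cut (α.N \ α.layer n)) hfin ψ S σ ⊆ α.run J j ψ S σ := by
  induction j generalizing i ψ S σ with
  | zero => exact fun _ _ => trivial
  | succ j ih =>
    have hnext := next_cut hα (K := α.N \ α.layer n) Set.sdiff_subset ψ (S := S)
      (fun x hx hxK => hxK.2 (α.layer_mono (by omega) (hS hx)))
    by_cases h : α.next ψ S = ∅
    · rw [run_succ_of_eq_empty h, linLPOF_of_eq_empty (hnext.trans h)]
    · rw [run_succ_of_ne_empty h, linLPOF_of_ne_empty (by rwa [hnext])]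
      rw [← CSet.nd_equiv (Equiv.setCongr hnext.symm) (fun _ => rfl)]
      refine CSet.nd_mono fun x => ?_
      have hx : x.1 ∈ α.layer (i + 1) :=
        α.frontier_mono hS (α.next_subset_frontier ψ S x.2)
      have hlab : (α.cut (α.N \ α.layer n)).lab x.1 = α.lab x.1 :=
        if_neg fun hK => hK.2 (α.layer_mono (by omega) hx)
      have hS' : insert x.1 S ⊆ α.layer (i + 1) :=
        Set.insert_subset hx (hS.trans (α.layer_mono (Nat.le_succ i)))
      simp only [Equiv.setCongr_apply, hlab]
      exact branch_subset (fun _ τ => ih (i + 1) (by omega) _ _ _ hS')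
        (fun _ _ _ τ => ih (i + 1) (by omega) _ _ _ hS') _

/-- Cuts and fuel bounds are cofinal in each other: a finite cut is dominated by enough fuel, and
`n` units of fuel by the cut at height `n`, which is finite because frontiers are. -/
theorem linPom_eq_iInter_run {α : LPOF} (hα : α.IsTransOn)
    (hfr : ∀ D : Set Node, D.Finite → (α.frontier D).Finite) (σ : Mem V) :
    linPom J α σ = ⋂ n, α.run J n (fun _ => True) ∅ σ := by
  have hlay : ∀ n, (α.layer n).Finite := by
    intro n
    induction n with
    | zero => exact Set.finite_empty
    | succ n ih => exact hfr _ ih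
  ext ρ
  simp only [Set.mem_iInter]
  constructor
  · intro h n
    have hfin : (α.cut (α.N \ α.layer n)).N.Finite := by
      refine (hfr _ (hlay n)).subset fun x hx => ⟨hx.1, fun y hy hyx => ?_⟩
      by_contra hyn
      exact hx.2 ⟨y, ⟨hy, hyn⟩, hyx⟩
    exact linLPOF_cut_subset_run hα hfin n 0 (by omega) _ _ _ (Set.empty_subset _)
      (h _ Set.sdiff_subset hfin)
  · intro h K hK hfin
    exact run_subset_linLPOF_cut hα hK hfin _ _ _ _ (by simp) (Nat.lt_succ_self _) (h _)

/-! ### Simulations -/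

/-- States of the two structures are related by `R`, and `e` matches their ready nodes. This one
principle handles a change of representative, entering a branch of a guarded choice, and entering a
copy of the second operand of a sequence. -/
theorem run_eq_of_simulation {α β : LPOF} (e : Node → Node) (he : Function.Injective e)
    (R : Form → Set Node → Form → Set Node → Prop)
    (hnext : ∀ ψ S ψ' S', R ψ S ψ' S' → β.next ψ' S' = e '' α.next ψ S)
    (hlab : ∀ x ∈ α.N, β.lab (e x) = α.lab x)
    (hstep : ∀ ψ S ψ' S', R ψ S ψ' S' → ∀ x ∈ α.next ψ S, (∀ b, α.lab x ≠ .test b) →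
      R ψ (insert x S) ψ' (insert (e x) S'))
    (htest : ∀ ψ S ψ' S', R ψ S ψ' S' → ∀ x ∈ α.next ψ S, ∀ b, α.lab x = .test b → ∀ r,
      R (fun v => ψ v ∧ v x = r) (insert x S) (fun v => ψ' v ∧ v (e x) = r) (insert (e x) S'))
    (n : ℕ) (ψ : Form) (S : Set Node) (ψ' : Form) (S' : Set Node) (σ : Mem V) (h : R ψ S ψ' S') :
    α.run J n ψ S σ = β.run J n ψ' S' σ := by
  induction n generalizing ψ S ψ' S' σ with
  | zero => rfl
  | succ n ih =>
    have hn := hnext _ _ _ _ h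
    by_cases h0 : α.next ψ S = ∅
    · rw [run_succ_of_eq_empty h0, run_succ_of_eq_empty (by rw [hn, h0, Set.image_empty])]
    · rw [run_succ_of_ne_empty h0, run_succ_of_ne_empty (by
        rw [hn]
        exact fun h => h0 (Set.image_eq_empty.1 h))]
      refine CSet.nd_equiv ((Equiv.Set.image e _ he).trans (Equiv.setCongr hn.symm)) fun x => ?_
      have hx : α.lab x.1 = β.lab (e x.1) := (hlab _ x.2.1).symm
      change branch J (β.lab (e x.1)) (e x.1) ψ' (fun ψ' => β.run J n ψ' (insert (e x.1) S')) σ = _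
      rw [← hx]
      refine subset_antisymm ?_ ?_
      · exact branch_subset (fun hb τ => (ih _ _ _ _ _ (hstep _ _ _ _ h _ x.2 hb)).ge)
          (fun b hb r τ => (ih _ _ _ _ _ (htest _ _ _ _ h _ x.2 b hb r)).ge) _
      · exact branch_subset (fun hb τ => (ih _ _ _ _ _ (hstep _ _ _ _ h _ x.2 hb)).le)
          (fun b hb r τ => (ih _ _ _ _ _ (htest _ _ _ _ h _ x.2 b hb r)).le) _

end LPOF

end run


namespace LPOF

/-! ## Well-formed LPOFs -/

/-- `x` is labelled by a test. -/
def IsTest (α : LPOF) (x : Node) : Prop := ∃ b, α.lab x = .test b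

/-- The conditions of well-formedness that concern the node `x` and its predecessors. -/
structure GoodAt (α : LPOF) (x : Node) : Prop where
  trans : ∀ y ∈ α.N, ∀ z ∈ α.N, α.lt z y → α.lt y x → α.lt z x
  acc : Acc (fun y x => y ∈ α.N ∧ x ∈ α.N ∧ α.lt y x) x
  form_anti : ∀ y ∈ α.N, α.lt y x → ∀ v, α.form x v → α.form y v
  form_local : ∀ v v', (∀ y ∈ α.N, α.lt y x → α.IsTest y → v y = v' y) →
    α.form x v → α.form x v'
  ne_bot : α.lab x ≠ .bot

/-- Well-formed LPOFs: the order is transitive, well-founded and finitely branching, formulae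
depend only on preceding tests and imply the formulae of the preceding nodes, and all labels are
determined. -/
structure Good (α : LPOF) : Prop where
  goodAt : ∀ x ∈ α.N, α.GoodAt x
  frontier : ∀ D : Set Node, D.Finite → (α.frontier D).Finite

/-- `α` and `β` have the same nodes and agree on them. -/
structure Agree (α β : LPOF) : Prop where
  N : α.N = β.N
  lt : ∀ x ∈ α.N, ∀ y ∈ α.N, α.lt x y ↔ β.lt x y
  lab : ∀ x ∈ α.N, α.lab x = β.lab x
  form : ∀ x ∈ α.N, ∀ v, α.form x v ↔ β.form x v

theorem Agree.symm {α β : LPOF} (h : α.Agree β) : β.Agree α where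
  N := h.N.symm
  lt x hx y hy := (h.lt x (h.N ▸ hx) y (h.N ▸ hy)).symm
  lab x hx := (h.lab x (h.N ▸ hx)).symm
  form x hx v := (h.form x (h.N ▸ hx) v).symm

theorem Agree.goodAt {α β : LPOF} (h : α.Agree β) {x : Node} (hx : x ∈ α.N) (hg : α.GoodAt x) :
    β.GoodAt x where
  trans y hy z hz hzy hyx := by
    rw [← h.N] at hy hz
    rw [← h.lt _ hz _ hx]
    exact hg.trans y hy z hz ((h.lt _ hz _ hy).2 hzy) ((h.lt _ hy _ hx).2 hyx)
  acc := by
    have : (fun y x => y ∈ β.N ∧ x ∈ β.N ∧ β.lt y x) =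
        (fun y x => y ∈ α.N ∧ x ∈ α.N ∧ α.lt y x) := by
      funext y x
      rw [← h.N]
      exact propext ⟨fun ⟨a, b, c⟩ => ⟨a, b, (h.lt _ a _ b).2 c⟩,
        fun ⟨a, b, c⟩ => ⟨a, b, (h.lt _ a _ b).1 c⟩⟩
    rw [this]
    exact hg.acc
  form_anti y hy hyx v hv := by
    rw [← h.N] at hy
    exact (h.form y hy v).1 (hg.form_anti y hy ((h.lt _ hy _ hx).2 hyx) v ((h.form x hx v).2 hv))
  form_local v v' hvv hv := by
    refine (h.form x hx _).1 (hg.form_local v v' (fun y hy hyx ⟨b, hb⟩ => ?_)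
      ((h.form x hx _).2 hv))
    exact hvv y (h.N ▸ hy) ((h.lt _ hy _ hx).1 hyx) ⟨b, (h.lab y hy) ▸ hb⟩
  ne_bot := (h.lab x hx) ▸ hg.ne_bot

theorem Agree.next_eq {α β : LPOF} (h : α.Agree β) (ψ : Form) (S : Set Node) :
    α.next ψ S = β.next ψ S := by
  ext x
  constructor
  · rintro ⟨hx, hxS, hp, hf⟩
    refine ⟨h.N ▸ hx, hxS, fun y hy hyx => ?_, fun v hv => (h.form x hx v).1 (hf v hv)⟩
    rw [← h.N] at hy
    exact hp y hy ((h.lt _ hy _ hx).2 hyx)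
  · rintro ⟨hx, hxS, hp, hf⟩
    rw [← h.N] at hx
    refine ⟨hx, hxS, fun y hy hyx => ?_, fun v hv => (h.form x hx v).2 (hf v hv)⟩
    exact hp y (h.N ▸ hy) ((h.lt _ hy _ hx).1 hyx)

theorem Agree.run_eq {T V : Finset Var} {J : Set (Mem T)} {α β : LPOF} (h : α.Agree β) (n : ℕ)
    (ψ : Form) (S : Set Node) (σ : Mem V) : α.run J n ψ S σ = β.run J n ψ S σ := by
  refine run_eq_of_simulation id Function.injective_id (fun ψ S ψ' S' => ψ = ψ' ∧ S = S')
    ?_ (fun x hx => (h.lab x hx).symm) ?_ ?_ n ψ S ψ S σ ⟨rfl, rfl⟩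
  · rintro ψ S _ _ ⟨rfl, rfl⟩
    rw [Set.image_id, h.next_eq]
  · rintro ψ S _ _ ⟨rfl, rfl⟩ x - -
    exact ⟨rfl, rfl⟩
  · rintro ψ S _ _ ⟨rfl, rfl⟩ x - b - r
    exact ⟨rfl, rfl⟩

theorem Good.isTransOn {α : LPOF} (h : α.Good) : α.IsTransOn :=
  fun x hx y hy z hz => (h.goodAt x hx).trans y hy z hz

/-! ### One node -/

theorem good_single {ℓ : Label} (h : ℓ ≠ .bot) : (single ℓ).Good where
  goodAt _ _ :=
    { trans := fun _ _ _ _ h => h.elim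
      acc := ⟨_, fun _ h => h.2.2.elim⟩
      form_anti := fun _ _ h => h.elim
      form_local := fun _ _ _ _ => trivial
      ne_bot := h }
  frontier _ _ := (Set.finite_singleton Node.root).subset fun _ hx => hx.1

/-! ### Guarded choice and parallel composition -/

theorem left_injective : Function.Injective Node.left := fun _ _ h => by injection h

theorem right_injective : Function.Injective Node.right := fun _ _ h => by injection h

theorem copy_injective (l : List (Node × Bool)) : Function.Injective (Node.copy l) :=
  fun _ _ h => by injection h

/-- An embedding of `α` above a minimal node, under an additional condition `G` on that node. -/
theorem GoodAt.of_embedding {α γ : LPOF} {e : Node → Node} {G : Form}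
    (hN : ∀ x, e x ∈ γ.N ↔ x ∈ α.N) (hroot : Node.root ∈ γ.N)
    (hlt : ∀ x y, γ.lt (e x) (e y) ↔ α.lt x y) (hlt_root : ∀ x, γ.lt .root (e x))
    (hroot_lt : ∀ y, ¬ γ.lt y .root)
    (hpred : ∀ x y, γ.lt y (e x) → y = .root ∨ ∃ y', y = e y')
    (hlab : ∀ x, γ.lab (e x) = α.lab x)
    (hform : ∀ x v, γ.form (e x) v ↔ G v ∧ α.form x (fun z => v (e z)))
    (hform_root : ∀ v, γ.form .root v)
    (hG : ∀ v v', (γ.IsTest .root → v .root = v' .root) → G v → G v')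
    {x : Node} (h : α.GoodAt x) : γ.GoodAt (e x) where
  trans y hy z hz hzy hyx := by
    rcases hpred _ _ hyx with rfl | ⟨y, rfl⟩
    · exact (hroot_lt _ hzy).elim
    · rcases hpred _ _ hzy with rfl | ⟨z, rfl⟩
      · exact hlt_root _
      · rw [hlt] at hzy hyx ⊢
        exact h.trans y ((hN _).1 hy) z ((hN _).1 hz) hzy hyx
  acc := by
    have := h.acc
    clear h
    induction this with
    | intro x _ ih =>
      refine ⟨_, fun y ⟨hyN, hxN, hyx⟩ => ?_⟩
      rcases hpred _ _ hyx with rfl | ⟨y, rfl⟩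
      · exact ⟨_, fun z hz => (hroot_lt _ hz.2.2).elim⟩
      · exact ih y ⟨(hN _).1 hyN, (hN _).1 hxN, (hlt _ _).1 hyx⟩
  form_anti y hy hyx v hv := by
    rcases hpred _ _ hyx with rfl | ⟨y, rfl⟩
    · exact hform_root v
    · rw [hform] at hv ⊢
      exact ⟨hv.1, h.form_anti y ((hN _).1 hy) ((hlt _ _).1 hyx) _ hv.2⟩
  form_local v v' hvv hv := by
    rw [hform] at hv ⊢
    refine ⟨hG v v' (fun ht => hvv _ hroot (hlt_root _) ht) hv.1,
      h.form_local _ _ (fun y hy hyx ht => ?_) hv.2⟩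
    refine hvv (e y) ((hN _).2 hy) ((hlt _ _).2 hyx) ?_
    unfold IsTest
    rwa [hlab]
  ne_bot := by
    rw [hlab]
    exact h.ne_bot

theorem frontier_finite_of_two {α β γ : LPOF}
    (hN : γ.N = {z | z = .root ∨ (∃ x ∈ α.N, z = .left x) ∨ ∃ x ∈ β.N, z = .right x})
    (hleft : ∀ x y, α.lt x y → γ.lt (.left x) (.left y))
    (hright : ∀ x y, β.lt x y → γ.lt (.right x) (.right y)) {D : Set Node}
    (hα : (α.frontier (Node.left ⁻¹' D)).Finite) (hβ : (β.frontier (Node.right ⁻¹' D)).Finite) :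
    (γ.frontier D).Finite := by
  refine (((Set.finite_singleton Node.root).union (hα.image Node.left)).union
    (hβ.image Node.right)).subset ?_
  rintro z ⟨hz, hp⟩
  rw [hN] at hz hp
  rcases hz with rfl | ⟨x, hx, rfl⟩ | ⟨x, hx, rfl⟩
  · exact Or.inl (Or.inl rfl)
  · exact Or.inl (Or.inr ⟨x, ⟨hx, fun y hy hyx =>
      hp (.left y) (Or.inr (Or.inl ⟨y, hy, rfl⟩)) (hleft _ _ hyx)⟩, rfl⟩)
  · exact Or.inr ⟨x, ⟨hx, fun y hy hyx =>
      hp (.right y) (Or.inr (Or.inr ⟨y, hy, rfl⟩)) (hright _ _ hyx)⟩, rfl⟩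

section guard

variable {b : Test} {α β : LPOF}

theorem root_mem_guard : Node.root ∈ (guard b α β).N := Or.inl rfl

@[simp] theorem left_mem_guard {x : Node} : .left x ∈ (guard b α β).N ↔ x ∈ α.N := by
  simp [guard]

@[simp] theorem right_mem_guard {x : Node} : .right x ∈ (guard b α β).N ↔ x ∈ β.N := by
  simp [guard]

@[simp] theorem copy_notMem_guard {l : List (Node × Bool)} {x : Node} :
    .copy l x ∉ (guard b α β).N := by
  simp [guard]

theorem not_guard_lt_root (y : Node) : ¬ (guard b α β).lt y .root := by
  cases y <;> exact id

theorem goodAt_guard_root : (guard b α β).GoodAt .root where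
  trans _ _ _ _ _ h := (not_guard_lt_root _ h).elim
  acc := ⟨_, fun _ h => (not_guard_lt_root _ h.2.2).elim⟩
  form_anti _ _ h := (not_guard_lt_root _ h).elim
  form_local _ _ _ _ := trivial
  ne_bot := by simp [guard]

theorem GoodAt.guard_left {x : Node} (h : α.GoodAt x) : (guard b α β).GoodAt (.left x) :=
  GoodAt.of_embedding (G := fun v => v .root = true) (fun _ => left_mem_guard) root_mem_guard
    (fun _ _ => Iff.rfl) (fun _ => trivial) not_guard_lt_root
    (fun x y h => by
      cases y with
      | root => exact Or.inl rfl
      | left y => exact Or.inr ⟨y, rfl⟩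
      | right y => exact h.elim
      | copy l y => exact h.elim)
    (fun _ => rfl) (fun _ _ => Iff.rfl) (fun _ => trivial)
    (fun _ _ hv h => (hv ⟨b, rfl⟩) ▸ h) h

theorem GoodAt.guard_right {x : Node} (h : β.GoodAt x) : (guard b α β).GoodAt (.right x) :=
  GoodAt.of_embedding (G := fun v => v .root = false) (fun _ => right_mem_guard) root_mem_guard
    (fun _ _ => Iff.rfl) (fun _ => trivial) not_guard_lt_root
    (fun x y h => by
      cases y with
      | root => exact Or.inl rfl
      | left y => exact h.elim
      | right y => exact Or.inr ⟨y, rfl⟩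
      | copy l y => exact h.elim)
    (fun _ => rfl) (fun _ _ => Iff.rfl) (fun _ => trivial)
    (fun _ _ hv h => (hv ⟨b, rfl⟩) ▸ h) h

theorem Good.guard (hα : α.Good) (hβ : β.Good) : (guard b α β).Good where
  goodAt x hx := by
    cases x with
    | root => exact goodAt_guard_root
    | left x => exact (hα.goodAt x (left_mem_guard.1 hx)).guard_left
    | right x => exact (hβ.goodAt x (right_mem_guard.1 hx)).guard_right
    | copy l x => exact (copy_notMem_guard hx).elim
  frontier D hD := frontier_finite_of_two rfl (fun _ _ => id) (fun _ _ => id)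
    (hα.frontier _ (hD.preimage left_injective.injOn))
    (hβ.frontier _ (hD.preimage right_injective.injOn))

end guard

section par

variable {α β : LPOF}

theorem root_mem_par : Node.root ∈ (par α β).N := Or.inl rfl

theorem left_mem_par {x : Node} : .left x ∈ (par α β).N ↔ x ∈ α.N := by
  simp [par]

theorem right_mem_par {x : Node} : .right x ∈ (par α β).N ↔ x ∈ β.N := by
  simp [par]

theorem not_par_lt_root (y : Node) : ¬ (par α β).lt y .root := by
  cases y <;> exact id

theorem Good.par (hα : α.Good) (hβ : β.Good) : (par α β).Good where
  goodAt x hx := by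
    cases x with
    | root =>
      exact
        { trans := fun _ _ _ _ _ h => (not_par_lt_root _ h).elim
          acc := ⟨_, fun _ h => (not_par_lt_root _ h.2.2).elim⟩
          form_anti := fun _ _ h => (not_par_lt_root _ h).elim
          form_local := fun _ _ _ _ => trivial
          ne_bot := by simp [LPOF.par] }
    | left x =>
      refine GoodAt.of_embedding (G := fun _ => True) (fun _ => left_mem_par) root_mem_par
        (fun _ _ => Iff.rfl) (fun _ => trivial) not_par_lt_root (fun x y h => ?_)
        (fun _ => rfl) (fun _ _ => (and_iff_right trivial).symm) (fun _ => trivial)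
        (fun _ _ _ h => h) (hα.goodAt x (left_mem_par.1 hx))
      cases y with
      | root => exact Or.inl rfl
      | left y => exact Or.inr ⟨y, rfl⟩
      | right y => exact h.elim
      | copy l y => exact h.elim
    | right x =>
      refine GoodAt.of_embedding (G := fun _ => True) (fun _ => right_mem_par) root_mem_par
        (fun _ _ => Iff.rfl) (fun _ => trivial) not_par_lt_root (fun x y h => ?_)
        (fun _ => rfl) (fun _ _ => (and_iff_right trivial).symm) (fun _ => trivial)
        (fun _ _ _ h => h) (hβ.goodAt x (right_mem_par.1 hx))
      cases y with
      | root => exact Or.inl rfl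
      | left y => exact h.elim
      | right y => exact Or.inr ⟨y, rfl⟩
      | copy l y => exact h.elim
    | copy l x => simp [LPOF.par] at hx
  frontier D hD := frontier_finite_of_two rfl (fun _ _ => id) (fun _ _ => id)
    (hα.frontier _ (hD.preimage left_injective.injOn))
    (hβ.frontier _ (hD.preimage right_injective.injOn))

end par

/-! ### Sequential composition -/

section seq

variable {α β : LPOF}

@[simp] theorem left_mem_seq {x : Node} : .left x ∈ (seq α β).N ↔ x ∈ α.N := by
  simp [seq]

@[simp] theorem copy_mem_seq {l : List (Node × Bool)} {y : Node} :
    .copy l y ∈ (seq α β).N ↔ α.Terminal l ∧ y ∈ β.N := by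
  simp [seq]

@[simp] theorem root_notMem_seq : .root ∉ (seq α β).N := by
  simp [seq]

@[simp] theorem right_notMem_seq {x : Node} : .right x ∉ (seq α β).N := by
  simp [seq]

theorem GoodAt.seq_left {x : Node} (h : α.GoodAt x) : (seq α β).GoodAt (.left x) where
  trans y hy z hz hzy hyx := by
    cases y with
    | left y =>
      cases z with
      | left z => exact h.trans y (left_mem_seq.1 hy) z (left_mem_seq.1 hz) hzy hyx
      | _ => exact hzy.elim
    | _ => exact hyx.elim
  acc := by
    have := h.acc
    clear h
    induction this with
    | intro x _ ih =>
      refine ⟨_, fun y ⟨hyN, hxN, hyx⟩ => ?_⟩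
      cases y with
      | left y => exact ih y ⟨left_mem_seq.1 hyN, left_mem_seq.1 hxN, hyx⟩
      | _ => exact hyx.elim
  form_anti y hy hyx v hv := by
    cases y with
    | left y => exact h.form_anti y (left_mem_seq.1 hy) hyx _ hv
    | _ => exact hyx.elim
  form_local v v' hvv hv :=
    h.form_local (fun z => v (.left z)) (fun z => v' (.left z))
      (fun y hy hyx ht => hvv (.left y) (left_mem_seq.2 hy) hyx ht) hv
  ne_bot := h.ne_bot

theorem GoodAt.seq_copy (hα : ∀ x ∈ α.N, α.GoodAt x) {l : List (Node × Bool)} (hl : α.Terminal l)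
    {y : Node} (h : β.GoodAt y) : (seq α β).GoodAt (.copy l y) where
  trans x hx z hz hzx hxy := by
    cases x with
    | left x =>
      cases z with
      | left z =>
        have hx' : x ∈ α.reached l := hxy
        exact ⟨left_mem_seq.1 hz, fun v hv => (hα x hx'.1).form_anti z (left_mem_seq.1 hz) hzx v
          (hx'.2 v hv)⟩
      | _ => exact hzx.elim
    | copy l' x =>
      obtain ⟨rfl, hxy⟩ := hxy
      cases z with
      | left z => exact hzx
      | copy l'' z =>
        obtain ⟨rfl, hzx⟩ := hzx
        exact ⟨rfl, h.trans x (copy_mem_seq.1 hx).2 z (copy_mem_seq.1 hz).2 hzx hxy⟩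
      | _ => exact hzx.elim
    | _ => exact hxy.elim
  acc := by
    have := h.acc
    clear h
    induction this with
    | intro y _ ih =>
      refine ⟨_, fun x ⟨hxN, hyN, hxy⟩ => ?_⟩
      cases x with
      | left x => exact (hα x (left_mem_seq.1 hxN)).seq_left.acc
      | copy l' x =>
        obtain ⟨rfl, hxy⟩ := hxy
        exact ih x ⟨(copy_mem_seq.1 hxN).2, (copy_mem_seq.1 hyN).2, hxy⟩
      | _ => exact hxy.elim
  form_anti x hx hxy v hv := by
    cases x with
    | left x => exact (show x ∈ α.reached l from hxy).2 _ hv.1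
    | copy l' x =>
      obtain ⟨rfl, hxy⟩ := hxy
      exact ⟨hv.1, h.form_anti x (copy_mem_seq.1 hx).2 hxy _ hv.2⟩
    | _ => exact hxy.elim
  form_local v v' hvv hv := by
    refine ⟨fun p hp => ?_, h.form_local (fun z => v (.copy l z)) (fun z => v' (.copy l z))
      (fun x hx hxy ht => ?_) hv.2⟩
    -- Every test listed in `l` is reached under `l` and therefore precedes the copy, so `v` and
    -- `v'` agree on it.
    · obtain ⟨hr, ht⟩ := (hl.2.2.2.1 p.1).1 ⟨p.2, hp⟩
      have := hvv (.left p.1) (left_mem_seq.2 hr.1) hr ht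
      exact this.symm.trans (hv.1 p hp)
    · exact hvv (.copy l x) (copy_mem_seq.2 ⟨hl, hx⟩) ⟨rfl, hxy⟩ ht
  ne_bot := h.ne_bot

/-- A terminal list is the canonical enumeration of a finite set of outcomes, and its tests are
reached nodes. Hence there are at most as many such lists as subsets of `D × Bool`. -/
theorem finite_terminal {D : Set Node} (hD : D.Finite) :
    {l | α.Terminal l ∧ α.reached l ⊆ D}.Finite := by
  have hfin : {t : Finset (Node × Bool) | (t : Set (Node × Bool)) ⊆ D ×ˢ Set.univ}.Finite := by
    have hD' : (D ×ˢ (Set.univ : Set Bool)).Finite := hD.prod Set.finite_univ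
    refine hD'.toFinset.powerset.finite_toSet.subset fun t ht => ?_
    rw [Finset.mem_coe, Finset.mem_powerset]
    exact fun p hp => hD'.mem_toFinset.2 (ht hp)
  refine (hfin.image Finset.toList).subset ?_
  rintro l ⟨hl, hlD⟩
  obtain ⟨t, rfl⟩ := hl.1
  refine ⟨t, fun p hp => ⟨hlD ?_, trivial⟩, rfl⟩
  exact ((hl.2.2.2.1 p.1).1 ⟨p.2, by simpa using hp⟩).1

theorem frontier_seq_finite {D : Set Node} (hα : (α.frontier (Node.left ⁻¹' D)).Finite)
    (hD : D.Finite) (hβ : ∀ l, (β.frontier (Node.copy l ⁻¹' D)).Finite) :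
    ((seq α β).frontier D).Finite := by
  refine ((hα.image Node.left).union ((finite_terminal (α := α)
    (hD.preimage left_injective.injOn)).biUnion fun l _ => (hβ l).image (Node.copy l))).subset ?_
  rintro z ⟨hz, hp⟩
  cases z with
  | left x =>
    exact Or.inl ⟨x, ⟨left_mem_seq.1 hz, fun y hy hyx => hp (.left y) (left_mem_seq.2 hy) hyx⟩, rfl⟩
  | copy l y =>
    obtain ⟨hl, hy⟩ := copy_mem_seq.1 hz
    refine Or.inr (Set.mem_biUnion (x := l) ⟨hl, fun x hx => hp (.left x)
      (left_mem_seq.2 hx.1) hx⟩ ⟨y, ⟨hy, fun x hx hxy => ?_⟩, rfl⟩)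
    exact hp (.copy l x) (copy_mem_seq.2 ⟨hl, hx⟩) ⟨rfl, hxy⟩
  | root => exact (root_notMem_seq hz).elim
  | right x => exact (right_notMem_seq hz).elim

theorem Good.seq (hα : α.Good) (hβ : β.Good) : (seq α β).Good where
  goodAt z hz := by
    cases z with
    | left x => exact (hα.goodAt x (left_mem_seq.1 hz)).seq_left
    | copy l y =>
      obtain ⟨hl, hy⟩ := copy_mem_seq.1 hz
      exact GoodAt.seq_copy hα.goodAt hl (hβ.goodAt y hy)
    | root => exact (root_notMem_seq hz).elim
    | right x => exact (right_notMem_seq hz).elim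
  frontier D hD := frontier_seq_finite (hα.frontier _ (hD.preimage left_injective.injOn)) hD
    fun l => hβ.frontier _ (hD.preimage (copy_injective l).injOn)

end seq

/-! ### Loops -/

section loop

variable {b : Test} {α : LPOF}

/-- The finite unrollings of a loop. -/
def unroll (b : Test) (α : LPOF) (n : ℕ) : LPOF :=
  (fun γ => LPOF.guard b (α.seq γ) (single .fork))^[n] (single .bot)

theorem unroll_succ (b : Test) (α : LPOF) (n : ℕ) :
    unroll b α (n + 1) = LPOF.guard b (α.seq (unroll b α n)) (single .fork) :=
  Function.iterate_succ_apply' _ _ _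

theorem mem_single {ℓ : Label} {x : Node} : x ∈ (single ℓ).N ↔ x = .root := Iff.rfl

theorem unroll_N_mono (b : Test) (α : LPOF) : Monotone (fun n => (unroll b α n).N) := by
  refine monotone_nat_of_le_succ fun n => ?_
  induction n with
  | zero =>
    intro x hx
    obtain rfl : x = .root := hx
    rw [unroll_succ]
    exact root_mem_guard
  | succ n ih =>
    intro x hx
    rw [unroll_succ] at hx ⊢
    cases x with
    | root => exact root_mem_guard
    | right x =>
      rw [right_mem_guard] at hx ⊢
      exact hx
    | copy l x => exact (copy_notMem_guard hx).elim
    | left x =>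
      rw [left_mem_guard] at hx ⊢
      cases x with
      | left x => simpa using hx
      | copy l y =>
        rw [copy_mem_seq] at hx ⊢
        exact ⟨hx.1, ih hx.2⟩
      | root => exact (root_notMem_seq hx).elim
      | right x => exact (right_notMem_seq hx).elim

theorem unroll_lab_congr (n m : ℕ) (x : Node) (hn : x ∈ (unroll b α n).N)
    (hm : x ∈ (unroll b α m).N) (hn' : (unroll b α n).lab x ≠ .bot)
    (hm' : (unroll b α m).lab x ≠ .bot) : (unroll b α n).lab x = (unroll b α m).lab x := by
  induction n generalizing m x with
  | zero => exact (hn' rfl).elim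
  | succ n ih =>
    cases m with
    | zero => exact (hm' rfl).elim
    | succ m =>
      rw [unroll_succ] at hn hm hn' hm' ⊢
      rw [unroll_succ]
      cases x with
      | root => rfl
      | right x => rfl
      | copy l x => rfl
      | left x =>
        rw [left_mem_guard] at hn hm
        cases x with
        | copy l y => exact ih m y (copy_mem_seq.1 hn).2 (copy_mem_seq.1 hm).2 hn' hm'
        | _ => rfl

theorem unroll_form_congr (n m : ℕ) (x : Node) (hn : x ∈ (unroll b α n).N)
    (hm : x ∈ (unroll b α m).N) (v : Node → Bool) :
    (unroll b α n).form x v ↔ (unroll b α m).form x v := by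
  induction n generalizing m x v with
  | zero =>
    obtain rfl : x = .root := hn
    cases m with
    | zero => rfl
    | succ m =>
      rw [unroll_succ]
      rfl
  | succ n ih =>
    cases m with
    | zero =>
      obtain rfl : x = .root := hm
      rw [unroll_succ]
      rfl
    | succ m =>
      rw [unroll_succ] at hn hm ⊢
      rw [unroll_succ]
      cases x with
      | root => rfl
      | right x => rfl
      | copy l x => rfl
      | left x =>
        rw [left_mem_guard] at hn hm
        cases x with
        | copy l y =>
          exact and_congr Iff.rfl (and_congr Iff.rfl
            (ih m y (copy_mem_seq.1 hn).2 (copy_mem_seq.1 hm).2 _))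
        | _ => rfl

theorem mem_loop {x : Node} : x ∈ (loop b α).N ↔ ∃ n, x ∈ (unroll b α n).N := Iff.rfl

theorem loop_lt {x y : Node} : (loop b α).lt x y ↔
    ∃ n, x ∈ (unroll b α n).N ∧ y ∈ (unroll b α n).N ∧ (unroll b α n).lt x y := Iff.rfl

theorem root_mem_loop : .root ∈ (loop b α).N := ⟨0, rfl⟩

theorem exists_unroll_succ {x : Node} (hx : x ∈ (loop b α).N) :
    ∃ n, x ∈ (unroll b α (n + 1)).N := by
  obtain ⟨n, hn⟩ := hx
  exact ⟨n, unroll_N_mono b α (Nat.le_succ n) hn⟩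

theorem loop_lab {x : Node} {n : ℕ} (hx : x ∈ (unroll b α n).N)
    (h : (unroll b α n).lab x ≠ .bot) : (loop b α).lab x = (unroll b α n).lab x := by
  have hex : ∃ n, x ∈ (unroll b α n).N ∧ (unroll b α n).lab x ≠ .bot := ⟨n, hx, h⟩
  have : (loop b α).lab x = (unroll b α hex.choose).lab x := dif_pos hex
  rw [this]
  exact unroll_lab_congr _ _ _ hex.choose_spec.1 hx hex.choose_spec.2 h

theorem loop_lab_bot {x : Node} (h : ∀ n, x ∈ (unroll b α n).N → (unroll b α n).lab x = .bot) :
    (loop b α).lab x = .bot :=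
  dif_neg fun ⟨n, hx, hn⟩ => hn (h n hx)

/-- Node names do not depend on the depth of unrolling, so the supremum solves the loop equation
without renaming. Only agreement on the nodes can be expected, and scheduling sees no more than
that. -/
theorem loop_agree (b : Test) (α : LPOF) (hα : ∀ x ∈ α.N, α.lab x ≠ .bot) :
    (loop b α).Agree (LPOF.guard b (α.seq (loop b α)) (single .fork)) where
  N := by
    ext x
    cases x with
    | root => exact ⟨fun _ => root_mem_guard, fun _ => root_mem_loop⟩
    | copy l x =>
      refine ⟨fun h => ?_, fun h => (copy_notMem_guard h).elim⟩
      obtain ⟨n, hn⟩ := exists_unroll_succ h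
      rw [unroll_succ] at hn
      exact (copy_notMem_guard hn).elim
    | right x =>
      rw [right_mem_guard]
      constructor
      · intro h
        obtain ⟨n, hn⟩ := exists_unroll_succ h
        rw [unroll_succ] at hn
        exact right_mem_guard.1 hn
      · intro h
        refine mem_loop.2 ⟨1, ?_⟩
        rw [unroll_succ]
        exact right_mem_guard.2 h
    | left x =>
      rw [left_mem_guard]
      constructor
      · intro h
        obtain ⟨n, hn⟩ := exists_unroll_succ h
        rw [unroll_succ, left_mem_guard] at hn
        cases x with
        | left x => simpa using hn
        | copy l y =>
          rw [copy_mem_seq] at hn ⊢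
          exact ⟨hn.1, n, hn.2⟩
        | root => exact (root_notMem_seq hn).elim
        | right x => exact (right_notMem_seq hn).elim
      · intro h
        cases x with
        | left x =>
          refine mem_loop.2 ⟨1, ?_⟩
          rw [unroll_succ]
          simpa using h
        | copy l y =>
          obtain ⟨hl, n, hn⟩ := copy_mem_seq.1 h
          refine mem_loop.2 ⟨n + 1, ?_⟩
          rw [unroll_succ, left_mem_guard]
          exact copy_mem_seq.2 ⟨hl, hn⟩
        | root => exact (root_notMem_seq h).elim
        | right x => exact (right_notMem_seq h).elim
  lt x hx y hy := by
    rw [loop_lt]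
    constructor
    · rintro ⟨n, hxn, hyn, h⟩
      cases n with
      | zero => exact h.elim
      | succ n =>
        rw [unroll_succ] at hxn hyn h
        rcases x with _ | x | x | ⟨l, x⟩ <;> rcases y with _ | y | y | ⟨l', y⟩ <;>
          try exact h
        rw [left_mem_guard] at hxn hyn
        rcases x with _ | x | x | ⟨l, x⟩ <;> rcases y with _ | y | y | ⟨l', y⟩ <;>
          try exact h
        exact ⟨h.1, n, (copy_mem_seq.1 hxn).2, (copy_mem_seq.1 hyn).2, h.2⟩
    · intro h
      obtain ⟨n, hxn⟩ := exists_unroll_succ hx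
      obtain ⟨m, hym⟩ := exists_unroll_succ hy
      have hx' := unroll_N_mono b α (Nat.succ_le_succ (le_max_left n m)) hxn
      have hy' := unroll_N_mono b α (Nat.succ_le_succ (le_max_right n m)) hym
      -- Only between two nodes in copies of the inner loop does the order depend on the unrolling
      -- depth; all other pairs are decided by the outermost layer.
      by_cases hc : ∃ l l' x' y', x = .left (.copy l x') ∧ y = .left (.copy l' y')
      · obtain ⟨l, l', x', y', rfl, rfl⟩ := hc
        obtain ⟨hl, hlt⟩ := h
        obtain ⟨k, hxk, hyk, hk⟩ := loop_lt.1 hlt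
        refine ⟨k + 1, ?_, ?_, ?_⟩
        · simp only [unroll_succ, left_mem_guard, copy_mem_seq] at hx' ⊢
          exact ⟨hx'.1, hxk⟩
        · simp only [unroll_succ, left_mem_guard, copy_mem_seq] at hy' ⊢
          exact ⟨hy'.1, hyk⟩
        · rw [unroll_succ]
          exact ⟨hl, hk⟩
      · refine ⟨max n m + 1, hx', hy', ?_⟩
        rw [unroll_succ]
        rcases x with _ | x | x | ⟨l, x⟩ <;> rcases y with _ | y | y | ⟨l', y⟩ <;>
          try exact h
        rcases x with _ | x | x | ⟨l, x⟩ <;> rcases y with _ | y | y | ⟨l', y⟩ <;>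
          try exact h
        exact (hc ⟨l, l', x, y, rfl, rfl⟩).elim
  lab x hx := by
    obtain ⟨n, hn⟩ := exists_unroll_succ hx
    by_cases hc : ∃ l y, x = .left (.copy l y)
    · obtain ⟨l, y, rfl⟩ := hc
      have hy : α.Terminal l ∧ y ∈ (unroll b α n).N := by
        rw [unroll_succ] at hn
        simpa using hn
      change _ = (loop b α).lab y
      by_cases hb : ∃ k, y ∈ (unroll b α k).N ∧ (unroll b α k).lab y ≠ .bot
      · obtain ⟨k, hyk, hk⟩ := hb
        rw [loop_lab hyk hk]
        have := loop_lab (b := b) (α := α) (x := .left (.copy l y)) (n := k + 1)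
          (by rw [unroll_succ]; simpa using ⟨hy.1, hyk⟩) (by rw [unroll_succ]; exact hk)
        rw [this, unroll_succ]
        rfl
      · push Not at hb
        rw [loop_lab_bot hb, loop_lab_bot]
        intro k hk
        cases k with
        | zero => rfl
        | succ k =>
          rw [unroll_succ] at hk ⊢
          have : y ∈ (unroll b α k).N := by
            simp only [left_mem_guard, copy_mem_seq] at hk
            exact hk.2
          exact hb k this
    · have he : (unroll b α (n + 1)).lab x =
          (LPOF.guard b (α.seq (loop b α)) (single .fork)).lab x := by
        rw [unroll_succ]
        rcases x with _ | x | x | ⟨l, x⟩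
        · rfl
        · rcases x with _ | x | x | ⟨l, x⟩
          · rfl
          · rfl
          · rfl
          · exact (hc ⟨l, x, rfl⟩).elim
        · rfl
        · rfl
      rw [← he]
      refine loop_lab hn ?_
      rw [he]
      rw [unroll_succ] at hn
      rcases x with _ | x | x | ⟨l, x⟩
      · simp [LPOF.guard]
      · rcases x with _ | x | x | ⟨l, x⟩
        · simp at hn
        · exact hα x (by simpa using hn)
        · simp at hn
        · exact (hc ⟨l, x, rfl⟩).elim
      · simp [LPOF.guard, single]
      · simp at hn
  form x hx v := by
    obtain ⟨n, hn⟩ := exists_unroll_succ hx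
    have hiff : ∀ {y : Node} {k : ℕ} (u : Node → Bool), y ∈ (unroll b α k).N →
        ((loop b α).form y u ↔ (unroll b α k).form y u) := fun u hy =>
      ⟨fun ⟨m, hm, h⟩ => (unroll_form_congr _ _ _ hm hy u).1 h, fun h => ⟨_, hy, h⟩⟩
    rw [hiff v hn]
    rw [unroll_succ] at hn ⊢
    rcases x with _ | x | x | ⟨l, x⟩
    · rfl
    · rcases x with _ | x | x | ⟨l, x⟩
      · rfl
      · rfl
      · rfl
      · rw [left_mem_guard, copy_mem_seq] at hn
        exact and_congr Iff.rfl (and_congr Iff.rfl (hiff _ hn.2).symm)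
    · rfl
    · rfl

/-- Induction on the first unrolling that contains the node: through the loop equation, a node of
the inner loop has already appeared one level earlier. -/
theorem goodAt_loop (hα : α.Good) : ∀ x, x ∈ (loop b α).N → (loop b α).GoodAt x := by
  have hag := loop_agree b α (fun x hx => (hα.goodAt x hx).ne_bot)
  have key : ∀ x, x ∈ (loop b α).N →
      (LPOF.guard b (α.seq (loop b α)) (single .fork)).GoodAt x →
      (loop b α).GoodAt x := fun x hx h => hag.symm.goodAt (hag.N ▸ hx) h
  have main : ∀ n x, x ∈ (unroll b α n).N → (loop b α).GoodAt x := by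
    intro n
    induction n with
    | zero =>
      intro x hx
      obtain rfl : x = .root := hx
      exact key _ root_mem_loop goodAt_guard_root
    | succ n ih =>
      intro x hx
      refine key x ⟨_, hx⟩ ?_
      rw [unroll_succ] at hx
      cases x with
      | root => exact goodAt_guard_root
      | right x => exact ((good_single (by simp)).goodAt x (right_mem_guard.1 hx)).guard_right
      | copy l x => exact (copy_notMem_guard hx).elim
      | left x =>
        rw [left_mem_guard] at hx
        refine GoodAt.guard_left ?_
        cases x with
        | left x => exact (hα.goodAt x (left_mem_seq.1 hx)).seq_left
        | copy l y =>
          obtain ⟨hl, hy⟩ := copy_mem_seq.1 hx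
          exact GoodAt.seq_copy hα.goodAt hl (ih y hy)
        | root => exact (root_notMem_seq hx).elim
        | right x => exact (right_notMem_seq hx).elim
  exact fun x ⟨n, hn⟩ => main n x hn

theorem Agree.frontier_eq {α β : LPOF} (h : α.Agree β) (D : Set Node) :
    α.frontier D = β.frontier D := by
  ext x
  unfold LPOF.frontier
  rw [← h.N]
  exact and_congr_right fun hx => forall₂_congr fun y hy => by rw [h.lt y hy x hx]

/-- Induction on the size of `D`. Without the root in `D`, only the root can be on the frontier.
With it, the part of `D` seen by any copy of the inner loop is strictly smaller, since it misses the
root. -/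
theorem Good.loop (hα : α.Good) : (loop b α).Good where
  goodAt := goodAt_loop hα
  frontier D hD := by
    have hag := loop_agree b α (fun x hx => (hα.goodAt x hx).ne_bot)
    induction hn : D.ncard using Nat.strong_induction_on generalizing D with
    | _ n ih =>
      subst hn
      by_cases hr : Node.root ∈ D
      · rw [hag.frontier_eq]
        refine frontier_finite_of_two rfl (fun _ _ => id) (fun _ _ => id) ?_
          ((good_single (by simp)).frontier _ (hD.preimage right_injective.injOn))
        have hD' := hD.preimage left_injective.injOn
        refine frontier_seq_finite (hα.frontier _ (hD'.preimage left_injective.injOn)) hD'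
          fun l => ?_
        have hD'' := hD'.preimage (copy_injective l).injOn
        refine ih _ ?_ _ hD'' rfl
        rw [← Set.ncard_image_of_injective _ (left_injective.comp (copy_injective l))]
        refine Set.ncard_lt_ncard ⟨?_, fun h => ?_⟩ hD
        · rintro _ ⟨x, hx, rfl⟩
          exact hx
        · obtain ⟨x, -, hx⟩ := h hr
          simp at hx
      · refine (Set.finite_singleton Node.root).subset ?_
        rintro x ⟨hx, hp⟩
        by_contra hne
        refine hr (hp _ root_mem_loop ?_)
        rw [hag.lt _ root_mem_loop _ hx]
        rw [hag.N] at hx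
        cases x with
        | root => exact (hne rfl).elim
        | left x => trivial
        | right x => trivial
        | copy l x => exact (copy_notMem_guard hx).elim

end loop

end LPOF

theorem Cmd.good_den : ∀ C : Cmd, C.den.Good
  | .skip => LPOF.good_single (by simp)
  | .seq C₁ C₂ => C₁.good_den.seq C₂.good_den
  | .par C₁ C₂ => C₁.good_den.par C₂.good_den
  | .ite _ C₁ C₂ => C₁.good_den.guard C₂.good_den
  | .while _ C => C.good_den.loop
  | .act _ => LPOF.good_single (by simp)


namespace LPOF

/-! ## Reachable states -/

/-- The invariant of schedules: the path condition `ψ` fixes exactly the outcomes of the tests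
among the processed nodes `S`, and it entails the formulae of these nodes. -/
structure State (α : LPOF) (ψ : Form) (S : Set Node) : Prop where
  finite : S.Finite
  subset : S ⊆ α.N
  cond : ∃ o : Node → Bool, ∀ v, ψ v ↔ ∀ x ∈ S, α.IsTest x → v x = o x
  entails : ∀ x ∈ S, ∀ v, ψ v → α.form x v

namespace State

variable {α : LPOF} {ψ : Form} {S : Set Node}

theorem start (α : LPOF) : α.State (fun _ => True) ∅ where
  finite := Set.finite_empty
  subset := Set.empty_subset _
  cond := ⟨fun _ => true, by simp⟩
  entails := by simp

theorem sat (h : α.State ψ S) : ∃ v, ψ v := by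
  obtain ⟨o, ho⟩ := h.cond
  exact ⟨o, (ho o).2 fun _ _ _ => rfl⟩

theorem step (h : α.State ψ S) {x : Node} (hx : x ∈ α.next ψ S) (hl : ∀ b, α.lab x ≠ .test b) :
    α.State ψ (insert x S) where
  finite := h.finite.insert x
  subset := Set.insert_subset hx.1 h.subset
  cond := by
    obtain ⟨o, ho⟩ := h.cond
    refine ⟨o, fun v => (ho v).trans ⟨fun hv y hy ht => ?_, fun hv y hy => hv y (Or.inr hy)⟩⟩
    rcases hy with rfl | hy
    · exact (hl _ ht.choose_spec).elim
    · exact hv y hy ht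
  entails := by
    rintro y (rfl | hy)
    exacts [hx.2.2.2, h.entails y hy]

theorem test (h : α.State ψ S) {x : Node} (hx : x ∈ α.next ψ S) {b : Test}
    (hl : α.lab x = .test b) (r : Bool) :
    α.State (fun v => ψ v ∧ v x = r) (insert x S) where
  finite := h.finite.insert x
  subset := Set.insert_subset hx.1 h.subset
  cond := by
    classical
    obtain ⟨o, ho⟩ := h.cond
    refine ⟨Function.update o x r, fun v => ⟨?_, fun hv => ⟨(ho v).2 fun y hy ht => ?_, ?_⟩⟩⟩
    · rintro ⟨hv, rfl⟩ y (rfl | hy) ht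
      · simp
      · rw [Function.update_of_ne (ne_of_mem_of_not_mem hy hx.2.1)]
        exact (ho v).1 hv y hy ht
    · have := hv y (Or.inr hy) ht
      rwa [Function.update_of_ne (ne_of_mem_of_not_mem hy hx.2.1)] at this
    · simpa using hv x (Or.inl rfl) ⟨b, hl⟩
  entails := by
    rintro y (rfl | hy) v hv
    exacts [hx.2.2.2 v hv.1, h.entails y hy v hv.1]

/-- A complete execution contradicts the formulae of all nodes that were not processed. -/
theorem mem_of_next_eq_empty (h : α.State ψ S) (hα : α.Good) (hn : α.next ψ S = ∅) {x : Node}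
    (hx : x ∈ α.N) {v : Node → Bool} (hv : ψ v) (hf : α.form x v) : x ∈ S := by
  have := (hα.goodAt x hx).acc
  induction this with
  | intro x _ ih =>
    by_contra hxS
    have hp : ∀ y ∈ α.N, α.lt y x → y ∈ S := fun y hy hyx =>
      ih y ⟨hy, hx, hyx⟩ hy ((hα.goodAt x hx).form_anti y hy hyx v hf)
    -- By induction all predecessors of `x` are processed, so `ψ` fixes every test on which the
    -- formula of `x` depends; true in one valuation, it is then entailed.
    have hmem : x ∈ α.next ψ S := by
      refine ⟨hx, hxS, hp, fun u hu => (hα.goodAt x hx).form_local v u (fun y hy hyx ht => ?_) hf⟩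
      obtain ⟨o, ho⟩ := h.cond
      rw [(ho v).1 hv y (hp y hy hyx) ht, (ho u).1 hu y (hp y hy hyx) ht]
    rw [hn] at hmem
    exact hmem

/-- A schedule with nothing left to do determines a complete finite execution, and thereby the copy
of the second operand in which a sequential composition continues. -/
theorem exists_terminal (h : α.State ψ S) (hα : α.Good) (hn : α.next ψ S = ∅) :
    ∃ l, α.Terminal l ∧ α.reached l = S ∧ ∀ v, ψ v ↔ outcomes l v := by
  classical
  obtain ⟨o, ho⟩ := h.cond
  set t : Finset (Node × Bool) :=
    (h.finite.toFinset.filter (fun x => α.IsTest x)).image (fun x => (x, o x)) with ht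
  have hmem : ∀ x r, (x, r) ∈ t.toList ↔ x ∈ S ∧ α.IsTest x ∧ r = o x := by
    intro x r
    simp only [ht, Finset.mem_toList, Finset.mem_image, Finset.mem_filter,
      Set.Finite.mem_toFinset, Prod.mk.injEq]
    constructor
    · rintro ⟨y, ⟨hy, hyt⟩, rfl, rfl⟩
      exact ⟨hy, hyt, rfl⟩
    · rintro ⟨hx, hxt, rfl⟩
      exact ⟨x, ⟨hx, hxt⟩, rfl, rfl⟩
  have hiff : ∀ v, ψ v ↔ outcomes t.toList v := by
    intro v
    rw [ho]
    constructor
    · rintro hv ⟨x, r⟩ hp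
      obtain ⟨hx, hxt, rfl⟩ := (hmem x r).1 hp
      exact hv x hx hxt
    · intro hv x hx hxt
      exact hv (x, o x) ((hmem _ _).2 ⟨hx, hxt, rfl⟩)
  obtain ⟨v₀, hv₀⟩ := h.sat
  have hreach : α.reached t.toList = S := by
    ext x
    constructor
    · rintro ⟨hx, hf⟩
      exact h.mem_of_next_eq_empty hα hn hx hv₀ (hf v₀ ((hiff v₀).1 hv₀))
    · intro hx
      exact ⟨h.subset hx, fun v hv => h.entails x hx v ((hiff v).2 hv)⟩
  refine ⟨t.toList, ⟨⟨t, rfl⟩, ⟨v₀, (hiff _).1 hv₀⟩, ?_, ?_, ?_, ?_⟩, hreach, hiff⟩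
  · rw [hreach]
    exact h.finite
  · intro x
    rw [hreach]
    constructor
    · rintro ⟨r, hr⟩
      exact ⟨((hmem _ _).1 hr).1, ((hmem _ _).1 hr).2.1⟩
    · rintro ⟨hx, hxt⟩
      exact ⟨o x, (hmem _ _).2 ⟨hx, hxt, rfl⟩⟩
  · intro x hx hxr v hv hf
    rw [hreach] at hxr
    exact hxr (h.mem_of_next_eq_empty hα hn hx ((hiff v).2 hv) hf)
  · rw [hreach]
    exact fun x hx => (hα.goodAt x (h.subset hx)).ne_bot

end State

/-- Comparable executions reach the same nodes and hence decide the same tests alike. This excludes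
that a path condition enables two copies of the second operand. -/
theorem Terminal.eq_of_imp {α : LPOF} {l l' : List (Node × Bool)} (hl : α.Terminal l)
    (hl' : α.Terminal l') (h : ∀ v, outcomes l v → outcomes l' v) : l = l' := by
  obtain ⟨v₀, hv₀⟩ := hl.2.1
  have hr : α.reached l = α.reached l' := by
    ext x
    constructor
    · intro hx
      by_contra hx'
      exact hl'.2.2.2.2.1 x hx.1 hx' v₀ (h v₀ hv₀) (hx.2 v₀ hv₀)
    · exact fun hx => ⟨hx.1, fun v hv => hx.2 v (h v hv)⟩
  have hmem : ∀ p, p ∈ l ↔ p ∈ l' := by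
    rintro ⟨x, r⟩
    constructor
    · intro hp
      have h1 := (hl.2.2.2.1 x).1 ⟨r, hp⟩
      rw [hr] at h1
      obtain ⟨r', hr'⟩ := (hl'.2.2.2.1 x).2 h1
      have e1 : v₀ x = r := hv₀ _ hp
      have e2 : v₀ x = r' := h v₀ hv₀ _ hr'
      rwa [← e1, e2]
    · intro hp
      have h1 := (hl'.2.2.2.1 x).1 ⟨r, hp⟩
      rw [← hr] at h1
      obtain ⟨r', hr'⟩ := (hl.2.2.2.1 x).2 h1
      have e1 : v₀ x = r' := hv₀ _ hr'
      have e2 : v₀ x = r := h v₀ hv₀ _ hp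
      rwa [← e2, e1]
  obtain ⟨t, rfl⟩ := hl.1
  obtain ⟨t', rfl⟩ := hl'.1
  congr 1
  ext p
  simpa using hmem p

/-! ## Linearization of guarded choices and sequential compositions -/

section run

variable {T V : Finset Var} {J : Set (Mem T)}

theorem next_guard_init (b : Test) (α β : LPOF) :
    (LPOF.guard b α β).next (fun _ => True) ∅ = {.root} := by
  ext x
  rw [Set.mem_singleton_iff]
  constructor
  · rintro ⟨hx, -, hp, -⟩
    cases x with
    | root => rfl
    | left x => exact (hp .root root_mem_guard trivial).elim
    | right x => exact (hp .root root_mem_guard trivial).elim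
    | copy l x => exact (copy_notMem_guard hx).elim
  · rintro rfl
    exact ⟨root_mem_guard, id, fun y _ hy => (not_guard_lt_root y hy).elim, fun _ _ => trivial⟩

/-- Path conditions of the guarded choice are those of `α` together with the outcome at the root.
They stay satisfiable, so no node of the other branch becomes ready. -/
theorem run_guard_left (b : Test) (α β : LPOF) (n : ℕ) (σ : Mem V) :
    (LPOF.guard b α β).run J n (fun v => True ∧ v .root = true) {.root} σ =
      α.run J n (fun _ => True) ∅ σ := by
  refine (run_eq_of_simulation Node.left left_injective
    (fun ψ S ψ' S' => α.State ψ S ∧ (∀ v, ψ' v ↔ v .root = true ∧ ψ (fun z => v (.left z))) ∧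
      S' = insert .root (Node.left '' S)) ?_ (fun _ _ => rfl) ?_ ?_ n _ _ _ _ σ
    ⟨State.start α, fun v => by simp, by simp⟩).symm
  · rintro ψ S ψ' S' ⟨hs, hψ, rfl⟩
    have hext : ∀ u : Node → Bool, ∃ v : Node → Bool, v .root = true ∧ (fun z => v (.left z)) = u :=
      fun u => ⟨fun z => match z with | .left z => u z | _ => true, rfl, rfl⟩
    ext x
    constructor
    · rintro ⟨hx, hxS, hp, hf⟩
      cases x with
      | root => exact (hxS (Or.inl rfl)).elim
      | left x =>
        refine ⟨x, ⟨left_mem_guard.1 hx, fun h => hxS (Or.inr ⟨x, h, rfl⟩), fun y hy hyx => ?_,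
          fun u hu => ?_⟩, rfl⟩
        · rcases hp (.left y) (left_mem_guard.2 hy) hyx with h | ⟨y', hy', h⟩
          · cases h
          · exact left_injective h ▸ hy'
        · obtain ⟨v, hv, rfl⟩ := hext u
          exact (hf v ((hψ v).2 ⟨hv, hu⟩)).2
      | right x =>
        obtain ⟨u, hu⟩ := hs.sat
        obtain ⟨v, hv, rfl⟩ := hext u
        have := (hf v ((hψ v).2 ⟨hv, hu⟩)).1
        rw [hv] at this
        cases this
      | copy l x => exact (copy_notMem_guard hx).elim
    · rintro ⟨x, ⟨hx, hxS, hp, hf⟩, rfl⟩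
      refine ⟨left_mem_guard.2 hx, ?_, fun y hy hyx => ?_, fun v hv => ?_⟩
      · rintro (h | ⟨y, hy, h⟩)
        · cases h
        · exact hxS (left_injective h ▸ hy)
      · cases y with
        | root => exact Or.inl rfl
        | left y => exact Or.inr ⟨y, hp y (left_mem_guard.1 hy) hyx, rfl⟩
        | right y => exact hyx.elim
        | copy l y => exact hyx.elim
      · exact ⟨((hψ v).1 hv).1, hf _ ((hψ v).1 hv).2⟩
  · rintro ψ S ψ' S' ⟨hs, hψ, rfl⟩ x hx hl
    refine ⟨hs.step hx hl, hψ, ?_⟩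
    rw [Set.image_insert_eq, Set.insert_comm]
  · rintro ψ S ψ' S' ⟨hs, hψ, rfl⟩ x hx b' hl r
    refine ⟨hs.test hx hl r, fun v => ?_, ?_⟩
    · exact (and_congr_left' (hψ v)).trans and_assoc
    · rw [Set.image_insert_eq, Set.insert_comm]

theorem run_guard_of_true {b : Test} {σ : Mem V} (hb : b.eval σ = some true) (α β : LPOF) (n : ℕ) :
    (LPOF.guard b α β).run J (n + 1) (fun _ => True) ∅ σ = α.run J n (fun _ => True) ∅ σ := by
  rw [run_succ_of_ne_empty (by rw [next_guard_init]; exact Set.singleton_ne_empty _)]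
  have hu := next_guard_init b α β
  let e : Unit ≃ (LPOF.guard b α β).next (fun _ => True) ∅ :=
    (Equiv.equivPUnit (({.root} : Set Node))).symm.trans (Equiv.setCongr hu.symm)
  rw [← CSet.nd_equiv e (fun _ => rfl), CSet.nd_unique]
  have he : (e default).1 = .root := rfl
  rw [he]
  change branch J (.test b) _ _ _ _ = _
  simp only [branch, hb, insert_empty_eq]
  exact run_guard_left b α β n σ

theorem next_guard_single_of_false (b : Test) (α : LPOF) :
    (LPOF.guard b α (single .fork)).next (fun v => True ∧ v .root = false) {.root} =
      {.right .root} := by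
  ext x
  rw [Set.mem_singleton_iff]
  constructor
  · rintro ⟨hx, hxS, hp, hf⟩
    cases x with
    | root => exact (hxS rfl).elim
    | left x => simpa using (hf (fun _ => false) ⟨trivial, rfl⟩).1
    | right x => rw [mem_single.1 (right_mem_guard.1 hx)]
    | copy l x => exact (copy_notMem_guard hx).elim
  · rintro rfl
    refine ⟨right_mem_guard.2 rfl, by simp, fun y _ hy => ?_, fun v hv => ⟨hv.2, trivial⟩⟩
    cases y with
    | root => rfl
    | _ => exact hy.elim

theorem next_guard_single_done (b : Test) (α : LPOF) :
    (LPOF.guard b α (single .fork)).next (fun v => True ∧ v .root = false)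
      (insert (.right .root) {.root}) = ∅ := by
  rw [Set.eq_empty_iff_forall_notMem]
  rintro x ⟨hx, hxS, hp, hf⟩
  cases x with
  | root => exact hxS (Or.inr rfl)
  | left x => simpa using (hf (fun _ => false) ⟨trivial, rfl⟩).1
  | right x =>
    rw [mem_single.1 (right_mem_guard.1 hx)] at hxS
    exact hxS (Or.inl rfl)
  | copy l x => exact copy_notMem_guard hx

/-- The three units of fuel pay for the test, the no-op, and the observation that nothing else is
ready. -/
theorem run_guard_single_of_false {b : Test} {σ : Mem V} (hb : b.eval σ = some false) (α : LPOF)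
    (n : ℕ) : (LPOF.guard b α (single .fork)).run J (n + 3) (fun _ => True) ∅ σ = CSet.eta σ := by
  rw [run_succ_of_ne_empty (by rw [next_guard_init]; exact Set.singleton_ne_empty _)]
  let e : Unit ≃ (LPOF.guard b α (single .fork)).next (fun _ => True) ∅ :=
    (Equiv.equivPUnit (({.root} : Set Node))).symm.trans
      (Equiv.setCongr (next_guard_init b α _).symm)
  rw [← CSet.nd_equiv e (fun _ => rfl), CSet.nd_unique]
  have he : (e default).1 = .root := rfl
  rw [he]
  change branch J (.test b) _ _ _ _ = _
  simp only [branch, hb, insert_empty_eq]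
  rw [run_succ_of_ne_empty (by rw [next_guard_single_of_false]; exact Set.singleton_ne_empty _)]
  let e' : Unit ≃ (LPOF.guard b α (single .fork)).next (fun v => True ∧ v .root = false) {.root} :=
    (Equiv.equivPUnit (({.right .root} : Set Node))).symm.trans
      (Equiv.setCongr (next_guard_single_of_false b α).symm)
  rw [← CSet.nd_equiv e' (fun _ => rfl), CSet.nd_unique]
  have he' : (e' default).1 = .right .root := rfl
  rw [he']
  exact run_succ_of_eq_empty (next_guard_single_done b α)

/-! ### Sequential composition -/

variable {α β : LPOF}

/-- Once the execution `l` of `α` is complete, unprocessed nodes of `α` contradict `l`, and every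
other copy is excluded by `Terminal.eq_of_imp`. What remains behaves like `β`. -/
theorem run_seq_copy {l : List (Node × Bool)} (hl : α.Terminal l) (n : ℕ) {ψ' : Form}
    (hψ' : ∀ v, ψ' v ↔ outcomes l (fun z => v (.left z))) (σ : Mem V) :
    (α.seq β).run J n ψ' (Node.left '' α.reached l) σ = β.run J n (fun _ => True) ∅ σ := by
  refine (run_eq_of_simulation (Node.copy l) (copy_injective l)
    (fun ψ S ψ' S' => β.State ψ S ∧
      (∀ v, ψ' v ↔ outcomes l (fun z => v (.left z)) ∧ ψ (fun z => v (.copy l z))) ∧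
      S' = Node.left '' α.reached l ∪ Node.copy l '' S) ?_ (fun _ _ => rfl) ?_ ?_ n _ _ _ _ σ
    ⟨State.start β, fun v => by simp [hψ'], by simp⟩).symm
  · rintro ψ S ψ' S' ⟨hs, hψ, rfl⟩
    have hext : ∀ u w : Node → Bool, ∃ v : Node → Bool,
        (fun z => v (.left z)) = u ∧ (fun z => v (.copy l z)) = w := fun u w =>
      ⟨fun z => match z with | .left z => u z | .copy _ z => w z | _ => true, rfl, rfl⟩
    obtain ⟨u₀, hu₀⟩ := hl.2.1
    obtain ⟨w₀, hw₀⟩ := hs.sat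
    ext x
    constructor
    · rintro ⟨hx, hxS, hp, hf⟩
      cases x with
      | root => exact (root_notMem_seq hx).elim
      | right x => exact (right_notMem_seq hx).elim
      | left x =>
        obtain ⟨v, rfl, rfl⟩ := hext u₀ w₀
        exact (hl.2.2.2.2.1 x (left_mem_seq.1 hx) (fun h => hxS (Or.inl ⟨x, h, rfl⟩)) _ hu₀
          (hf v ((hψ v).2 ⟨hu₀, hw₀⟩))).elim
      | copy l' y =>
        obtain ⟨hl', hy⟩ := copy_mem_seq.1 hx
        obtain rfl : l = l' := by
          refine hl.eq_of_imp hl' fun u hu => ?_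
          obtain ⟨v, rfl, rfl⟩ := hext u w₀
          exact (hf v ((hψ v).2 ⟨hu, hw₀⟩)).1
        refine ⟨y, ⟨hy, fun h => hxS (Or.inr ⟨y, h, rfl⟩), fun z hz hzy => ?_, fun w hw => ?_⟩, rfl⟩
        · rcases hp (.copy l z) (copy_mem_seq.2 ⟨hl, hz⟩) ⟨rfl, hzy⟩ with ⟨z', _, h⟩ | ⟨z', hz', h⟩
          · cases h
          · exact copy_injective l h ▸ hz'
        · obtain ⟨v, rfl, rfl⟩ := hext u₀ w
          exact (hf v ((hψ v).2 ⟨hu₀, hw⟩)).2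
    · rintro ⟨y, ⟨hy, hyS, hp, hf⟩, rfl⟩
      refine ⟨copy_mem_seq.2 ⟨hl, hy⟩, ?_, fun z hz hzy => ?_, fun v hv => ?_⟩
      · rintro (⟨z, _, h⟩ | ⟨z, hz, h⟩)
        · cases h
        · exact hyS (copy_injective l h ▸ hz)
      · cases z with
        | left z => exact Or.inl ⟨z, hzy, rfl⟩
        | copy l' z =>
          obtain ⟨rfl, hzy⟩ := hzy
          exact Or.inr ⟨z, hp z (copy_mem_seq.1 hz).2 hzy, rfl⟩
        | _ => exact hzy.elim
      · exact ⟨((hψ v).1 hv).1, hf _ ((hψ v).1 hv).2⟩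
  · rintro ψ S ψ' S' ⟨hs, hψ, rfl⟩ x hx hl
    refine ⟨hs.step hx hl, hψ, ?_⟩
    rw [Set.image_insert_eq, Set.union_insert]
  · rintro ψ S ψ' S' ⟨hs, hψ, rfl⟩ x hx b' hl r
    refine ⟨hs.test hx hl r, fun v => ?_, ?_⟩
    · exact (and_congr_left' (hψ v)).trans and_assoc
    · rw [Set.image_insert_eq, Set.union_insert]

theorem next_seq_left {ψ : Form} {S : Set Node} (hs : α.State ψ S) (hn : α.next ψ S ≠ ∅)
    {ψ' : Form} (hψ' : ∀ v, ψ' v ↔ ψ (fun z => v (.left z))) :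
    (α.seq β).next ψ' (Node.left '' S) = Node.left '' α.next ψ S := by
  have hext : ∀ u : Node → Bool, ∃ v : Node → Bool, (fun z => v (.left z)) = u := fun u =>
    ⟨fun z => match z with | .left z => u z | _ => true, rfl⟩
  ext x
  constructor
  · rintro ⟨hx, hxS, hp, hf⟩
    cases x with
    | root => exact (root_notMem_seq hx).elim
    | right x => exact (right_notMem_seq hx).elim
    | left x =>
      refine ⟨x, ⟨left_mem_seq.1 hx, fun h => hxS ⟨x, h, rfl⟩, fun y hy hyx => ?_, fun u hu => ?_⟩,
        rfl⟩
      · obtain ⟨y', hy', h⟩ := hp (.left y) (left_mem_seq.2 hy) hyx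
        exact left_injective h ▸ hy'
      · obtain ⟨v, rfl⟩ := hext u
        exact hf v ((hψ' v).2 hu)
    | copy l y =>
      obtain ⟨hl, hy⟩ := copy_mem_seq.1 hx
      -- A ready node `z` of `α` forbids any copy to be ready: its formula is compatible with `l`,
      -- so `z` is reached under `l`, precedes the copy, and would have to be processed already.
      obtain ⟨z, hz⟩ := Set.nonempty_iff_ne_empty.2 hn
      obtain ⟨u, hu⟩ := hs.sat
      obtain ⟨v, rfl⟩ := hext u
      refine (hl.2.2.2.2.1 z hz.1 (fun hzl => ?_) _ (hf v ((hψ' v).2 hu)).1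
        (hz.2.2.2 _ hu)).elim
      obtain ⟨z', hz', h⟩ := hp (.left z) (left_mem_seq.2 hz.1) hzl
      exact hz.2.1 (left_injective h ▸ hz')
  · rintro ⟨x, ⟨hx, hxS, hp, hf⟩, rfl⟩
    refine ⟨left_mem_seq.2 hx, ?_, fun y hy hyx => ?_, fun v hv => hf _ ((hψ' v).1 hv)⟩
    · rintro ⟨y, hy, h⟩
      exact hxS (left_injective h ▸ hy)
    · cases y with
      | left y => exact ⟨y, hp y (left_mem_seq.1 hy) hyx, rfl⟩
      | _ => exact hyx.elim

theorem run_seq_of_next_eq_empty (hα : α.Good) {ψ : Form} {S : Set Node} (hs : α.State ψ S)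
    (hn : α.next ψ S = ∅) {ψ' : Form} (hψ' : ∀ v, ψ' v ↔ ψ (fun z => v (.left z))) (n : ℕ)
    (σ : Mem V) :
    (α.seq β).run J n ψ' (Node.left '' S) σ = β.run J n (fun _ => True) ∅ σ := by
  obtain ⟨l, hl, rfl, hlψ⟩ := hs.exists_terminal hα hn
  exact run_seq_copy hl n (fun v => (hψ' v).trans (hlψ _)) σ

theorem run_seq_succ {ψ : Form} {S : Set Node} (hs : α.State ψ S) (hn : α.next ψ S ≠ ∅)
    {ψ' : Form} (hψ' : ∀ v, ψ' v ↔ ψ (fun z => v (.left z))) (n : ℕ) (σ : Mem V) :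
    (α.seq β).run J (n + 1) ψ' (Node.left '' S) σ = CSet.nd (fun x : α.next ψ S =>
      branch J (α.lab x.1) (.left x.1) ψ'
        (fun ψ'' => (α.seq β).run J n ψ'' (Node.left '' insert x.1 S)) σ) := by
  have hnext := next_seq_left (β := β) hs hn hψ'
  rw [run_succ_of_ne_empty (by
    rw [hnext]
    exact fun h => hn (Set.image_eq_empty.1 h))]
  symm
  refine CSet.nd_equiv ((Equiv.Set.image Node.left _ left_injective).trans
    (Equiv.setCongr hnext.symm)) fun x => ?_
  rw [Set.image_insert_eq]
  rfl

/-- The sequence reaches `β` with at most `n ≤ m` units of fuel left, and less fuel allows more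
outcomes. -/
theorem bind_run_subset_run_seq (hα : α.Good) {m : ℕ} (n : ℕ) (hnm : n ≤ m) (ψ : Form)
    (S : Set Node) (hs : α.State ψ S) (ψ' : Form) (hψ' : ∀ v, ψ' v ↔ ψ (fun z => v (.left z)))
    (σ : Mem V) :
    CSet.bind (β.run J m (fun _ => True) ∅) (α.run J n ψ S σ) ⊆
      (α.seq β).run J n ψ' (Node.left '' S) σ := by
  induction n generalizing ψ S ψ' σ with
  | zero => exact fun _ _ => trivial
  | succ n ih =>
    by_cases hn : α.next ψ S = ∅
    · rw [run_succ_of_eq_empty hn, CSet.bind_eta, run_seq_of_next_eq_empty hα hs hn hψ']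
      exact β.run_antitone _ _ _ hnm
    · rw [run_succ_of_ne_empty hn, run_seq_succ hs hn hψ']
      refine (CSet.bind_nd_subset _ _ fun τ => run_nonempty _ _ _ _ _).trans
        (CSet.nd_mono fun x => bind_branch_subset (fun hl τ => ?_) (fun b hl r τ => ?_) σ)
      · exact ih (by omega) _ _ (hs.step x.2 hl) _ hψ' τ
      · exact ih (by omega) _ _ (hs.test x.2 hl r) _ (fun v => by rw [hψ']) τ

/-- If `α` finishes within `n` steps, at least `m` units are left for `β`; otherwise the right-hand
side imposes no constraint along that schedule. -/
theorem run_seq_subset_bind_run (hα : α.Good) {m : ℕ} (n : ℕ) (ψ : Form)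
    (S : Set Node) (hs : α.State ψ S) (ψ' : Form) (hψ' : ∀ v, ψ' v ↔ ψ (fun z => v (.left z)))
    (σ : Mem V) :
    (α.seq β).run J (n + m) ψ' (Node.left '' S) σ ⊆
      CSet.bind (β.run J m (fun _ => True) ∅) (α.run J n ψ S σ) := by
  induction n generalizing ψ S ψ' σ with
  | zero =>
    change _ ⊆ CSet.bind _ CSet.bot
    rw [CSet.bind_bot]
    exact fun _ _ => trivial
  | succ n ih =>
    by_cases hn : α.next ψ S = ∅
    · rw [run_succ_of_eq_empty hn, CSet.bind_eta, run_seq_of_next_eq_empty hα hs hn hψ']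
      exact β.run_antitone _ _ _ (by omega)
    · rw [run_succ_of_ne_empty hn, Nat.add_right_comm, run_seq_succ hs hn hψ']
      refine subset_trans (CSet.nd_mono fun x => branch_subset_bind
        (fun τ => β.sigmaConvex_run _ _ _ τ) (fun hl τ => ?_) (fun b hl r τ => ?_) σ)
        (CSet.nd_bind_subset (fun τ => β.sigmaConvex_run _ _ _ τ) _)
      · exact ih _ _ (hs.step x.2 hl) _ hψ' τ
      · exact ih _ _ (hs.test x.2 hl r) _ (fun v => by rw [hψ']) τ

end run

end LPOF

/-! ## The semantics of loops -/

section lin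

variable {T V : Finset Var} {J : Set (Mem T)}

/-- The outcomes of the first `n` steps of a command. -/
noncomputable def Cmd.approx (J : Set (Mem T)) (C : Cmd) (n : ℕ) (σ : Mem V) : CSet (Mem V) :=
  C.den.run J n (fun _ => True) ∅ σ

theorem lin_eq_iInter (C : Cmd) (σ : Mem V) : lin J C σ = ⋂ n, C.approx J n σ :=
  LPOF.linPom_eq_iInter_run C.good_den.isTransOn C.good_den.frontier σ

theorem lin_subset_approx (C : Cmd) (n : ℕ) (σ : Mem V) : lin J C σ ⊆ C.approx J n σ := by
  rw [lin_eq_iInter]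
  exact Set.iInter_subset _ n

theorem Cmd.approx_antitone (C : Cmd) (σ : Mem V) : Antitone (fun n => C.approx J n σ) :=
  C.den.run_antitone _ _ _

theorem Cmd.limClosed_approx (hJ : J.Finite) (C : Cmd) (n : ℕ) (σ : Mem V) :
    LimClosed (C.approx J n σ) :=
  LPOF.limClosed_run C.good_den.frontier hJ n _ Set.finite_empty σ

theorem sigmaConvex_lin (C : Cmd) (σ : Mem V) : SigmaConvex (lin J C σ) := by
  intro ι w ν h
  rw [lin_eq_iInter, Set.mem_iInter]
  exact fun n => C.den.sigmaConvex_run n _ _ σ _ w ν fun i hi => lin_subset_approx C n σ (h i hi)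

/-- Any limit point of members of the decreasing closed sets of approximate outcomes lies in all of
them. -/
theorem lin_nonempty (hJ : J.Finite) (C : Cmd) (σ : Mem V) : (lin J C σ).Nonempty := by
  choose ρ hρ using fun n => C.den.run_nonempty (J := J) n (fun _ => True) ∅ σ
  obtain ⟨ρ', hρ'⟩ := exists_limTo ρ
  refine ⟨ρ', ?_⟩
  rw [lin_eq_iInter, Set.mem_iInter]
  refine fun n => C.limClosed_approx hJ n σ ρ ρ' ?_ hρ'
  filter_upwards [Nat.hyperfilter_le_atTop (eventually_ge_atTop n)] with k hk
  exact C.approx_antitone σ hk (hρ k)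

theorem approx_while_of_true {b : Test} {C : Cmd} {σ : Mem V} (hb : b.eval σ = some true) (n : ℕ) :
    (Cmd.while b C).approx J (n + 1) σ =
      (C.den.seq (Cmd.while b C).den).run J n (fun _ => True) ∅ σ := by
  unfold Cmd.approx
  rw [← LPOF.run_guard_of_true hb _ (.single .fork) n]
  exact (LPOF.loop_agree b C.den fun x hx => (C.good_den.goodAt x hx).ne_bot).run_eq _ _ _ _

theorem approx_while_of_false {b : Test} {C : Cmd} {σ : Mem V} (hb : b.eval σ = some false)
    (n : ℕ) : (Cmd.while b C).approx J (n + 3) σ = CSet.eta σ := by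
  unfold Cmd.approx
  rw [← LPOF.run_guard_single_of_false (J := J) hb (C.den.seq (Cmd.while b C).den) n]
  exact (LPOF.loop_agree b C.den fun x hx => (C.good_den.goodAt x hx).ne_bot).run_eq _ _ _ _

theorem eta_subset_approx_while {b : Test} {C : Cmd} {σ : Mem V} (hb : b.eval σ = some false)
    (n : ℕ) : CSet.eta σ ⊆ (Cmd.while b C).approx J n σ := by
  rw [← approx_while_of_false (J := J) (C := C) hb n]
  exact Cmd.approx_antitone _ _ (by omega)

theorem lin_while_subset_eta {b : Test} {C : Cmd} {σ : Mem V} (hb : b.eval σ = some false) :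
    lin J (Cmd.while b C) σ ⊆ CSet.eta σ := by
  rw [← approx_while_of_false (J := J) (C := C) hb 0]
  exact lin_subset_approx _ _ _

theorem bind_approx_subset_approx_while {b : Test} {C : Cmd} {σ : Mem V}
    (hb : b.eval σ = some true) (n : ℕ) :
    CSet.bind ((Cmd.while b C).approx J n) (lin J C σ) ⊆ (Cmd.while b C).approx J (n + 1) σ := by
  rw [approx_while_of_true hb]
  refine (CSet.bind_mono (fun _ => subset_rfl) (lin_subset_approx C n σ)).trans ?_
  have := LPOF.bind_run_subset_run_seq (J := J) (β := (Cmd.while b C).den) C.good_den n le_rfl _ _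
    (LPOF.State.start _) (fun _ => True) (fun _ => Iff.rfl) σ
  rwa [Set.image_empty] at this

/-- Each fuel bound gives a decomposition of `ρ` of its own; compactness, in the form of
`CSet.mem_bind_iInter`, extracts one that is valid for all bounds at once. -/
theorem lin_while_subset_bind (hJ : J.Finite) {b : Test} {C : Cmd} {σ : Mem V}
    (hb : b.eval σ = some true) :
    lin J (Cmd.while b C) σ ⊆ CSet.bind (lin J (Cmd.while b C)) (lin J C σ) := by
  intro ρ hρ
  have hfun : lin J (Cmd.while b C) = fun τ : Mem V => ⋂ n, (Cmd.while b C).approx J n τ :=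
    funext fun τ => lin_eq_iInter _ τ
  rw [hfun, lin_eq_iInter]
  refine CSet.mem_bind_iInter (fun n τ => Cmd.limClosed_approx hJ _ n τ)
    (fun n => C.limClosed_approx hJ n σ) (fun τ => Cmd.approx_antitone _ τ) (C.approx_antitone σ)
    (ρ := fun _ => ρ) (.of_forall fun n => ?_) (LimTo.const ρ)
  -- One unit for the test, `n` for the body and `n` for the remaining loop.
  have h1 := lin_subset_approx _ (n + n + 1) σ hρ
  rw [approx_while_of_true hb] at h1
  have := LPOF.run_seq_subset_bind_run (J := J) (m := n) (β := (Cmd.while b C).den) C.good_den n _ _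
    (LPOF.State.start _) (fun _ => True) (fun _ => Iff.rfl) σ
  rw [Set.image_empty] at this
  exact this h1

end lin


/-! ## Values and memories -/

/-- The values that are lists of depth less than `n`. -/
def Val.layer : ℕ → Set Val
  | 0 => ∅
  | n + 1 => Set.range Val.num ∪ Val.list '' {l | ∀ v ∈ l, v ∈ Val.layer n}

theorem Val.layer_mono : Monotone Val.layer := by
  refine monotone_nat_of_le_succ fun n => ?_
  induction n with
  | zero => exact Set.empty_subset _
  | succ n ih =>
    exact Set.union_subset_union_right _ (Set.image_mono fun l hl v hv => ih (hl v hv))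

theorem Val.exists_mem_layer (v : Val) : ∃ n, v ∈ Val.layer n := by
  refine Val.rec (motive_1 := fun v => ∃ n, v ∈ Val.layer n)
    (motive_2 := fun l => ∃ n, ∀ v ∈ l, v ∈ Val.layer n) ?_ ?_ ?_ ?_ v
  · exact fun q => ⟨1, Or.inl ⟨q, rfl⟩⟩
  · rintro l ⟨n, hn⟩
    exact ⟨n + 1, Or.inr ⟨l, hn, rfl⟩⟩
  · exact ⟨0, by simp⟩
  · rintro v l ⟨n, hn⟩ ⟨m, hm⟩
    refine ⟨max n m, fun w hw => ?_⟩
    rcases List.mem_cons.1 hw with rfl | hw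
    · exact Val.layer_mono (le_max_left _ _) hn
    · exact Val.layer_mono (le_max_right _ _) (hm w hw)

/-- Countability of memories will make arbitrary unions of events measurable, in particular the
union that occurs in `PSpace.Le`. -/
instance : Countable Val := by
  have h : ∀ n, (Val.layer n).Countable := by
    intro n
    induction n with
    | zero => exact Set.countable_empty
    | succ n ih =>
      refine (Set.countable_range _).union (Set.Countable.image ?_ _)
      have := ih.to_subtype
      rw [← Set.range_list_map_coe]
      exact Set.countable_range _
  rw [← Set.countable_univ_iff]
  exact (Set.countable_iUnion h).mono fun v _ => Set.mem_iUnion.2 v.exists_mem_layer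

instance : Infinite Val :=
  Infinite.of_injective Val.num fun _ _ h => by injection h

instance : Inhabited Val := ⟨Val.num 0⟩

theorem proj_surjective {S T : Finset Var} (h : S ⊆ T) :
    Function.Surjective (proj h : Mem T → Mem S) := by
  intro σ
  refine ⟨fun x => if hx : x.1 ∈ S then σ ⟨x.1, hx⟩ else default, funext fun x => ?_⟩
  simp [proj]

theorem Val.ofBool_injective : Function.Injective Val.ofBool := by
  intro a b h
  cases a <;> cases b <;> simp_all [Val.ofBool]

/-! ## Locality of expressions and pure assertions -/

mutual

theorem Exp.evalStore_congr : ∀ (e : Exp) {s s' : Var → Val}, (∀ x ∈ e.fv, s x = s' x) →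
    e.evalStore s = e.evalStore s'
  | .var x, _, _, h => by
    simp only [Exp.evalStore]
    exact h x (by simp [Exp.fv])
  | .val _, _, _, _ => by simp only [Exp.evalStore]
  | .test b, _, _, h => by
    simp only [Exp.evalStore]
    rw [Test.evalStore_congr b fun x hx => h x (by simpa [Exp.fv] using hx)]
  | .op n f args, _, _, h => by
    simp only [Exp.evalStore]
    congr 1
    funext i
    exact Exp.evalStore_congr (args i) fun x hx => h x (by
      simp only [Exp.fv, Finset.mem_biUnion, Finset.mem_univ, true_and]
      exact ⟨i, hx⟩)

theorem Test.evalStore_congr : ∀ (b : Test) {s s' : Var → Val}, (∀ x ∈ b.fv, s x = s' x) →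
    b.evalStore s = b.evalStore s'
  | .tru, _, _, _ => by simp only [Test.evalStore]
  | .fls, _, _, _ => by simp only [Test.evalStore]
  | .and b₁ b₂, _, _, h => by
    simp only [Test.evalStore]
    rw [Test.evalStore_congr b₁ fun x hx => h x (by simp [Test.fv, hx]),
      Test.evalStore_congr b₂ fun x hx => h x (by simp [Test.fv, hx])]
  | .or b₁ b₂, _, _, h => by
    simp only [Test.evalStore]
    rw [Test.evalStore_congr b₁ fun x hx => h x (by simp [Test.fv, hx]),
      Test.evalStore_congr b₂ fun x hx => h x (by simp [Test.fv, hx])]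
  | .not b, _, _, h => by
    simp only [Test.evalStore]
    rw [Test.evalStore_congr b fun x hx => h x (by simpa [Test.fv] using hx)]
  | .cmp r e₁ e₂, _, _, h => by
    simp only [Test.evalStore]
    rw [Exp.evalStore_congr e₁ fun x hx => h x (by simp [Test.fv, hx]),
      Exp.evalStore_congr e₂ fun x hx => h x (by simp [Test.fv, hx])]

end

theorem Exp.eval_proj {S T : Finset Var} (h : S ⊆ T) (e : Exp) (he : e.fv ⊆ S) (σ : Mem T) :
    e.eval (proj h σ) = e.eval σ := by
  rw [Exp.eval, Exp.eval, if_pos he, if_pos (he.trans h)]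
  congr 1
  refine e.evalStore_congr fun x hx => ?_
  simp [Mem.toStore, proj, he hx, h (he hx)]

theorem Exp.fv_subset_of_eval {S : Finset Var} {e : Exp} {σ : Mem S} {v : Val}
    (h : e.eval σ = some v) : e.fv ⊆ S := by
  unfold Exp.eval at h
  split_ifs at h with h'
  exact h'

theorem Pure.sat_of_proj {S T : Finset Var} (h : S ⊆ T) (P : Pure) (Γ : Ctx) (σ : Mem T)
    (hP : P.Sat Γ (proj h σ)) : P.Sat Γ σ := by
  induction P generalizing Γ S T with
  | tru => trivial
  | fls => exact hP
  | and P Q ihP ihQ => exact ⟨ihP h Γ σ hP.1, ihQ h Γ σ hP.2⟩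
  | or P Q ihP ihQ => exact hP.imp (ihP h Γ σ) (ihQ h Γ σ)
  | sep P Q ihP ihQ =>
    obtain ⟨S₁, S₂, h₁, h₂, hd, hP, hQ⟩ := hP
    exact ⟨S₁, S₂, h₁.trans h, h₂.trans h, hd, hP, hQ⟩
  | ex X P ih =>
    obtain ⟨v, hv⟩ := hP
    exact ⟨v, ih h _ σ hv⟩
  | pointsTo e E =>
    rw [Pure.Sat] at hP ⊢
    rwa [Exp.eval_proj h e (Exp.fv_subset_of_eval hP)] at hP
  | cmp r E₁ E₂ => exact hP

/-- A disjunction may hold in a memory that lacks some of its free variables, so only those present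
in `T` are required to survive. This form also passes to the two parts of a separating conjunction.
-/
theorem Pure.sat_proj {S T : Finset Var} (h : S ⊆ T) (P : Pure) (hS : T ∩ P.fv ⊆ S) (Γ : Ctx)
    (σ : Mem T) (hP : P.Sat Γ σ) : P.Sat Γ (proj h σ) := by
  induction P generalizing Γ S T with
  | tru => trivial
  | fls => exact hP
  | and P Q ihP ihQ =>
    rw [Pure.fv, Finset.inter_union_distrib_left] at hS
    exact ⟨ihP h (Finset.union_subset_left hS) Γ σ hP.1,
      ihQ h (Finset.union_subset_right hS) Γ σ hP.2⟩
  | or P Q ihP ihQ =>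
    rw [Pure.fv, Finset.inter_union_distrib_left] at hS
    exact hP.imp (ihP h (Finset.union_subset_left hS) Γ σ)
      (ihQ h (Finset.union_subset_right hS) Γ σ)
  | sep P Q ihP ihQ =>
    obtain ⟨S₁, S₂, h₁, h₂, hd, hP, hQ⟩ := hP
    rw [Pure.fv, Finset.inter_union_distrib_left] at hS
    refine ⟨S₁ ∩ S, S₂ ∩ S, Finset.inter_subset_right, Finset.inter_subset_right,
      hd.mono Finset.inter_subset_left Finset.inter_subset_left, ?_, ?_⟩
    · refine ihP (S := S₁ ∩ S) (T := S₁) Finset.inter_subset_left ?_ Γ _ hP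
      exact Finset.subset_inter Finset.inter_subset_left
        ((Finset.inter_subset_inter_right h₁).trans (Finset.union_subset_left hS))
    · refine ihQ (S := S₂ ∩ S) (T := S₂) Finset.inter_subset_left ?_ Γ _ hQ
      exact Finset.subset_inter Finset.inter_subset_left
        ((Finset.inter_subset_inter_right h₂).trans (Finset.union_subset_right hS))
  | ex X P ih =>
    obtain ⟨v, hv⟩ := hP
    exact ⟨v, ih h hS _ σ hv⟩
  | pointsTo e E =>
    rw [Pure.Sat] at hP ⊢
    have hT := Exp.fv_subset_of_eval hP
    rwa [Exp.eval_proj h e ((Finset.subset_inter hT subset_rfl).trans hS)]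
  | cmp r E₁ E₂ => exact hP

/-- Finitary assertions talk about all of their free variables. -/
theorem Pure.Finitary.fv_subset {P : Pure} (hP : P.Finitary) {Γ : Ctx} {S : Finset Var}
    {σ : Mem S} (h : P.Sat Γ σ) : P.fv ⊆ S := by
  intro x hx
  by_contra hxS
  -- If `x` were absent from `S`, its value could be varied without affecting satisfaction; as there
  -- are infinitely many values, `P` would have infinitely many satisfying memories.
  let ρ : Val → Mem (S ∪ P.fv) := fun v y => if hy : y.1 ∈ S then σ ⟨y.1, hy⟩ else v
  have hproj : ∀ v, proj Finset.subset_union_left (ρ v) = σ := by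
    intro v
    funext y
    simp [proj, ρ]
  have hsat : ∀ v, P.Sat Γ (proj Finset.subset_union_right (ρ v) : Mem P.fv) := by
    intro v
    refine P.sat_proj _ Finset.inter_subset_right Γ _
      (P.sat_of_proj Finset.subset_union_left Γ _ ?_)
    rwa [hproj]
  refine Set.infinite_of_injective_forall_mem (f := fun v => (proj Finset.subset_union_right (ρ v) :
    Mem P.fv)) (fun v w hvw => ?_) hsat (hP Γ)
  have := congrFun hvw ⟨x, hx⟩
  simpa [proj, ρ, hxS] using this

theorem Pure.Finitary.proj_mem_semFv {P : Pure} (hP : P.Finitary) {Γ : Ctx} {S : Finset Var}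
    {σ : Mem S} (h : P.Sat Γ σ) : proj (hP.fv_subset h) σ ∈ P.semFv Γ :=
  P.sat_proj _ Finset.inter_subset_right Γ σ h

theorem Pure.sat_testIs {b : Test} {r : Bool} {Γ : Ctx} {S : Finset Var} {σ : Mem S}
    (h : (Pure.testIs b r).Sat Γ σ) : b.eval σ = some r := by
  have h' : (Exp.test b).eval σ = some (Val.ofBool r) := h
  have hfv := Exp.fv_subset_of_eval h'
  rw [Exp.fv] at hfv
  rw [Exp.eval, if_pos (by rwa [Exp.fv]), Exp.evalStore, Option.some_inj] at h'
  rw [Test.eval, if_pos hfv, Val.ofBool_injective h']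


/-! ## Probability spaces and distributions -/

theorem toOuterMeasure_le_one {X : Type} (ν : PMF X) (A : Set X) : ν.toOuterMeasure A ≤ 1 := by
  rw [PMF.toOuterMeasure_apply, ← ν.tsum_coe]
  exact ENNReal.tsum_le_tsum fun x => Set.indicator_le_self _ _ x

theorem toOuterMeasure_add_le {X : Type} (ν : PMF X) {A B C : Set X} (hA : A ⊆ C) (hB : B ⊆ C)
    (hd : Disjoint A B) : ν.toOuterMeasure A + ν.toOuterMeasure B ≤ ν.toOuterMeasure C := by
  simp only [PMF.toOuterMeasure_apply, ← ENNReal.tsum_add]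
  refine ENNReal.tsum_le_tsum fun x => ?_
  by_cases hxA : x ∈ A
  · simp [hxA, hA hxA, Set.disjoint_left.1 hd hxA]
  · by_cases hxB : x ∈ B
    · simp [hxA, hxB, hB hxB]
    · simp [hxA, hxB]

theorem toOuterMeasure_inter_of_one {X : Type} (ν : PMF X) {A B : Set X}
    (hB : ν.toOuterMeasure B = 1) : ν.toOuterMeasure (A ∩ B) = ν.toOuterMeasure A := by
  rw [PMF.toOuterMeasure_apply_eq_one_iff] at hB
  refine PMF.toOuterMeasure_apply_eq_of_inter_support_eq _ ?_
  rw [Set.inter_assoc, Set.inter_eq_right.2 hB]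

/-- Complementary lower bounds that add up to an upper bound are sharp. -/
theorem eq_of_add_le {a b x y c : ℝ≥0∞} (ha : a ≤ x) (hb : b ≤ y) (hxy : x + y ≤ c)
    (hab : a + b = c) (hc : c ≠ ∞) : a = x := by
  refine le_antisymm ha ?_
  have hb' : b ≠ ∞ := ne_top_of_le_ne_top hc (hab ▸ le_add_self)
  refine (ENNReal.add_le_add_iff_right hb').1 ?_
  rw [hab]
  exact (add_le_add_right hb x).trans hxy

namespace PSpace

variable {S T W V : Finset Var}

theorem event_Ω (P : PSpace S) : P.Event P.Ω :=
  ⟨subset_rfl, by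
    let _ := P.F
    rw [Subtype.coe_preimage_self]
    exact MeasurableSet.univ⟩

theorem prob_Ω (P : PSpace S) : P.prob P.Ω = 1 := by
  let _ := P.F
  have := P.isProb
  unfold prob
  rw [Subtype.coe_preimage_self]
  exact measure_univ

theorem Event.compl {P : PSpace S} {A : Set (Mem S)} (h : P.Event A) : P.Event (P.Ω \ A) := by
  let _ := P.F
  refine ⟨Set.sdiff_subset, ?_⟩
  rw [Set.preimage_sdiff, Subtype.coe_preimage_self]
  exact MeasurableSet.univ.diff h.2

theorem Event.prob_add_compl {P : PSpace S} {A : Set (Mem S)} (h : P.Event A) :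
    P.prob A + P.prob (P.Ω \ A) = 1 := by
  let _ := P.F
  have := P.isProb
  unfold prob
  rw [Set.preimage_sdiff, Subtype.coe_preimage_self, ← Set.compl_eq_univ_sdiff]
  exact prob_add_prob_compl h.2

theorem prob_ne_top (P : PSpace S) (A : Set (Mem S)) : P.prob A ≠ ∞ := by
  let _ := P.F
  have := P.isProb
  exact measure_ne_top _ _

/-- There are only countably many sample points, so one member of `s` for each covered point already
gives the whole union. -/
theorem event_sUnion {P : PSpace S} {s : Set (Set (Mem S))} (h : ∀ A ∈ s, P.Event A) :
    P.Event (⋃₀ s) := by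
  let _ := P.F
  refine ⟨Set.sUnion_subset fun A hA => (h A hA).1, ?_⟩
  have hx : ∀ x : P.Ω, ∃ A : Set P.Ω, MeasurableSet A ∧ A ⊆ Subtype.val ⁻¹' ⋃₀ s ∧
      (x.1 ∈ ⋃₀ s → x ∈ A) := by
    intro x
    by_cases hx : x.1 ∈ ⋃₀ s
    · obtain ⟨A, hA, hxA⟩ := hx
      exact ⟨Subtype.val ⁻¹' A, (h A hA).2, Set.preimage_mono (Set.subset_sUnion_of_mem hA),
        fun _ => hxA⟩
    · exact ⟨∅, MeasurableSet.empty, Set.empty_subset _, fun h => (hx h).elim⟩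
  choose A hA hAs hxA using hx
  have : (Subtype.val ⁻¹' ⋃₀ s : Set P.Ω) = ⋃ x, A x :=
    subset_antisymm (fun x hx => Set.mem_iUnion.2 ⟨x, hxA x hx⟩) (Set.iUnion_subset hAs)
  rw [this]
  exact MeasurableSet.iUnion hA

theorem event_ofPMF (μ : PMF (Mem S)) (A : Set (Mem S)) : (ofPMF μ).Event A :=
  ⟨Set.subset_univ _, trivial⟩

theorem prob_ofPMF (μ : PMF (Mem S)) (A : Set (Mem S)) :
    (ofPMF μ).prob A = μ.toOuterMeasure A := by
  unfold prob ofPMF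
  rw [@PMF.toMeasure_apply_eq_toOuterMeasure_apply _ ⊤ _ _ trivial, PMF.toOuterMeasure_map_apply]
  rfl

theorem model_ofPMF (μ : PMF (Mem S)) : (ofPMF μ).Model :=
  ⟨rfl, @Measure.IsComplete.mk _ ⊤ _ fun _ _ => trivial⟩

/-- The probabilities of the events of `P` are their probabilities under `ν`. -/
def Law (P : PSpace S) (ν : PMF (Mem V)) : Prop :=
  ∃ h : S ⊆ V, ∀ A, P.Event A → P.prob A = ν.toOuterMeasure (proj h ⁻¹' A)

/-- An upper bound for an event and one for its complement must both be equalities, since the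
probabilities on either side cannot add up to more than one. One-sided estimates by inclusion
therefore suffice below. -/
theorem law_of_le_measure {P : PSpace S} {ν : PMF (Mem V)} (h : S ⊆ V)
    (hA : ∀ A, P.Event A → P.prob A ≤ ν.toOuterMeasure (proj h ⁻¹' A)) : P.Law ν := by
  refine ⟨h, fun A hE => eq_of_add_le (hA A hE) (hA _ hE.compl) ?_ hE.prob_add_compl
    ENNReal.one_ne_top⟩
  refine (toOuterMeasure_add_le ν (Set.subset_univ _) (Set.subset_univ _) ?_).trans
    (toOuterMeasure_le_one ν _)
  exact Disjoint.preimage _ Set.disjoint_sdiff_right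

theorem law_ofPMF (ν : PMF (Mem V)) : (ofPMF ν).Law ν :=
  ⟨subset_rfl, fun A _ => prob_ofPMF ν A⟩

theorem Le.exists_event {P : PSpace S} {Q : PSpace T} (h : P.Le Q) :
    ∃ hST : S ⊆ T, ∀ A, P.Event A → ∃ E, Q.Event E ∧ E ⊆ proj hST ⁻¹' A ∧ P.prob A = Q.prob E := by
  obtain ⟨hST, -, -, hp⟩ := h
  refine ⟨hST, fun A hA => ⟨_, event_sUnion fun B hB => hB.1, ?_, hp A hA⟩⟩
  exact Set.sUnion_subset fun B hB => Set.image_subset_iff.1 hB.2.subset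

theorem Le.law {P : PSpace S} {Q : PSpace T} {ν : PMF (Mem V)} (h : P.Le Q) (hQ : Q.Law ν) :
    P.Law ν := by
  obtain ⟨hST, hE⟩ := h.exists_event
  obtain ⟨hTV, hQ⟩ := hQ
  refine law_of_le_measure (hST.trans hTV) fun A hA => ?_
  obtain ⟨E, hEE, hEA, hp⟩ := hE A hA
  rw [hp, hQ E hEE]
  exact measure_mono fun x hx => hEA hx

/-- The full preimage is the largest set that projects onto a given event, so it is the union
occurring in `PSpace.Le`. -/
theorem Law.le_ofPMF {P : PSpace S} {ν : PMF (Mem V)} (h : P.Law ν) : P.Le (ofPMF ν) := by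
  obtain ⟨hSV, h⟩ := h
  have himg : ∀ A : Set (Mem S), proj hSV '' (proj hSV ⁻¹' A) = A := fun A =>
    Set.image_preimage_eq A (proj_surjective hSV)
  refine ⟨hSV, fun x _ => ?_, fun A _ => ⟨_, event_ofPMF ν _, himg A⟩, fun A hA => ?_⟩
  · obtain ⟨y, hy⟩ := proj_surjective hSV x
    exact ⟨y, trivial, hy⟩
  · rw [h A hA, prob_ofPMF]
    congr 1
    refine subset_antisymm (Set.subset_sUnion_of_mem ⟨event_ofPMF ν _, himg A⟩) ?_
    exact Set.sUnion_subset fun B hB => Set.image_subset_iff.1 hB.2.subset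

theorem IsProj.law {R : PSpace W} {P : PSpace S} {ν : PMF (Mem V)} (h : R.IsProj P)
    (hR : R.Law ν) : P.Law ν := by
  obtain ⟨hSW, -, -, hp⟩ := h
  obtain ⟨hWV, hR⟩ := hR
  refine law_of_le_measure (hSW.trans hWV) fun A hA => ?_
  rw [(hp A hA).2, hR _ (hp A hA).1]
  refine measure_mono ?_
  rintro x ⟨-, hS, -, hx, -⟩
  exact hx

/-! ### Independent products -/

section prod

variable {P₁ : PSpace S} {P₂ : PSpace T} {R : PSpace W} {ν : PMF (Mem V)}

theorem IsProd.event_star (h : P₁.IsProd P₂ R) {A : Set (Mem S)} {B : Set (Mem T)}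
    (hA : P₁.Event A) (hB : P₂.Event B) : R.Event (star W A B) := by
  refine ⟨?_, ?_⟩
  · rw [h.2.2.1]
    rintro x ⟨hd, hS, hT, hx, hy⟩
    exact ⟨hd, hS, hT, hA.1 hx, hB.1 hy⟩
  · rw [h.2.2.2.1]
    exact MeasurableSpace.measurableSet_generateFrom ⟨A, B, hA, hB, rfl⟩

theorem IsProd.subset_left (h : P₁.IsProd P₂ R) : S ⊆ W := h.2.1 ▸ Finset.subset_union_left

theorem IsProd.subset_right (h : P₁.IsProd P₂ R) : T ⊆ W := h.2.1 ▸ Finset.subset_union_right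

theorem IsProd.law_left (h : P₁.IsProd P₂ R) (hR : R.Law ν) : P₁.Law ν := by
  obtain ⟨hWV, hR⟩ := hR
  refine law_of_le_measure (h.subset_left.trans hWV) fun A hA => ?_
  have := h.2.2.2.2 A _ hA P₂.event_Ω
  rw [prob_Ω, mul_one] at this
  rw [← this, hR _ (h.event_star hA P₂.event_Ω)]
  refine measure_mono ?_
  rintro x ⟨-, hS, -, hx, -⟩
  exact hx

theorem IsProd.law_right (h : P₁.IsProd P₂ R) (hR : R.Law ν) : P₂.Law ν := by
  obtain ⟨hWV, hR⟩ := hR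
  refine law_of_le_measure (h.subset_right.trans hWV) fun A hA => ?_
  have := h.2.2.2.2 _ A P₁.event_Ω hA
  rw [prob_Ω, one_mul] at this
  rw [← this, hR _ (h.event_star P₁.event_Ω hA)]
  refine measure_mono ?_
  rintro x ⟨-, -, hT, -, hx⟩
  exact hx

/-- The events of a coarsening of one factor are independent of those of the other factor. -/
theorem IsProd.indep {U : Finset Var} {Q : PSpace U} (h : P₁.IsProd P₂ R) (hR : R.Law ν)
    (hQ : Q.Le P₁) (hU : U ⊆ V) (hT : T ⊆ V) {A : Set (Mem U)} {B : Set (Mem T)}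
    (hA : Q.Event A) (hB : P₂.Event B) :
    Q.prob A * P₂.prob B = ν.toOuterMeasure (proj hU ⁻¹' A ∩ proj hT ⁻¹' B) := by
  obtain ⟨_, hlaw₂⟩ := h.law_right hR
  obtain ⟨hWV, hR⟩ := hR
  obtain ⟨hUS, hE⟩ := hQ.exists_event
  have key : ∀ A, Q.Event A →
      Q.prob A * P₂.prob B ≤ ν.toOuterMeasure (proj hU ⁻¹' A ∩ proj hT ⁻¹' B) := by
    intro A hA
    obtain ⟨E, hEE, hEA, hp⟩ := hE A hA
    rw [hp, ← h.2.2.2.2 E B hEE hB, hR _ (h.event_star hEE hB)]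
    refine measure_mono ?_
    rintro x ⟨-, hS, hT, hx, hy⟩
    exact ⟨hEA hx, hy⟩
  -- The events `A` and its complement split the event `B`, so the two inequalities add up to an
  -- equality with total `P₂.prob B`.
  refine eq_of_add_le (key A hA) (key _ hA.compl) (c := P₂.prob B) ?_ ?_ (P₂.prob_ne_top B)
  · rw [hlaw₂ B hB]
    refine toOuterMeasure_add_le ν Set.inter_subset_right Set.inter_subset_right ?_
    exact (Disjoint.preimage _ Set.disjoint_sdiff_right).mono Set.inter_subset_left
      Set.inter_subset_left
  · rw [← add_mul, hA.prob_add_compl, one_mul]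

/-- The independent product is the law of the projection of `ν` to `S ∪ T`, restricted to the events
generated by rectangles. By hypothesis `ν` already has the product values there. -/
theorem exists_isProd (hP₁ : P₁.Ω = Set.univ) (hP₂ : P₂.Ω = Set.univ) (hd : Disjoint S T)
    (hS : S ⊆ V) (hT : T ⊆ V)
    (h : ∀ A B, P₁.Event A → P₂.Event B →
      P₁.prob A * P₂.prob B = ν.toOuterMeasure (proj hS ⁻¹' A ∩ proj hT ⁻¹' B)) :
    ∃ R : PSpace (S ∪ T), P₁.IsProd P₂ R ∧ R.Le (ofPMF ν) := by
  have hST : S ∪ T ⊆ V := Finset.union_subset hS hT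
  let F : MeasurableSpace (Set.univ : Set (Mem (S ∪ T))) := MeasurableSpace.generateFrom
    {D | ∃ A B, P₁.Event A ∧ P₂.Event B ∧ D = Subtype.val ⁻¹' star (S ∪ T) A B}
  let f : Mem V → (Set.univ : Set (Mem (S ∪ T))) := fun σ => ⟨proj hST σ, trivial⟩
  have hf : @Measurable _ _ ⊤ F f := fun _ _ => trivial
  let R : PSpace (S ∪ T) :=
    { Ω := Set.univ
      F := F
      μ := @Measure.map _ _ ⊤ F f (@PMF.toMeasure _ ⊤ ν)
      isProb := @Measure.isProbabilityMeasure_map _ _ ⊤ F _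
        (@PMF.toMeasure.isProbabilityMeasure _ ⊤ ν) _ hf.aemeasurable }
  have hprob : ∀ A, R.Event A → R.prob A = ν.toOuterMeasure (proj hST ⁻¹' A) := by
    intro A hA
    have h1 : R.prob A = @PMF.toMeasure _ ⊤ ν (f ⁻¹' (Subtype.val ⁻¹' A)) :=
      @Measure.map_apply _ _ ⊤ F _ f hf _ hA.2
    rw [h1, @PMF.toMeasure_apply_eq_toOuterMeasure_apply _ ⊤ _ _ trivial]
    rfl
  have hstar : star (S ∪ T) P₁.Ω P₂.Ω = Set.univ := by
    refine Set.eq_univ_of_forall fun x =>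
      ⟨hd, Finset.subset_union_left, Finset.subset_union_right, ?_, ?_⟩
    · rw [hP₁]
      trivial
    · rw [hP₂]
      trivial
  refine ⟨R, ⟨hd, rfl, hstar.symm, rfl, fun A B hA hB => ?_⟩, Law.le_ofPMF ⟨hST, hprob⟩⟩
  rw [hprob _ ⟨Set.subset_univ _, MeasurableSpace.measurableSet_generateFrom ⟨A, B, hA, hB, rfl⟩⟩,
    h A B hA hB]
  congr 1
  ext x
  exact ⟨fun ⟨_, _, _, h₁, h₂⟩ => ⟨h₁, h₂⟩, fun ⟨h₁, h₂⟩ =>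
    ⟨hd, Finset.subset_union_left, Finset.subset_union_right, h₁, h₂⟩⟩

end prod

/-! ### Direct sums -/

/-- A null set of the extension meets the sample space of `P` in a null set, and outside that sample
space there is no measurability condition. -/
theorem IsComp.model {P R : PSpace S} (h : P.IsComp R) (hP : P.Complete) : R.Model := by
  obtain ⟨hΩ, hE, hp⟩ := h
  refine ⟨hΩ, @Measure.IsComplete.mk _ R.F _ fun s hs => ?_⟩
  have himg : ∀ t : Set R.Ω, (Subtype.val ⁻¹' (Subtype.val '' t) : Set R.Ω) = t := fun t =>
    Set.preimage_image_eq t Subtype.val_injective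
  obtain ⟨t, hst, htm, ht⟩ := @exists_measurable_superset_of_null _ R.F R.μ s hs
  have htE : R.Event (Subtype.val '' t) := ⟨by simp, by rw [himg]; exact htm⟩
  have ht0 : P.prob (Subtype.val '' t ∩ P.Ω) = 0 := by
    rw [← hp _ htE]
    unfold prob
    rw [himg]
    exact ht
  have hsE : P.Event (Subtype.val '' s ∩ P.Ω) := by
    refine ⟨Set.inter_subset_right, hP.out' _ ?_⟩
    let _ := P.F
    refine measure_mono_null (fun x hx => ?_) ht0
    exact ⟨Set.image_mono hst hx.1, x.2⟩
  have := ((hE _).2 hsE).2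
  rwa [himg] at this

section directSum

variable {ι : Type} {q : PMF ι} {Q : ι → PSpace S} {R : PSpace S}

theorem IsDirectSum.event_inter (h : IsDirectSum q Q R) {i : ι} (hi : i ∈ q.support)
    {A : Set (Mem S)} (hA : (Q i).Event (A ∩ (Q i).Ω)) : R.Event (A ∩ (Q i).Ω) := by
  obtain ⟨hd, hΩ, hE, -⟩ := h
  rw [hE]
  refine ⟨fun x hx => ?_, fun j hj => ?_⟩
  · rw [hΩ]
    exact ⟨i, hi, hx.2⟩
  · by_cases hij : i = j
    · subst hij
      rwa [Set.inter_assoc, Set.inter_self]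
    · rw [Set.inter_assoc, (hd i hi j hj hij).inter_eq, Set.inter_empty]
      let _ := (Q j).F
      exact ⟨Set.empty_subset _, by rw [Set.preimage_empty]; exact MeasurableSet.empty⟩

theorem IsDirectSum.prob_inter (h : IsDirectSum q Q R) {i : ι} (hi : i ∈ q.support)
    {A : Set (Mem S)} (hA : (Q i).Event (A ∩ (Q i).Ω)) :
    R.prob (A ∩ (Q i).Ω) = q i * (Q i).prob (A ∩ (Q i).Ω) := by
  have hE := h.event_inter hi hA
  obtain ⟨hd, hΩ, -, hp⟩ := h
  rw [hp _ hE, tsum_eq_single i, Set.inter_assoc, Set.inter_self]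
  intro j hji
  by_cases hj : j ∈ q.support
  · rw [Set.inter_assoc, (hd i hi j hj hji.symm).inter_eq, Set.inter_empty]
    unfold prob
    rw [Set.preimage_empty, measure_empty, mul_zero]
  · rw [(PMF.apply_eq_zero_iff _ _).2 hj, zero_mul]

/-- A distribution that refines a direct sum is the corresponding mixture of conditional
distributions. -/
theorem IsDirectSum.exists_mixture (h : IsDirectSum q Q R) {ν : PMF (Mem V)} (hSV : S ⊆ V)
    (hR : ∀ A, R.Event A → R.prob A = ν.toOuterMeasure (proj hSV ⁻¹' A)) :
    ∃ m : ι → PMF (Mem V), ν = q.bind m ∧ ∀ i ∈ q.support, ∀ B,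
      q i * (m i).toOuterMeasure B = ν.toOuterMeasure (proj hSV ⁻¹' (Q i).Ω ∩ B) := by
  have hmass : ∀ i ∈ q.support, ν.toOuterMeasure (proj hSV ⁻¹' (Q i).Ω) = q i := by
    intro i hi
    have hE : (Q i).Event ((Q i).Ω ∩ (Q i).Ω) := by
      rw [Set.inter_self]
      exact (Q i).event_Ω
    have := h.prob_inter hi hE
    rw [hR _ (h.event_inter hi hE), Set.inter_self, prob_Ω, mul_one] at this
    exact this
  have hex : ∀ i, ∃ m : PMF (Mem V), i ∈ q.support →
      ∀ x, q i * m x = (proj hSV ⁻¹' (Q i).Ω).indicator ν x := by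
    intro i
    by_cases hi : i ∈ q.support
    · have hs : ∑' x, (proj hSV ⁻¹' (Q i).Ω).indicator ν x = q i := by
        rw [← PMF.toOuterMeasure_apply, hmass i hi]
      have h0 : q i ≠ 0 := (PMF.mem_support_iff _ _).1 hi
      refine ⟨PMF.normalize ((proj hSV ⁻¹' (Q i).Ω).indicator ν) (by rwa [hs])
        (by rw [hs]; exact PMF.apply_ne_top _ _), fun _ x => ?_⟩
      rw [PMF.normalize_apply, hs, mul_comm, mul_assoc,
        ENNReal.inv_mul_cancel h0 (PMF.apply_ne_top _ _), mul_one]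
    · exact ⟨ν, fun h => (hi h).elim⟩
  choose m hm using hex
  refine ⟨m, ?_, fun i hi B => ?_⟩
  · have hone : ν.toOuterMeasure (proj hSV ⁻¹' R.Ω) = 1 := by
      rw [← hR _ R.event_Ω, prob_Ω]
    rw [PMF.toOuterMeasure_apply_eq_one_iff] at hone
    ext x
    rw [PMF.bind_apply]
    by_cases hx : x ∈ ν.support
    · have hxR : proj hSV x ∈ R.Ω := hone hx
      rw [h.2.1] at hxR
      obtain ⟨i, hi, hxi⟩ := hxR
      rw [tsum_eq_single i, hm i hi, Set.indicator_of_mem (Set.mem_preimage.2 hxi)]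
      intro j hji
      by_cases hj : j ∈ q.support
      · rw [hm j hj, Set.indicator_of_notMem]
        exact Set.disjoint_left.1 (h.1 i hi j hj hji.symm) hxi
      · rw [(PMF.apply_eq_zero_iff _ _).2 hj, zero_mul]
    · rw [(PMF.apply_eq_zero_iff _ _).2 hx]
      symm
      rw [ENNReal.tsum_eq_zero]
      intro i
      by_cases hi : i ∈ q.support
      · rw [hm i hi]
        exact Set.indicator_apply_eq_zero.2 fun _ => (PMF.apply_eq_zero_iff _ _).2 hx
      · rw [(PMF.apply_eq_zero_iff _ _).2 hi, zero_mul]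
  · rw [PMF.toOuterMeasure_apply, PMF.toOuterMeasure_apply, ← ENNReal.tsum_mul_left]
    refine tsum_congr fun x => ?_
    by_cases hx : x ∈ B
    · rw [Set.indicator_of_mem hx, hm i hi]
      by_cases hx' : x ∈ proj hSV ⁻¹' (Q i).Ω
      · rw [Set.indicator_of_mem hx', Set.indicator_of_mem (Set.mem_inter hx' hx)]
      · rw [Set.indicator_of_notMem hx', Set.indicator_of_notMem fun h => hx' h.1]
    · rw [Set.indicator_of_notMem hx, Set.indicator_of_notMem fun h => hx h.2, mul_zero]

end directSum

end PSpace


/-! ## Executions of the loop body -/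

section body

variable {Γ : Ctx} {I : Pure} {φ ψ : Assertion} {b : Test} {C : Cmd} {V : Finset Var}

theorem eval_eq_of_law {r : Bool} {T : Finset Var} {P : PSpace T} {ν : PMF (Mem V)}
    (hP : (Assertion.sure (.testIs b r)).Sat Γ P) (hlaw : P.Law ν) :
    ∀ σ ∈ ν.support, b.eval σ = some r := by
  obtain ⟨hT, hlaw⟩ := hlaw
  obtain ⟨hE, h1⟩ := hP
  rw [hlaw _ hE, PMF.toOuterMeasure_apply_eq_one_iff] at h1
  exact fun σ hσ => Pure.sat_testIs (Pure.sat_of_proj hT _ Γ σ (h1 hσ))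

theorem eval_eq_true_of_sat (hpair : InvariantPair φ ψ b C I) {μ : PMF (Mem V)}
    (h : (φ.withInv I).Sat Γ (PSpace.ofPMF μ)) : ∀ σ ∈ μ.support, b.eval σ = some true := by
  obtain ⟨U₁, U₂, W, P₁, P₂, P', hM₁, -, hprod, hle, hφ, -⟩ := h
  exact eval_eq_of_law (hpair.enter Γ U₁ P₁ hM₁ hφ)
    (PSpace.IsProd.law_left hprod (hle.law (PSpace.law_ofPMF μ)))

/-- Distributions on final memories of the loop. -/
structure IsExit (Γ : Ctx) (I : Pure) (ψ : Assertion) (b : Test) (ν : PMF (Mem V)) : Prop where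
  eval_eq : ∀ σ ∈ ν.support, b.eval σ = some false
  prob_eq : ∀ (U : Finset Var) (Q : PSpace U), ψ.IsSmallest Γ Q → ∀ A, Q.Event A →
    ν.toOuterMeasure (PSpace.star V A (I.semFv Γ)) = Q.prob A

/-- Conditioning on a summand of the direct sum preserves the independence from the invariant part,
because the sample space of the summand is an event on the side of `P₁`. So each conditional
distribution satisfies its own assertion together with the invariant. In the exit summand, the
smallest space satisfying ψ fixes the probabilities. -/
theorem exists_mixture_of_sat_nd (hI : I.Finitary) (hpair : InvariantPair φ ψ b C I)
    {U : Finset Var} {Q : PSpace U} {ν : PMF (Mem V)} (hlaw : Q.Law ν)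
    (hQ : ((Assertion.nd φ ψ).withInv I).Sat Γ Q) :
    ∃ (q : PMF Bool) (m : Bool → PMF (Mem V)), ν = q.bind m ∧
      (true ∈ q.support → (φ.withInv I).Sat Γ (PSpace.ofPMF (m true))) ∧
      (false ∈ q.support → IsExit Γ I ψ b (m false)) := by
  obtain ⟨U₁, U₂, W, P₁, P₂, P', hM₁, hM₂, hprod, hle, ⟨q, T, Qs, R, hQs, hsum, hR⟩, hsure⟩ := hQ
  have hprod' : PSpace.IsProd P₁ P₂ P' := hprod
  have hlaw' := hle.law hlaw
  have hlaw₁ := hprod'.law_left hlaw'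
  obtain ⟨hTV, hlawR⟩ := hR.law hlaw₁
  obtain ⟨hU₂V, -⟩ := hprod'.law_right hlaw'
  have hd : Disjoint T U₂ := hprod'.1.mono_left hR.exists_event.choose
  obtain ⟨m, hm, hmass⟩ := hsum.exists_mixture hTV hlawR
  have key : ∀ i ∈ q.support, ∀ Q', (Qs i).IsComp Q' → ∀ A B, Q'.Event A → P₂.Event B →
      Q'.prob A * P₂.prob B = (m i).toOuterMeasure (proj hTV ⁻¹' A ∩ proj hU₂V ⁻¹' B) := by
    intro i hi Q' hQ' A B hA hB
    have h0 : q i ≠ 0 := (PMF.mem_support_iff _ _).1 hi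
    have hE := (hQ'.2.1 A).1 hA
    -- Multiplying by the weight `q i` turns the claim about the conditional distribution into
    -- independence under `ν` itself.
    refine (ENNReal.mul_right_inj h0 (PMF.apply_ne_top q i)).1 ?_
    rw [hmass i hi, hQ'.2.2 A hA, ← mul_assoc, ← hsum.prob_inter hi hE,
      hprod'.indep hlaw' hR hTV hU₂V (hsum.event_inter hi hE) hB]
    congr 1
    rw [Set.preimage_inter, Set.inter_assoc, Set.inter_left_comm]
  have hlawQ : ∀ i ∈ q.support, ∀ Q', (Qs i).IsComp Q' → Q'.Law (m i) := by
    intro i hi Q' hQ'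
    refine ⟨hTV, fun A hA => ?_⟩
    have := key i hi Q' hQ' A _ hA P₂.event_Ω
    rwa [PSpace.prob_Ω, mul_one, hM₂.1, Set.preimage_univ, Set.inter_univ] at this
  refine ⟨q, m, hm, fun hi => ?_, fun hi => ?_⟩
  · obtain ⟨hc, Q', hQ', hsat⟩ := hQs true hi
    have hsat' : φ.Sat Γ Q' := by simpa using hsat
    have hM := hQ'.model hc
    obtain ⟨R', hR', hle'⟩ := PSpace.exists_isProd hM.1 hM₂.1 hd hTV hU₂V (key true hi Q' hQ')
    exact ⟨T, U₂, _, Q', P₂, R', hM, hM₂, hR', hle', hsat', hsure⟩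
  · obtain ⟨hc, Q', hQ', hsat⟩ := hQs false hi
    have hsat' : ψ.Sat Γ Q' := by simpa using hsat
    have hM := hQ'.model hc
    have hlQ := hlawQ false hi Q' hQ'
    refine ⟨eval_eq_of_law (hpair.exit Γ T Q' hM hsat') hlQ, fun U' Q'' hQ'' A hA => ?_⟩
    have hle'' := hQ''.2.2 T Q' hM hsat'
    obtain ⟨hU'T, -⟩ := hle''.exists_event
    obtain ⟨hU'V, hl⟩ := hle''.law hlQ
    -- The invariant holds almost surely after conditioning too, so intersecting with it turns the
    -- preimage of `A` into the joined event without changing its probability.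
    have hinv : (m false).toOuterMeasure {σ | ∃ h : I.fv ⊆ V, proj h σ ∈ I.semFv Γ} = 1 := by
      have h1 := key false hi Q' hQ' _ _ Q'.event_Ω hsure.1
      rw [PSpace.prob_Ω, hsure.2, one_mul] at h1
      rw [PMF.toOuterMeasure_apply_eq_one_iff]
      intro σ hσ
      have h2 := (PMF.toOuterMeasure_apply_eq_one_iff _ _).1 h1.symm hσ
      exact ⟨(hI.fv_subset h2.2).trans hU₂V, hI.proj_mem_semFv h2.2⟩
    -- The joined event is empty unless the variable sets are disjoint. A memory satisfying `I`
    -- exists, since ⌈I⌉ has probability one, and it carries all free variables of `I` because `I`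
    -- is finitary.
    have hd' : Disjoint U' I.fv := by
      obtain ⟨τ, hτ⟩ : (I.sem Γ U₂).Nonempty := by
        by_contra hne
        rw [Set.not_nonempty_iff_eq_empty] at hne
        have h2 := hsure.2
        rw [hne] at h2
        simp [PSpace.prob] at h2
      exact hd.mono hU'T (hI.fv_subset hτ)
    rw [hl A hA, ← toOuterMeasure_inter_of_one (A := proj hU'V ⁻¹' A) _ hinv]
    congr 1
    ext σ
    exact ⟨fun ⟨_, _, hT, h₁, h₂⟩ => ⟨h₁, hT, h₂⟩, fun ⟨h₁, hT, h₂⟩ => ⟨hd', hU'V, hT, h₁, h₂⟩⟩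

/-- A frame on no variables allows the triple for the body to be applied to the full distribution on
memories. -/
theorem combine_trivial_frame (μ : PMF (Mem V)) :
    Combine .weak (PSpace.ofPMF μ)
      (PSpace.ofPMF (μ.map (proj (Finset.empty_subset V)))) (PSpace.ofPMF μ) := by
  have hproj : ∀ {S : Finset Var} (h : S ⊆ V),
      (PSpace.ofPMF μ).IsProj (PSpace.ofPMF (μ.map (proj h))) := by
    intro S h
    refine ⟨h, (Set.image_univ_of_surjective (proj_surjective h)).symm, fun A => ?_, fun A _ => ?_⟩
    · refine ⟨fun _ => ⟨proj h ⁻¹' A, PSpace.event_ofPMF _ _,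
        Set.image_preimage_eq A (proj_surjective h)⟩, fun _ => PSpace.event_ofPMF _ _⟩
    · refine ⟨PSpace.event_ofPMF _ _, ?_⟩
      rw [PSpace.prob_ofPMF, PSpace.prob_ofPMF, PMF.toOuterMeasure_map_apply]
      congr 1
      ext σ
      exact ⟨fun hσ => ⟨Finset.disjoint_sdiff, h, Finset.sdiff_subset, hσ, σ, trivial, rfl⟩,
        fun ⟨_, _, _, hσ, _⟩ => hσ⟩
  refine ⟨Finset.disjoint_empty_right V, (Finset.union_empty V).symm, ?_, hproj _⟩
  have := hproj (subset_refl V)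
  rwa [show (proj (subset_refl V) : Mem V → Mem V) = id from rfl, PMF.map_id] at this

theorem exists_mixture_of_mem_bindPMF (hI : I.Finitary) (hpair : InvariantPair φ ψ b C I)
    {μ : PMF (Mem V)} (hμ : (φ.withInv I).Sat Γ (PSpace.ofPMF μ)) {ν : PMF (Option (Mem V))}
    (hν : ν ∈ CSet.bindPMF (lin (I.semFv Γ) C) μ) :
    ∃ (q : PMF Bool) (m : Bool → PMF (Mem V)), ν = (q.bind m).map some ∧
      (true ∈ q.support → (φ.withInv I).Sat Γ (PSpace.ofPMF (m true))) ∧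
      (false ∈ q.support → IsExit Γ I ψ b (m false)) := by
  obtain ⟨U', W', Q, Q', ν', -, ⟨-, -, hQ, -⟩, rfl, hle, hsat⟩ :=
    hpair.body Γ V μ V ∅ V _ _ _ (PSpace.model_ofPMF μ) (PSpace.model_ofPMF _)
      (combine_trivial_frame μ) (PSpace.law_ofPMF μ).le_ofPMF hμ ν hν
  obtain ⟨q, m, rfl, h⟩ := exists_mixture_of_sat_nd hI hpair
    (hQ.law (hle.law (PSpace.law_ofPMF ν'))) hsat
  exact ⟨q, m, rfl, h⟩

end body


/-! ## Executions of the loop -/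

theorem CSet.mem_bindPMF {X Y : Type} {f : X → CSet Y} {μ : PMF X} {ρ : PMF (Option Y)} :
    ρ ∈ CSet.bindPMF f μ ↔
      ∃ κ : X → PMF (Option Y), (∀ x ∈ μ.support, κ x ∈ f x) ∧ ρ = μ.bind κ := by
  constructor
  · rintro ⟨_, rfl, κ, hκ, rfl⟩
    refine ⟨κ ∘ some, fun x hx => hκ (some x) ?_, PMF.bind_map _ _ _⟩
    exact (PMF.mem_support_map_iff _ _ _).2 ⟨x, hx, rfl⟩
  · rintro ⟨κ, hκ, rfl⟩
    refine ⟨_, rfl, fun o => o.elim (PMF.pure none) κ, ?_, by rw [PMF.bind_map]; rfl⟩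
    intro o ho
    obtain ⟨x, hx, rfl⟩ := (PMF.mem_support_map_iff _ _ _).1 ho
    exact hκ x hx

theorem CSet.bindPMF_mono {X Y : Type} {f g : X → CSet Y} {μ : PMF X}
    (h : ∀ x ∈ μ.support, f x ⊆ g x) : CSet.bindPMF f μ ⊆ CSet.bindPMF g μ := by
  intro ρ hρ
  obtain ⟨κ, hκ, rfl⟩ := CSet.mem_bindPMF.1 hρ
  exact CSet.mem_bindPMF.2 ⟨κ, fun x hx => h x hx (hκ x hx), rfl⟩

/-- The probability of ending in `A`. -/
noncomputable def termProb {X : Type} (ρ : PMF (Option X)) (A : Set X) : ℝ≥0∞ :=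
  ρ.toOuterMeasure (some '' A)

theorem termProb_eq_tsum {X : Type} (ρ : PMF (Option X)) (A : Set X) :
    termProb ρ A = ∑' x, A.indicator (fun x => ρ (some x)) x := by
  rw [termProb, PMF.toOuterMeasure_apply, tsum_option_eq, Set.indicator_of_notMem (by simp),
    zero_add]
  refine tsum_congr fun x => ?_
  by_cases hx : x ∈ A
  · rw [Set.indicator_of_mem (Set.mem_image_of_mem _ hx), Set.indicator_of_mem hx]
  · rw [Set.indicator_of_notMem (by simpa using hx), Set.indicator_of_notMem hx]

theorem none_add_termProb {X : Type} (ρ : PMF (Option X)) : ρ none + termProb ρ Set.univ = 1 := by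
  rw [termProb_eq_tsum, Set.indicator_univ, none_add_tsum_some]

theorem termProb_le_one {X : Type} (ρ : PMF (Option X)) (A : Set X) : termProb ρ A ≤ 1 :=
  toOuterMeasure_le_one _ _

theorem termProb_mono {X : Type} {ρ ρ' : PMF (Option X)} (h : ∀ x, ρ (some x) ≤ ρ' (some x))
    (A : Set X) : termProb ρ A ≤ termProb ρ' A := by
  rw [termProb_eq_tsum, termProb_eq_tsum]
  exact ENNReal.tsum_le_tsum fun x => Set.indicator_le_indicator (h x)

theorem termProb_pure_none {X : Type} (A : Set X) :
    termProb (PMF.pure (none : Option X)) A = 0 := by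
  rw [termProb_eq_tsum, ENNReal.tsum_eq_zero]
  intro x
  exact Set.indicator_apply_eq_zero.2 fun _ => by simp

theorem termProb_map_some {X : Type} (μ : PMF X) (A : Set X) :
    termProb (μ.map some) A = μ.toOuterMeasure A := by
  rw [termProb, PMF.toOuterMeasure_map_apply,
    Set.preimage_image_eq _ (Option.some_injective X)]

theorem map_some_none {X : Type} (μ : PMF X) : (μ.map some) none = 0 := by
  rw [PMF.apply_eq_zero_iff, PMF.mem_support_map_iff]
  simp

/-- `LimTo` alone lets mass escape from infinite events. The common bound `ρ₀` excludes this, by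
dominated convergence. -/
theorem LimTo.tendsto_termProb {X : Type} {ρ : ℕ → PMF (Option X)} {ρ' ρ₀ : PMF (Option X)}
    (h : LimTo ρ ρ') (hle : ∀ n x, ρ n (some x) ≤ ρ₀ (some x)) (A : Set X) :
    Tendsto (fun n => termProb (ρ n) A) (hyperfilter ℕ : Filter ℕ) (𝓝 (termProb ρ' A)) := by
  have hne : ∀ (ρ : PMF (Option X)), termProb ρ A ≠ ∞ := fun ρ =>
    ne_top_of_le_ne_top ENNReal.one_ne_top (termProb_le_one ρ A)
  have hreal : ∀ (ρ : PMF (Option X)), (termProb ρ A).toReal =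
      ∑' x, A.indicator (fun x => (ρ (some x)).toReal) x := by
    intro ρ
    rw [termProb_eq_tsum, ENNReal.tsum_toReal_eq]
    · refine tsum_congr fun x => ?_
      by_cases hx : x ∈ A <;> simp [hx]
    · intro x
      exact ne_top_of_le_ne_top (PMF.apply_ne_top ρ (some x)) (Set.indicator_le_self _ _ x)
  rw [← ENNReal.tendsto_toReal_iff (fun n => hne _) (hne _)]
  simp only [hreal]
  refine tendsto_tsum_of_dominated_convergence (bound := fun x => (ρ₀ (some x)).toReal) ?_ ?_
    (.of_forall fun n x => ?_)
  · refine ENNReal.summable_toReal (ne_top_of_le_ne_top ENNReal.one_ne_top ?_)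
    rw [← none_add_tsum_some ρ₀]
    exact le_add_self
  · intro x
    by_cases hx : x ∈ A
    · simp only [Set.indicator_of_mem hx]
      exact (ENNReal.tendsto_toReal (PMF.apply_ne_top _ _)).comp (h x)
    · simp only [Set.indicator_of_notMem hx]
      exact tendsto_const_nhds
  · by_cases hx : x ∈ A
    · rw [Set.indicator_of_mem hx, Real.norm_of_nonneg ENNReal.toReal_nonneg]
      exact ENNReal.toReal_mono (PMF.apply_ne_top _ _) (hle n x)
    · rw [Set.indicator_of_notMem hx, norm_zero]
      exact ENNReal.toReal_nonneg

-- Unfolding and truncation of loop outcomes.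

section loop

variable {Γ : Ctx} {I : Pure} {φ ψ : Assertion} {b : Test} {C : Cmd} {V : Finset Var}

/-- The first iteration of the loop. -/
theorem exists_unfold (hI : I.Finitary) (hpair : InvariantPair φ ψ b C I) {μ : PMF (Mem V)}
    (hμ : (φ.withInv I).Sat Γ (PSpace.ofPMF μ)) {ρ : PMF (Option (Mem V))}
    (hρ : ρ ∈ CSet.bindPMF (lin (I.semFv Γ) (.while b C)) μ) :
    ∃ (q : PMF Bool) (m : Bool → PMF (Mem V)) (ρ₁ : PMF (Option (Mem V))),
      (q.bind m).map some ∈ CSet.bindPMF (lin (I.semFv Γ) C) μ ∧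
      ρ = q.bind (fun r => if r then ρ₁ else (m false).map some) ∧
      (true ∈ q.support → (φ.withInv I).Sat Γ (PSpace.ofPMF (m true)) ∧
        ρ₁ ∈ CSet.bindPMF (lin (I.semFv Γ) (.while b C)) (m true)) ∧
      (false ∈ q.support → IsExit Γ I ψ b (m false)) := by
  have hb := eval_eq_true_of_sat hpair hμ
  obtain ⟨ν, hν, κ, hκ, rfl⟩ := CSet.subset_bind_bind (fun τ => sigmaConvex_lin _ τ) _
    (CSet.bindPMF_mono (fun σ hσ => lin_while_subset_bind (hI Γ) (hb σ hσ)) hρ)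
  obtain ⟨q, m, rfl, ht, hf⟩ := exists_mixture_of_mem_bindPMF hI hpair hμ hν
  have hκ' : ∀ i ∈ q.support, ∀ σ ∈ (m i).support,
      κ (some σ) ∈ lin (I.semFv Γ) (.while b C) σ := fun i hi σ hσ =>
    hκ (some σ) ((PMF.mem_support_map_iff _ _ _).2
      ⟨σ, (PMF.mem_support_bind_iff _ _ _).2 ⟨i, hi, hσ⟩, rfl⟩)
  -- The witness `ρ₁` is the part of the continuation that starts in the component satisfying φ ∗
  -- ⌈I⌉; on the exit component the loop is the identity.
  refine ⟨q, m, (m true).bind (κ ∘ some), hν, ?_, fun hi => ⟨ht hi, ?_⟩, hf⟩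
  · rw [PMF.bind_map, PMF.bind_bind]
    refine bind_congr_support fun i hi => ?_
    cases i with
    | true => rfl
    | false =>
      simp only [Bool.false_eq_true, if_false]
      exact bind_congr_support fun σ hσ =>
        lin_while_subset_eta ((hf hi).eval_eq σ hσ) (hκ' _ hi σ hσ)
  · exact CSet.mem_bindPMF.2 ⟨_, fun σ hσ => hκ' true hi σ hσ, rfl⟩

/-- Converse of `exists_unfold` for bounded fuel: the continuation `ρ₁` may be replaced by any
approximate outcome, such as a truncated one. -/
theorem mixture_mem_bindPMF_approx (hpair : InvariantPair φ ψ b C I) {μ : PMF (Mem V)}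
    (hμ : (φ.withInv I).Sat Γ (PSpace.ofPMF μ)) {q : PMF Bool} {m : Bool → PMF (Mem V)} {n : ℕ}
    (hq : (q.bind m).map some ∈ CSet.bindPMF (lin (I.semFv Γ) C) μ)
    {ρ₁ : PMF (Option (Mem V))}
    (ht : true ∈ q.support → (φ.withInv I).Sat Γ (PSpace.ofPMF (m true)) ∧
      ρ₁ ∈ CSet.bindPMF ((Cmd.while b C).approx (I.semFv Γ) n) (m true))
    (hf : false ∈ q.support → IsExit Γ I ψ b (m false)) :
    q.bind (fun r => if r then ρ₁ else (m false).map some) ∈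
      CSet.bindPMF ((Cmd.while b C).approx (I.semFv Γ) (n + 1)) μ := by
  classical
  have hb := eval_eq_true_of_sat hpair hμ
  refine CSet.bindPMF_mono (fun σ hσ => bind_approx_subset_approx_while (hb σ hσ) n)
    (CSet.bind_bind_subset _ ⟨_, hq, ?_⟩)
  obtain ⟨κ, hκ⟩ : ∃ κ : Mem V → PMF (Option (Mem V)), true ∈ q.support →
      (∀ σ ∈ (m true).support, κ σ ∈ (Cmd.while b C).approx (I.semFv Γ) n σ) ∧
        ρ₁ = (m true).bind κ := by
    by_cases hi : true ∈ q.support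
    · obtain ⟨κ, hκ⟩ := CSet.mem_bindPMF.1 (ht hi).2
      exact ⟨κ, fun _ => hκ⟩
    · exact ⟨fun _ => PMF.pure none, fun h => (hi h).elim⟩
  -- A single kernel must serve both components; the value of the test tells them apart, as it is
  -- true on the first and false on the second.
  refine ⟨fun o => o.elim (PMF.pure none) fun σ =>
    if b.eval σ = some false then PMF.pure (some σ) else κ σ, fun o ho => ?_, ?_⟩
  · obtain ⟨σ, hσ, rfl⟩ := (PMF.mem_support_map_iff _ _ _).1 ho
    obtain ⟨i, hi, hσ⟩ := (PMF.mem_support_bind_iff _ _ _).1 hσ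
    change (if b.eval σ = some false then PMF.pure (some σ) else κ σ) ∈
      (Cmd.while b C).approx (I.semFv Γ) n σ
    split_ifs with he
    · exact eta_subset_approx_while he n rfl
    · cases i with
      | true => exact (hκ hi).1 σ hσ
      | false => exact (he ((hf hi).eval_eq σ hσ)).elim
  · rw [PMF.bind_map, PMF.bind_bind]
    refine bind_congr_support fun i hi => ?_
    cases i with
    | true =>
      simp only [if_true]
      rw [(hκ hi).2]
      refine bind_congr_support fun σ hσ => ?_
      simp [eval_eq_true_of_sat hpair (ht hi).1 σ hσ]
    | false =>
      simp only [Bool.false_eq_true, if_false]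
      refine bind_congr_support fun σ hσ => ?_
      simp [(hf hi).eval_eq σ hσ]

theorem termProb_mixture {X : Type} (q : PMF Bool) (f : Bool → PMF (Option X)) (A : Set X) :
    termProb (q.bind f) A = q false * termProb (f false) A + q true * termProb (f true) A := by
  rw [termProb, PMF.toOuterMeasure_bind_apply, tsum_bool]
  rfl

/-- `ρ'` is a truncation of the outcome `ρ` of the loop, whose proper outcomes are distributed as
prescribed by `ψ`. -/
structure IsTruncation (Γ : Ctx) (I : Pure) (φ ψ : Assertion) (b : Test) (C : Cmd)
    (ρ ρ' : PMF (Option (Mem V))) : Prop where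
  le : ∀ σ, ρ' (some σ) ≤ ρ (some σ)
  prob_eq : ∀ (U : Finset Var) (Q : PSpace U), ψ.IsSmallest Γ Q → ∀ A, Q.Event A →
    termProb ρ' (PSpace.star V A (I.semFv Γ)) = termProb ρ' Set.univ * Q.prob A
  -- The mass at `none` is what was cut off while still looping; there `ρ` continues as an outcome
  -- of the loop from an admissible distribution and terminates with probability at least `c`.
  add_le : ∀ c : ℝ≥0∞, (∀ μ : PMF (Mem V), (φ.withInv I).Sat Γ (PSpace.ofPMF μ) →
    ∀ ρ₀ ∈ CSet.bindPMF (lin (I.semFv Γ) (.while b C)) μ, c ≤ termProb ρ₀ Set.univ) →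
    termProb ρ' Set.univ + ρ' none * c ≤ termProb ρ Set.univ

/-- With no fuel the truncation is immediate divergence. With more, the first iteration of `ρ` is
kept and its looping part is truncated recursively; each of the three properties is compatible with
mixing. -/
theorem exists_truncation_approx (hI : I.Finitary) (hpair : InvariantPair φ ψ b C I) (n : ℕ)
    {μ : PMF (Mem V)} (hμ : (φ.withInv I).Sat Γ (PSpace.ofPMF μ)) {ρ : PMF (Option (Mem V))}
    (hρ : ρ ∈ CSet.bindPMF (lin (I.semFv Γ) (.while b C)) μ) :
    ∃ ρ' ∈ CSet.bindPMF ((Cmd.while b C).approx (I.semFv Γ) n) μ,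
      IsTruncation Γ I φ ψ b C ρ ρ' := by
  induction n generalizing μ ρ with
  | zero =>
    refine ⟨PMF.pure none, CSet.mem_bindPMF.2 ⟨fun _ => PMF.pure none, fun _ _ => trivial,
      (PMF.bind_const _ _).symm⟩, ⟨fun σ => by simp, fun U Q _ A _ => ?_, fun c hc => ?_⟩⟩
    · rw [termProb_pure_none, termProb_pure_none, zero_mul]
    · rw [termProb_pure_none, PMF.pure_apply, if_pos rfl, one_mul, zero_add]
      exact hc μ hμ ρ hρ
  | succ n ih =>
    obtain ⟨q, m, ρ₁, hq, rfl, ht, hf⟩ := exists_unfold hI hpair hμ hρ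
    obtain ⟨ρ₁', hρ₁'⟩ : ∃ ρ₁' : PMF (Option (Mem V)), true ∈ q.support →
        ρ₁' ∈ CSet.bindPMF ((Cmd.while b C).approx (I.semFv Γ) n) (m true) ∧
        IsTruncation Γ I φ ψ b C ρ₁ ρ₁' := by
      by_cases hi : true ∈ q.support
      · obtain ⟨ρ₁', h⟩ := ih (ht hi).1 (ht hi).2
        exact ⟨ρ₁', fun _ => h⟩
      · exact ⟨PMF.pure none, fun h => (hi h).elim⟩
    have hcase : ∀ {r : Bool} {x y : ℝ≥0∞}, (r ∈ q.support → x ≤ y) → q r * x ≤ q r * y := by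
      intro r x y h
      by_cases hr : r ∈ q.support
      · gcongr
        exact h hr
      · rw [(PMF.apply_eq_zero_iff _ _).2 hr, zero_mul, zero_mul]
    refine ⟨_, mixture_mem_bindPMF_approx hpair hμ hq (fun hi => ⟨(ht hi).1, (hρ₁' hi).1⟩) hf,
      ⟨fun σ => ?_, fun U Q hQ A hA => ?_, fun c hc => ?_⟩⟩
    · rw [PMF.bind_apply, PMF.bind_apply, tsum_bool, tsum_bool]
      exact add_le_add le_rfl (hcase fun hi => (hρ₁' hi).2.le σ)
    · simp only [termProb_mixture, Bool.false_eq_true, if_false, if_true, termProb_map_some]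
      rw [add_mul, mul_assoc, mul_assoc]
      have hone : (m false).toOuterMeasure Set.univ = 1 := by
        rw [PMF.toOuterMeasure_apply_eq_one_iff]
        exact Set.subset_univ _
      congr 1
      · refine le_antisymm (hcase fun hi => ?_) (hcase fun hi => ?_) <;>
          rw [(hf hi).prob_eq U Q hQ A hA, hone, one_mul]
      · exact le_antisymm (hcase fun hi => ((hρ₁' hi).2.prob_eq U Q hQ A hA).le)
          (hcase fun hi => ((hρ₁' hi).2.prob_eq U Q hQ A hA).ge)
    · simp only [termProb_mixture, Bool.false_eq_true, if_false, if_true]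
      rw [PMF.bind_apply, tsum_bool]
      simp only [Bool.false_eq_true, if_false, if_true, map_some_none, mul_zero, zero_add]
      rw [add_assoc, mul_assoc, ← mul_add]
      exact add_le_add le_rfl (hcase fun hi => (hρ₁' hi).2.add_le c hc)

theorem exists_truncation (hI : I.Finitary) (hpair : InvariantPair φ ψ b C I)
    {μ : PMF (Mem V)} (hμ : (φ.withInv I).Sat Γ (PSpace.ofPMF μ)) {ρ : PMF (Option (Mem V))}
    (hρ : ρ ∈ CSet.bindPMF (lin (I.semFv Γ) (.while b C)) μ) :
    ∃ ρ' ∈ CSet.bindPMF (lin (I.semFv Γ) (.while b C)) μ, IsTruncation Γ I φ ψ b C ρ ρ' := by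
  choose t htm ht using fun n => exists_truncation_approx hI hpair n hμ hρ
  obtain ⟨ρ', hlim⟩ := exists_limTo t
  have htend := hlim.tendsto_termProb (fun n => (ht n).le)
  have hmem : ρ' ∈ CSet.bindPMF (lin (I.semFv Γ) (.while b C)) μ := by
    have := CSet.mem_bind_iInter (f := fun n => (Cmd.while b C).approx (I.semFv Γ) n)
      (S := fun _ => {μ.map some}) (fun n τ => Cmd.limClosed_approx (hI Γ) _ n τ)
      (fun _ => CSet.limClosed_singleton _) (fun τ => Cmd.approx_antitone _ τ) antitone_const
      (.of_forall htm) hlim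
    rw [Set.iInter_const] at this
    simp only [← lin_eq_iInter] at this
    exact this
  refine ⟨ρ', hmem, fun σ => le_of_tendsto' (hlim σ) fun n => (ht n).le σ, fun U Q hQ A hA => ?_,
    fun c hc => ?_⟩
  · refine tendsto_nhds_unique (htend _) ?_
    simp only [fun n => (ht n).prob_eq U Q hQ A hA]
    exact ENNReal.Tendsto.mul_const (htend _) (Or.inr (Q.prob_ne_top A))
  · have hc1 : c ≤ 1 := (hc μ hμ ρ hρ).trans (termProb_le_one _ _)
    have hct : c ≠ ∞ := ne_top_of_le_ne_top ENNReal.one_ne_top hc1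
    -- The limit is controlled only at proper outcomes. Adding `c` times the termination probability
    -- eliminates the term at `none` from the inequality.
    have hbal : ∀ κ : PMF (Option (Mem V)),
        termProb κ Set.univ + κ none * c + termProb κ Set.univ * c = termProb κ Set.univ + c := by
      intro κ
      rw [add_assoc, ← add_mul, none_add_termProb, one_mul]
    have hW : termProb ρ' Set.univ * c ≠ ∞ := ENNReal.mul_ne_top
      (ne_top_of_le_ne_top ENNReal.one_ne_top (termProb_le_one _ _)) hct
    refine (ENNReal.add_le_add_iff_right hW).1 ?_
    rw [hbal]
    refine le_of_tendsto_of_tendsto' ((htend _).add_const c)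
      (tendsto_const_nhds.add (ENNReal.Tendsto.mul_const (htend _) (Or.inr hct))) fun n => ?_
    rw [← hbal]
    exact add_le_add ((ht n).add_le c hc) le_rfl

-- From truncations to minimum probabilities.

theorem bindPMF_lin_nonempty (hI : I.Finitary) (μ : PMF (Mem V)) :
    (CSet.bindPMF (lin (I.semFv Γ) (.while b C)) μ).Nonempty :=
  CSet.bind_nonempty (Set.singleton_nonempty _) fun σ => lin_nonempty (hI Γ) _ σ

theorem minProb_le {X : Type} {S : CSet X} {ρ : PMF (Option X)} (h : ρ ∈ S) (A : Set X) :
    minProb S A ≤ termProb ρ A := iInf₂_le ρ h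

theorem minProb_while (hI : I.Finitary) (hpair : InvariantPair φ ψ b C I)
    {μ : PMF (Mem V)} (hμ : (φ.withInv I).Sat Γ (PSpace.ofPMF μ)) {U : Finset Var} {Q : PSpace U}
    (hQ : ψ.IsSmallest Γ Q) {A : Set (Mem U)} (hA : Q.Event A) :
    minProb (CSet.bindPMF (lin (I.semFv Γ) (.while b C)) μ) (PSpace.star V A (I.semFv Γ)) =
      minTerm (CSet.bindPMF (lin (I.semFv Γ) (.while b C)) μ) * Q.prob A := by
  have hle : ∀ ρ ∈ CSet.bindPMF (lin (I.semFv Γ) (.while b C)) μ,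
      minProb (CSet.bindPMF (lin (I.semFv Γ) (.while b C)) μ) (PSpace.star V A (I.semFv Γ)) ≤
        termProb ρ Set.univ * Q.prob A := by
    intro ρ hρ
    obtain ⟨ρ', hρ', ht⟩ := exists_truncation hI hpair hμ hρ
    refine (minProb_le hρ' _).trans ?_
    rw [ht.prob_eq U Q hQ A hA]
    gcongr
    exact termProb_mono ht.le _
  refine le_antisymm ?_ (le_iInf₂ fun ρ hρ => ?_)
  -- Taking the infimum over `ρ` requires division by the probability of `A`. For a null event any
  -- single outcome gives the bound.
  · by_cases h0 : Q.prob A = 0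
    · obtain ⟨ρ, hρ⟩ := bindPMF_lin_nonempty (Γ := Γ) (b := b) (C := C) hI μ
      have := hle ρ hρ
      rw [h0, mul_zero] at this ⊢
      exact this
    · rw [← ENNReal.div_le_iff h0 (Q.prob_ne_top A)]
      exact le_iInf₂ fun ρ hρ => (ENNReal.div_le_iff h0 (Q.prob_ne_top A)).2 (hle ρ hρ)
  · obtain ⟨ρ', hρ', ht⟩ := exists_truncation hI hpair hμ hρ
    calc minTerm (CSet.bindPMF (lin (I.semFv Γ) (.while b C)) μ) * Q.prob A
        ≤ termProb ρ' Set.univ * Q.prob A := by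
          gcongr
          exact minProb_le hρ' _
      _ = termProb ρ' (PSpace.star V A (I.semFv Γ)) := (ht.prob_eq U Q hQ A hA).symm
      _ ≤ termProb ρ (PSpace.star V A (I.semFv Γ)) := termProb_mono ht.le _

theorem minTerm_le_one (hI : I.Finitary) (μ : PMF (Mem V)) :
    minTerm (CSet.bindPMF (lin (I.semFv Γ) (.while b C)) μ) ≤ 1 := by
  obtain ⟨ρ, hρ⟩ := bindPMF_lin_nonempty (Γ := Γ) (b := b) (C := C) hI μ
  exact (minProb_le hρ _).trans (termProb_le_one _ _)

theorem minTerm_while_eq_one (hI : I.Finitary) (hpair : InvariantPair φ ψ b C I) {p : ℝ≥0∞}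
    (hp : 0 < p) (h : ∀ μ : PMF (Mem V), (φ.withInv I).Sat Γ (PSpace.ofPMF μ) →
      p ≤ minTerm (CSet.bindPMF (lin (I.semFv Γ) (.while b C)) μ))
    {μ : PMF (Mem V)} (hμ : (φ.withInv I).Sat Γ (PSpace.ofPMF μ)) :
    minTerm (CSet.bindPMF (lin (I.semFv Γ) (.while b C)) μ) = 1 := by
  -- The infimum ranges over all admissible initial distributions, since the mass cut off by a
  -- truncation continues from distributions other than `μ`.
  set c : ℝ≥0∞ := ⨅ (μ : PMF (Mem V)) (_ : (φ.withInv I).Sat Γ (PSpace.ofPMF μ)),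
    minTerm (CSet.bindPMF (lin (I.semFv Γ) (.while b C)) μ) with hc
  have hcμ : c ≤ minTerm (CSet.bindPMF (lin (I.semFv Γ) (.while b C)) μ) := iInf₂_le μ hμ
  have hc1 : c ≤ 1 := hcμ.trans (minTerm_le_one hI μ)
  have hct : c ≠ ∞ := ne_top_of_le_ne_top ENNReal.one_ne_top hc1
  have hc0 : 0 < c.toReal := ENNReal.toReal_pos (hp.trans_le (le_iInf₂ h)).ne' hct
  have hlow : ∀ μ : PMF (Mem V), (φ.withInv I).Sat Γ (PSpace.ofPMF μ) →
      ∀ ρ ∈ CSet.bindPMF (lin (I.semFv Γ) (.while b C)) μ, c ≤ termProb ρ Set.univ :=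
    fun μ hμ ρ hρ => (iInf₂_le μ hμ).trans (minProb_le hρ _)
  have hkey : ENNReal.ofReal (2 * c.toReal - c.toReal ^ 2) ≤ c := by
    refine le_iInf₂ fun μ hμ => le_iInf₂ fun ρ hρ => ?_
    obtain ⟨ρ', hρ', ht⟩ := exists_truncation hI hpair hμ hρ
    have h1 := ht.add_le c hlow
    have h2 := hlow μ hμ ρ' hρ'
    have h3 := none_add_termProb ρ'
    have hfin : ∀ κ : PMF (Option (Mem V)), termProb κ Set.univ ≠ ∞ := fun κ =>
      ne_top_of_le_ne_top ENNReal.one_ne_top (termProb_le_one _ _)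
    have hn : ρ' none ≠ ∞ := PMF.apply_ne_top _ _
    change _ ≤ termProb ρ Set.univ
    refine ENNReal.ofReal_le_of_le_toReal ?_
    have h1' := ENNReal.toReal_mono (hfin ρ) h1
    rw [ENNReal.toReal_add (hfin _) (ENNReal.mul_ne_top hn hct), ENNReal.toReal_mul] at h1'
    have h2' := ENNReal.toReal_mono (hfin ρ') h2
    have h3' := congrArg ENNReal.toReal h3
    rw [ENNReal.toReal_add hn (hfin _), ENNReal.toReal_one] at h3'
    have hc1' : c.toReal ≤ 1 := by
      have := ENNReal.toReal_mono ENNReal.one_ne_top hc1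
      rwa [ENNReal.toReal_one] at this
    have h4 : (ρ' none).toReal = 1 - (termProb ρ' Set.univ).toReal := by linarith
    rw [h4] at h1'
    -- With `t` the termination probability of `ρ'`, the difference of `t + (1 - t) c` and `2c - c²`
    -- is `(t - c)(1 - c)`.
    nlinarith [mul_nonneg (sub_nonneg.2 h2') (sub_nonneg.2 hc1')]
  have hc1' : 1 ≤ c := by
    have h1 := (ENNReal.ofReal_le_iff_le_toReal hct).1 hkey
    have h2 : (1 : ℝ) ≤ c.toReal := by
      by_contra hlt
      push Not at hlt
      nlinarith [mul_pos hc0 (sub_pos.2 hlt)]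
    rw [← ENNReal.ofReal_one]
    exact ENNReal.ofReal_le_of_le_toReal h2
  exact le_antisymm (minTerm_le_one hI μ) (hc1'.trans hcμ)

end loop

end PCOL

theorem mainTheorem3 (Γ : PCOL.Ctx) (I : PCOL.Pure) (hI : I.Finitary) (φ ψ : PCOL.Assertion)
    (b : PCOL.Test) (C : PCOL.Cmd) (hpair : PCOL.InvariantPair φ ψ b C I)
    (V : Finset PCOL.Var) :
    (∀ (U : Finset PCOL.Var) (Q : PCOL.PSpace U), ψ.IsSmallest Γ Q →
      ∀ μ : PMF (PCOL.Mem V), (φ.withInv I).Sat Γ (PCOL.PSpace.ofPMF μ) →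
      ∀ A : Set (PCOL.Mem U), Q.Event A →
        PCOL.minProb (PCOL.CSet.bindPMF (PCOL.lin (I.semFv Γ) (.while b C)) μ)
            (PCOL.PSpace.star V A (I.semFv Γ)) =
          PCOL.minTerm (PCOL.CSet.bindPMF (PCOL.lin (I.semFv Γ) (.while b C)) μ) * Q.prob A) ∧
    (∀ p : ℝ≥0∞, 0 < p → p ≤ 1 →
      (∀ μ : PMF (PCOL.Mem V), (φ.withInv I).Sat Γ (PCOL.PSpace.ofPMF μ) →
        p ≤ PCOL.minTerm (PCOL.CSet.bindPMF (PCOL.lin (I.semFv Γ) (.while b C)) μ)) →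
      ∀ μ : PMF (PCOL.Mem V), (φ.withInv I).Sat Γ (PCOL.PSpace.ofPMF μ) →
        PCOL.minTerm (PCOL.CSet.bindPMF (PCOL.lin (I.semFv Γ) (.while b C)) μ) = 1) :=
  ⟨fun _ _ hQ _ hμ _ hA => PCOL.minProb_while hI hpair hμ hQ hA,
    fun _ hp _ h _ hμ => PCOL.minTerm_while_eq_one hI hpair hp h hμ⟩
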